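/- **Setting.** Let $P$ be a Markov decision process with measurable state and action spaces, rewards $|\mathcal R(s,a)|\le R$, discount factor $\gamma\in[0,1)$ and horizon $H$. Let $\pi_\theta(a\mid s)>0$, $\theta\in\mathbb R^q$, be a parameterized policy density, twice differentiable in $\theta$ with $\|\nabla_\theta\log\pi_\theta(a\mid s)\|\le G$ and $\|\nabla^2_\theta\log\pi_\theta(a\mid s)\|\le M$. Let $p_\theta$ be the induced law (and density) of trajectories $\tau=(s_0,a_0,\dots,s_{H-1},a_{H-1})$, $\mathcal R(\tau)=\sum_{t<H}\gamma^t\mathcal R(s_t,a_t)$, $J(\theta)=\mathbb E_{\tau\sim p_\theta}\mathcal R(\tau)$, $g(\tau\mid\theta)=\sum_{t<H}\nabla\log\pi_\theta(a_t\mid s_t)\,(\mathcal R(\tau)-b_t(s_t))$ with baselines $|b_t|\le b$, and $\omega(\tau\mid\theta_1,\theta_2)=p_{\theta_2}(\tau)/p_{\theta_1}(\tau)$. Let $Q:\mathbb R^q\to\mathbb R\cup\{+\infty\}$ be proper, closed and convex, $F=J-Q$, $F^*=\sup F<\infty$, $\mathcal G_\eta(\theta)=\eta^{-1}[\mathrm{prox}_{\eta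 Q}(\theta+\eta\nabla J(\theta))-\theta]$, and let $\theta_0$ satisfy $Q(\theta_0)<\infty$ and $F^*-F(\theta_0)\le D$. **Algorithm 1 (ProxHSPGA).** Put $v_0=\frac1N\sum g(\tau\mid\theta_0)$ over $N$ independent trajectories from $p_{\theta_0}$. For $1\le t\le m$ sample independent batches $\mathcal B_t,\widehat{\mathcal B}_t$ of $B$ independent trajectories each from $p_{\theta_t}$ and put $$v_t=\beta v_{t-1}+\tfrac{\beta}{B}\sum_{\tau\in\mathcal B_t}\big[g(\tau\mid\theta_t)-\omega(\tau\mid\theta_t,\theta_{t-1})g(\tau\mid\theta_{t-1})\big]+\tfrac{1-\beta}{B}\sum_{\tau\in\widehat{\mathcal B}_t}g(\tau\mid\theta_t).$$ For $0\le t\le m$ let $\theta_{t+1}=(1-\alpha)\theta_t+\alpha\,\mathrm{prox}_{\eta Q}(\theta_t+\eta v_t)$. **Algorithm 2 (restarting)** runs Algorithm 1 in $S$ stages, each stage starting from the last iterate $\theta_{m+1}$ of the previous one. **Parameters.** For constants $L,\sigma,\overline C,\tilde c,\hat c>0$ and $B\in\mathbb N_+$ let $$N=\big\lceil\tilde c\,\sigma^{8/3}[B(m+1)]^{1/3}\big\rceil,\quad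 \beta=1-\tfrac{\sqrt B}{\sqrt{N(m+1)}},\quad \alpha=\tfrac{\hat c\sqrt2\,B^{3/4}}{\sqrt{3\overline C}\,N^{1/4}(m+1)^{1/4}},\quad \eta=\tfrac{2}{4+L\alpha}.$$ **Claim.** Given $H$, $\gamma\in[0,1)$, $R,G,M,W>0$ and $b\ge0$, there are $L_0,\sigma_0,C_0>0$, depending only on these numbers, such that for all problems as above: * $J$ is differentiable, $\nabla J$ is $L_0$-Lipschitz, $\|g(\tau\mid\theta)-\nabla J(\theta)\|^2\le\sigma_0^2$ for all $\tau,\theta$, and $\mathbb E_{\tau\sim p_{\theta_1}}\|g(\tau\mid\theta_1)-\omega(\tau\mid\theta_1,\theta_2)g(\tau\mid\theta_2)\|^2\le C_0\|\theta_1-\theta_2\|^2$ whenever $\mathrm{Var}_{\tau\sim p_{\theta_1}}\omega(\tau\mid\theta_1,\theta_2)\le W$. * Let $L\ge L_0$, $\sigma\ge\sigma_0$, $\overline C\ge C_0$, $B\in\mathbb N_+$, $\tilde c>0$, $0<\hat c\le\min\{1,\sqrt{3\overline C/(2B)}\}$, $D\in\mathbb R$, and an upper bound $S_{\max}$ on the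 number of stages be fixed. For each of the two algorithms there is $\Psi_{\min}>0$ such that for every $\Psi_0\ge\Psi_{\min}$ there are $\varepsilon_0,T>0$ for which the following holds for all problems as above, all $\varepsilon>0$, and all $1\le S\le S_{\max}$ ($S=1$ for Algorithm 1). Choose $$m+1=\Big\lceil\frac{\Psi_0^{3/2}\sigma}{S\,B\,\varepsilon^3}\Big\rceil,$$ suppose that $\varepsilon\le\varepsilon_0$ or $B\le N(m+1)$, and that almost surely $\mathrm{Var}_{\tau\sim p_{\theta_t}}\omega(\tau\mid\theta_t,\theta_{t-1})\le W$ for all pairs $(\theta_t,\theta_{t-1})$, $1\le t\le m$, that the algorithm encounters. Then $$\mathbb E\|\mathcal G_\eta(\tilde\theta_T)\|^2\le\varepsilon^2,$$ where $\tilde\theta_T$ is uniform on $\{\theta_t\}_{t=0}^m$ (or, if $m\ge1$, on $\{\theta_t\}_{t=1}^m$) for Algorithm 1 and uniform on $\{\theta_t^{(s)}\}_{0\le t\le m,\ 0\le s<S}$ for Algorithm 2. If $\varepsilon\le1$, the whole run samples at most $T\varepsilon^{-3}$ trajectories and performs at most $T\varepsilon^{-3}$ proximal steps. The constants $\Psi_{\min},\varepsilon_0,T$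 do not depend on the problem, on $q$ or on $\varepsilon$. -/

import Mathlib

open MeasureTheory ProbabilityTheory

noncomputable section

namespace HSPG

/-- The parameter space `ℝ^q` with its Euclidean norm. -/
abbrev Param (q : ℕ) : Type := EuclideanSpace ℝ (Fin q)

/-- Trajectories `(s₀, a₀, …, s_{H-1}, a_{H-1})`. -/
abbrev Traj (S : Type*) (A : Type*) (H : ℕ) : Type _ := Fin H → S × A

/-- A Markov decision process with a policy `π_θ(· | s)`, `θ ∈ ℝ^q`, given by positive densities with
respect to a reference measure on the actions, and a baseline that may depend on the time and on the
current state. -/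
structure Model (S : Type*) (A : Type*) [MeasurableSpace S] [MeasurableSpace A] (q H : ℕ) where
  /-- transition probabilities -/
  trans : Kernel (S × A) S
  trans_markov : IsMarkovKernel trans
  /-- initial state distribution -/
  start : Measure S
  start_prob : IsProbabilityMeasure start
  /-- immediate reward -/
  reward : S → A → ℝ
  measurable_reward : Measurable fun z : S × A => reward z.1 z.2
  /-- discount factor -/
  discount : ℝ
  /-- reference measure on the action space -/
  ref : Measure A
  ref_sigmaFinite : SigmaFinite ref
  /-- policy density: `dens θ s a` is `π_θ(a | s)` -/
  dens : Param q → S → A → ℝ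
  dens_pos : ∀ θ s a, 0 < dens θ s a
  measurable_dens : Measurable fun z : Param q × S × A => dens z.1 z.2.1 z.2.2
  lintegral_dens : ∀ θ s, ∫⁻ a, ENNReal.ofReal (dens θ s a) ∂ref = 1
  /-- baseline: `baseline t s` is subtracted at time `t` in state `s` -/
  baseline : Fin H → S → ℝ
  measurable_baseline : ∀ t, Measurable (baseline t)

section Proximal

variable {q : ℕ}

/-- `prox_f(x)`, the minimizer of `y ↦ f(y) + ‖y - x‖² / 2`. -/
def prox (f : Param q → EReal) (x : Param q) : Param q :=
  Classical.epsilon fun p : Param q =>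
    ∀ y : Param q, f p + ((‖p - x‖ ^ 2 / 2 : ℝ) : EReal) ≤ f y + ((‖y - x‖ ^ 2 / 2 : ℝ) : EReal)

/-- `prox_{ηQ}(x)`. -/
def proxStep (η : ℝ) (Q : Param q → EReal) (x : Param q) : Param q :=
  prox (fun y => (η : EReal) * Q y) x

/-- A proper, closed, convex function `ℝ^q → ℝ ∪ {+∞}`. -/
structure ProperClosedConvex (Q : Param q → EReal) : Prop where
  ne_bot : ∀ θ, Q θ ≠ ⊥
  exists_ne_top : ∃ θ, Q θ ≠ ⊤
  closed : LowerSemicontinuous Q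
  convex : Convex ℝ {z : Param q × ℝ | Q z.1 ≤ (z.2 : EReal)}

end Proximal

/-- The inputs of the algorithm: number `m` of iterations after the first, size `N` of the first batch,
size `B` of both mini-batches, and the step-sizes. -/
structure Config where
  m : ℕ
  N : ℕ
  B : ℕ
  β : ℝ
  α : ℝ
  η : ℝ

/-- The step-sizes `β`, `α`, `η` and the size `N = c̃ σ^{8/3} [B(m+1)]^{1/3}` (rounded up) of the first
batch, as functions of `B` and `m`. -/
def config (L σ C c' ĉ : ℝ) (B m : ℕ) : Config :=
  let N : ℕ := ⌈c' * σ ^ (8 / 3 : ℝ) * ((B : ℝ) * (m + 1)) ^ (1 / 3 : ℝ)⌉₊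
  let α : ℝ := ĉ * √2 * (B : ℝ) ^ (3 / 4 : ℝ) /
    (√(3 * C) * (N : ℝ) ^ (1 / 4 : ℝ) * ((m : ℝ) + 1) ^ (1 / 4 : ℝ))
  { m := m
    N := N
    B := B
    β := 1 - √(B : ℝ) / √((N : ℝ) * (m + 1))
    α := α
    η := 2 / (4 + L * α) }

/-- What the algorithm keeps: `(θ_t, v_t, θ_{t+1})`, and two counters, the number of trajectories
sampled so far and the number of proximal steps performed so far. -/
abbrev State (q : ℕ) : Type := (Param q × Param q × Param q) × ℕ × ℕ

namespace Model

variable {S A : Type*} [MeasurableSpace S] [MeasurableSpace A] {q H : ℕ} (P : Model S A q H)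

/-- The total discounted reward `ℛ(τ)`. -/
def ret (τ : Traj S A H) : ℝ :=
  ∑ t : Fin H, P.discount ^ (t : ℕ) * P.reward (τ t).1 (τ t).2

/-- From `(s, a)`: `s' ∼ trans (s, a)`, and `a'` "distributed" according to the reference measure. -/
def stepRef : Kernel (S × A) (S × A) :=
  P.trans.compProd (Kernel.const _ P.ref)

/-- The next `n` state-action pairs after a given one, actions following the reference measure. -/
def tailRef : (n : ℕ) → Kernel (S × A) (Traj S A n)
  | 0 => Kernel.const _ (Measure.dirac Fin.elim0)
  | n + 1 => (P.stepRef.compProd (Kernel.prodMkLeft (S × A) (tailRef n))).map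
      fun z => (Fin.cons z.1 z.2 : Traj S A (n + 1))

/-- The reference measure `P₀(ds₀) ref(da₀) trans(ds₁ | s₀, a₀) ref(da₁) ⋯` on trajectories. -/
def trajRef : (n : ℕ) → Measure (Traj S A n)
  | 0 => Measure.dirac Fin.elim0
  | n + 1 => ((P.start.prod P.ref).compProd (P.tailRef n)).map
      fun z => (Fin.cons z.1 z.2 : Traj S A (n + 1))

/-- The density `p_θ(τ)` with respect to `trajRef`; initial and transition probabilities are the same
for all `θ` and sit in `trajRef`. -/
def trajDens (θ : Param q) (τ : Traj S A H) : ℝ :=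
  ∏ t : Fin H, P.dens θ (τ t).1 (τ t).2

/-- The law `p_θ` of a trajectory under the policy `π_θ`: `s₀ ∼ P₀`, `a_t ∼ π_θ(· | s_t)`,
`s_{t+1} ∼ trans (s_t, a_t)`. -/
def trajLaw (θ : Param q) : Measure (Traj S A H) :=
  (P.trajRef H).withDensity fun τ => ENNReal.ofReal (P.trajDens θ τ)

/-- The importance weight `ω(τ | θ₁, θ₂) = p_{θ₂}(τ) / p_{θ₁}(τ)`. -/
def weight (τ : Traj S A H) (θ₁ θ₂ : Param q) : ℝ :=
  P.trajDens θ₂ τ / P.trajDens θ₁ τ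

/-- The expected return `J(θ)`. -/
def J (θ : Param q) : ℝ := ∫ τ, P.ret τ ∂(P.trajLaw θ)

/-- The score `∇_θ log π_θ(a | s)`. -/
def score (θ : Param q) (s : S) (a : A) : Param q :=
  gradient (fun θ' => Real.log (P.dens θ' s a)) θ

/-- The REINFORCE estimator with baseline, `g(τ | θ)`. -/
def g (τ : Traj S A H) (θ : Param q) : Param q :=
  ∑ t : Fin H, (P.ret τ - P.baseline t (τ t).1) • P.score θ (τ t).1 (τ t).2

/-- Bounded rewards, a bounded baseline, and a log-density of the policy that is twice differentiable
in `θ` with bounded gradient and bounded Hessian; `γ` is the discount factor. -/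
structure Bounded (γ R b G M : ℝ) : Prop where
  discount_eq : P.discount = γ
  reward_le : ∀ s a, |P.reward s a| ≤ R
  baseline_le : ∀ t s, |P.baseline t s| ≤ b
  differentiable_log : ∀ s a, Differentiable ℝ fun θ => Real.log (P.dens θ s a)
  score_le : ∀ θ s a, ‖P.score θ s a‖ ≤ G
  differentiable_score : ∀ s a, Differentiable ℝ fun θ => P.score θ s a
  hessian_le : ∀ θ s a, ‖fderiv ℝ (fun θ' => P.score θ' s a) θ‖ ≤ M

/-- The objective `F = J - Q`. -/
def F (Q : Param q → EReal) (θ : Param q) : EReal := (P.J θ : EReal) - Q θ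

/-- The gradient mapping `𝒢_η(θ)`. -/
def gradMap (η : ℝ) (Q : Param q → EReal) (θ : Param q) : Param q :=
  η⁻¹ • (proxStep η Q (θ + η • gradient P.J θ) - θ)

/-- The variance of `ω(τ | θ₁, θ₂)` for `τ ∼ p_{θ₁}`. -/
def weightVar (θ₁ θ₂ : Param q) : ENNReal :=
  evariance (fun τ => P.weight τ θ₁ θ₂) (P.trajLaw θ₁)

/-- `L`, `σ`, `C` are constants of smoothness and of variance: `∇J` is `L`-Lipschitz,
`‖g(τ | θ) - ∇J(θ)‖² ≤ σ²`, and
`E ‖g(τ | θ₁) - ω(τ | θ₁, θ₂) g(τ | θ₂)‖² ≤ C ‖θ₁ - θ₂‖²`, `τ ∼ p_{θ₁}`, whenever the importance weight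
has variance at most `W`. -/
structure SmoothnessConstants (W L σ C : ℝ) : Prop where
  differentiable : Differentiable ℝ P.J
  lipschitz : ∀ θ₁ θ₂, ‖gradient P.J θ₁ - gradient P.J θ₂‖ ≤ L * ‖θ₁ - θ₂‖
  variance : ∀ τ θ, ‖P.g τ θ - gradient P.J θ‖ ^ 2 ≤ σ ^ 2
  meanSquare : ∀ θ₁ θ₂, P.weightVar θ₁ θ₂ ≤ ENNReal.ofReal W →
    ∫⁻ τ, ENNReal.ofReal (‖P.g τ θ₁ - P.weight τ θ₁ θ₂ • P.g τ θ₂‖ ^ 2) ∂(P.trajLaw θ₁)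
      ≤ ENNReal.ofReal (C * ‖θ₁ - θ₂‖ ^ 2)

section Algorithm

variable (Q : Param q → EReal) (c : Config)

/-- A batch of `n` independent trajectories sampled from `p_θ`. -/
def batch (θ : Param q) (n : ℕ) : Measure (Fin n → Traj S A H) :=
  Measure.pi fun _ => P.trajLaw θ

/-- `θ_{t+1} = (1 - α) θ_t + α prox_{ηQ}(θ_t + η v_t)`. -/
def next (θ v : Param q) : Param q :=
  (1 - c.α) • θ + c.α • proxStep c.η Q (θ + c.η • v)

/-- `v₀`, the average of `g(· | θ₀)` over the first batch. -/
def firstEstimator (θ : Param q) (b : Fin c.N → Traj S A H) : Param q :=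
  (c.N : ℝ)⁻¹ • ∑ i, P.g (b i) θ

/-- The hybrid estimator `v_t` from `θ_{t-1}`, `v_{t-1}`, `θ_t` and two batches. -/
def hybridEstimator (θ' v' θ : Param q) (b b' : Fin c.B → Traj S A H) : Param q :=
  c.β • v'
    + (c.β / c.B) • ∑ i, (P.g (b i) θ - P.weight (b i) θ θ' • P.g (b i) θ')
    + ((1 - c.β) / c.B) • ∑ i, P.g (b' i) θ

/-- The law of the state after the first update, from an initial point and the two counters. -/
def firstIter (x : Param q × ℕ × ℕ) : Measure (State q) :=
  (P.batch x.1 c.N).map fun b =>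
    let v := P.firstEstimator c x.1 b
    ((x.1, v, next Q c x.1 v), (x.2.1 + c.N, x.2.2 + 1))

/-- The law of the state after one more iteration: two independent batches are sampled from the
current policy, then `v` and `θ` are updated. -/
def iter (x : State q) : Measure (State q) :=
  ((P.batch x.1.2.2 c.B).prod (P.batch x.1.2.2 c.B)).map fun b =>
    let θ := x.1.2.2
    let v := P.hybridEstimator c x.1.1 x.1.2.1 θ b.1 b.2
    ((θ, v, next Q c θ v), (x.2.1 + (c.B + c.B), x.2.2 + 1))

/-- The law of `(θ_t, v_t, θ_{t+1})` and of the counters in a run of ProxHSPGA whose initial point and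
counters have the law `ν`; the run stops at `t = m`. -/
def law (ν : Measure (Param q × ℕ × ℕ)) : ℕ → Measure (State q)
  | 0 => ν.bind (P.firstIter Q c)
  | t + 1 => (law ν t).bind (P.iter Q c)

/-- The law of the initial point `θ_0^{(s)}` and of the counters at stage `s` of restarting ProxHSPGA,
which is `θ_{m+1}^{(s-1)}` if `s ≥ 1`. At stage `0` this is the deterministic point `θ₀`. -/
def stageStart (θ₀ : Param q) : ℕ → Measure (Param q × ℕ × ℕ)
  | 0 => Measure.dirac (θ₀, 0, 0)
  | s + 1 => (P.law Q c (stageStart θ₀ s) c.m).map fun x => (x.1.2.2, x.2)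

/-- The law of `(θ_t^{(s)}, v_t^{(s)}, θ_{t+1}^{(s)})` and of the counters. -/
def stageLaw (θ₀ : Param q) (s t : ℕ) : Measure (State q) :=
  P.law Q c (P.stageStart Q c θ₀ s) t

/-- The law of a uniformly random element of `{θ_t : t ∈ I}` in a run of ProxHSPGA from `θ₀`. -/
def output (θ₀ : Param q) (I : Finset ℕ) : Measure (Param q) :=
  (I.card : ENNReal)⁻¹ •
    ∑ t ∈ I, (P.law Q c (Measure.dirac (θ₀, 0, 0)) t).map fun x => x.1.1

/-- The law of a uniformly random element of `{θ_t^{(s)} : 0 ≤ s < K, 0 ≤ t ≤ m}` in a run of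
restarting ProxHSPGA with `K` stages from `θ₀`. -/
def restartOutput (θ₀ : Param q) (K : ℕ) : Measure (Param q) :=
  ((K * (c.m + 1) : ℕ) : ENNReal)⁻¹ •
    ∑ s ∈ Finset.range K, ∑ t ∈ Finset.range (c.m + 1),
      (P.stageLaw Q c θ₀ s t).map fun x => x.1.1

/-- In a run from `ν`, almost surely every importance weight `ω(· | θ_{t+1}, θ_t)` that is used has
variance at most `W`. -/
def WeightsBounded (ν : Measure (Param q × ℕ × ℕ)) (W : ℝ) : Prop :=
  ∀ t < c.m, ∀ᵐ x ∂(P.law Q c ν t), P.weightVar x.1.2.2 x.1.1 ≤ ENNReal.ofReal W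

/-- `ρ` is a probability law on `ℝ^q` under which `E ‖𝒢_η(θ)‖² ≤ ε²`. -/
def Accurate (ε : ℝ) (ρ : Measure (Param q)) : Prop :=
  IsProbabilityMeasure ρ ∧
    ∫⁻ θ, ENNReal.ofReal (‖P.gradMap c.η Q θ‖ ^ 2) ∂ρ ≤ ENNReal.ofReal (ε ^ 2)

end Algorithm

end Model

end HSPG

end

universe u v

/-! Write `d_t = prox_{ηQ}(θ_t + η v_t) - θ_t` and `e_t = v_t - ∇J(θ_t)`. Two inequalities carry the
proof. Convexity of `Q` and smoothness of `J` give the descent `gap(θ_{t+1}) + (3α/2)‖d_t‖² ≤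
gap(θ_t) + (α/2)‖e_t‖²` (`gap_next_add_le`); the step `η = 2/(4 + Lα)` is tuned so that the
smoothness error cancels. Unbiasedness and independence of the batches give `E‖e_{t+1}‖² ≤ β²
E‖e_t‖² + (β²Cα²/B) E‖d_t‖² + (1-β)²σ²/B` (`Bounded.lintegral_sq_norm_hybridEstimator_sub_le`),
since `θ_{t+1} - θ_t = α d_t`.

Adding `α/(1-β)` times the second to the first makes `gap + α/(1-β) ‖e‖²` a Lyapunov function as
soon as `Cα² ≤ B(1-β)`. Its sum (`sum_le_of_lyapunov`) bounds `α ∑ E(‖e_t‖² + ‖d_t‖²)` by the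
initial gap plus the accumulated noise, and nonexpansiveness of the prox turns this into a bound on
the gradient mapping. The gap left at the end of a stage is kept in the inequality, so stages
telescope.

With the prescribed `N`, `β`, `α` the resulting average is `O([B(m+1)]^{-2/3})`
(`add_mul_stageNoise_le`), and `m + 1` of order `Ψ^{3/2}σ/(KBε³)`, `K` being the number of stages,
brings it below `ε²/2`. The cost is a multiple of `KB(m+1)`, hence of `ε^{-3}`.

The constants of the class come from the policy gradient theorem `∇J(θ) = E g(τ | θ)`. The baseline
does not bias it because the law of the state at time `t` ignores the policy used at time `t`.
Importance weights put two gradients under one law, and `|ω - 1|` is at most a multiple of `‖θ₁ -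
θ₂‖` for nearby parameters; for distant ones the assumed variance bound `W`, or boundedness of `g`,
suffices. -/

noncomputable section

namespace HSPG

open Metric Filter Topology

/-! ### Proximal operators of proper closed convex functions -/

section Proximal

variable {q : ℕ} {Q : Param q → EReal}

namespace ProperClosedConvex

theorem coe_toReal (hQ : ProperClosedConvex Q) {θ : Param q} (h : Q θ ≠ ⊤) :
    ((Q θ).toReal : EReal) = Q θ :=
  EReal.coe_toReal h (hQ.ne_bot θ)

theorem combination_le (hQ : ProperClosedConvex Q) {y z : Param q} (hy : Q y ≠ ⊤) (hz : Q z ≠ ⊤)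
    {a c : ℝ} (ha : 0 ≤ a) (hc : 0 ≤ c) (hac : a + c = 1) :
    Q (a • y + c • z) ≤ ((a * (Q y).toReal + c * (Q z).toReal : ℝ) : EReal) := by
  have h := hQ.convex (x := (y, (Q y).toReal)) (by simp [hQ.coe_toReal hy])
    (y := (z, (Q z).toReal)) (by simp [hQ.coe_toReal hz]) ha hc hac
  simpa using h

theorem toReal_combination_le (hQ : ProperClosedConvex Q) {y z : Param q} (hy : Q y ≠ ⊤)
    (hz : Q z ≠ ⊤) {a c : ℝ} (ha : 0 ≤ a) (hc : 0 ≤ c) (hac : a + c = 1) :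
    Q (a • y + c • z) ≠ ⊤ ∧
      (Q (a • y + c • z)).toReal ≤ a * (Q y).toReal + c * (Q z).toReal := by
  have h := hQ.combination_le hy hz ha hc hac
  have hne : Q (a • y + c • z) ≠ ⊤ := ne_top_of_le_ne_top (EReal.coe_ne_top _) h
  refine ⟨hne, ?_⟩
  rw [← hQ.coe_toReal hne] at h
  exact_mod_cast h

/-- A proper closed convex function decreases at most linearly. -/
theorem exists_linear_minorant (hQ : ProperClosedConvex Q) {θ₀ : Param q} (h₀ : Q θ₀ ≠ ⊤) :
    ∃ k : ℝ, 0 ≤ k ∧ ∀ y, Q y ≠ ⊤ → -(k * (1 + ‖y - θ₀‖)) ≤ (Q y).toReal := by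
  obtain ⟨a, ha, hmin⟩ := LowerSemicontinuousOn.exists_isMinOn (s := closedBall θ₀ 1) (f := Q)
    ⟨θ₀, by simp⟩ (isCompact_closedBall _ _) (hQ.closed.lowerSemicontinuousOn _)
  rw [isMinOn_iff] at hmin
  have hae : Q a ≠ ⊤ := ne_top_of_le_ne_top h₀ (hmin θ₀ (by simp))
  have hball : ∀ y ∈ closedBall θ₀ 1, Q y ≠ ⊤ → (Q a).toReal ≤ (Q y).toReal := fun y hy hy' =>
    EReal.toReal_le_toReal (hmin y hy) (hQ.ne_bot a) hy'
  set A := (Q a).toReal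
  set r := (Q θ₀).toReal
  refine ⟨|A| + |r|, by positivity, fun y hy => ?_⟩
  have hA := neg_abs_le A
  have hr := le_abs_self r
  have hd := norm_nonneg (y - θ₀)
  by_cases hd1 : ‖y - θ₀‖ ≤ 1
  · have := hball y (by simpa [dist_eq_norm] using hd1) hy
    nlinarith [abs_nonneg A, abs_nonneg r]
  · push Not at hd1
    set d := ‖y - θ₀‖
    have hdp : 0 < d := by linarith
    -- The segment from `θ₀` to `y` leaves the unit ball at distance one; convexity there transports
    -- the minimum `A` over the ball to a linear lower bound at `y`, with no separating hyperplane.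
    have hcomb := hQ.toReal_combination_le h₀ hy (a := 1 - d⁻¹) (c := d⁻¹)
      (by have := inv_le_one_of_one_le₀ hd1.le; linarith) (by positivity) (by ring)
    have hz : (1 - d⁻¹) • θ₀ + d⁻¹ • y ∈ closedBall θ₀ 1 := by
      have : (1 - d⁻¹) • θ₀ + d⁻¹ • y - θ₀ = d⁻¹ • (y - θ₀) := by
        rw [smul_sub, sub_smul, one_smul]; abel
      rw [mem_closedBall, dist_eq_norm, this, norm_smul, norm_inv, Real.norm_of_nonneg hd]
      exact (inv_mul_cancel₀ hdp.ne').le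
    have h1 := (hball _ hz hcomb.1).trans hcomb.2
    have h2 : d * A ≤ (d - 1) * r + (Q y).toReal := by
      have := mul_le_mul_of_nonneg_left h1 hdp.le
      have e : d * ((1 - d⁻¹) * r + d⁻¹ * (Q y).toReal) = (d - 1) * r + (Q y).toReal := by
        field_simp
      rw [e] at this
      exact this
    nlinarith [abs_nonneg A, abs_nonneg r]

/-- Existence is compactness in a large ball: outside it the quadratic term beats the linear
minorant, so the objective there exceeds its value at `θ₀`. -/
theorem exists_prox (hQ : ProperClosedConvex Q) {η : ℝ} (hη : 0 < η) (x : Param q) :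
    ∃ p, ∀ y, (η : EReal) * Q p + ((‖p - x‖ ^ 2 / 2 : ℝ) : EReal)
      ≤ (η : EReal) * Q y + ((‖y - x‖ ^ 2 / 2 : ℝ) : EReal) := by
  obtain ⟨θ₀, h₀⟩ := hQ.exists_ne_top
  obtain ⟨k, hk, hmin⟩ := hQ.exists_linear_minorant h₀
  set r := (Q θ₀).toReal with hr
  set e := ‖θ₀ - x‖ with he
  -- For `d > ρ` this makes `d (d/2 - ηk - e)` at least `η|r| + ηk + 1`, which is what the
  -- comparison with `θ₀` needs.
  set ρ := 2 * (η * k + e + (η * |r| + η * k + 1)) with hρ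
  have he0 : 0 ≤ e := norm_nonneg _
  have hρ0 : 0 ≤ ρ := by positivity
  -- The objective is divided by `η`: then `Q` appears unscaled and only a finite continuous term is
  -- added to it.
  have hlsc : LowerSemicontinuous fun y => Q y + ((‖y - x‖ ^ 2 / 2 / η : ℝ) : EReal) := by
    refine hQ.closed.add' ?_ fun y => EReal.continuousAt_add (Or.inr (EReal.coe_ne_bot _))
      (Or.inr (EReal.coe_ne_top _))
    exact (continuous_coe_real_ereal.comp (by fun_prop)).lowerSemicontinuous
  obtain ⟨p, -, hp⟩ := LowerSemicontinuousOn.exists_isMinOn (s := closedBall θ₀ ρ)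
    ⟨θ₀, by simpa using hρ0⟩ (isCompact_closedBall _ _) (hlsc.lowerSemicontinuousOn _)
  rw [isMinOn_iff] at hp
  have hpθ := hp θ₀ (by simpa using hρ0)
  have hpne : Q p ≠ ⊤ := by
    intro h
    rw [h, EReal.top_add_coe, ← hQ.coe_toReal h₀, ← EReal.coe_add] at hpθ
    exact EReal.coe_ne_top _ (top_le_iff.1 hpθ)
  have key : ∀ y, Q y ≠ ⊤ → y ∈ closedBall θ₀ ρ →
      η * (Q p).toReal + ‖p - x‖ ^ 2 / 2 ≤ η * (Q y).toReal + ‖y - x‖ ^ 2 / 2 := by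
    intro y hy hyb
    have h := hp y hyb
    rw [← hQ.coe_toReal hy, ← hQ.coe_toReal hpne, ← EReal.coe_add, ← EReal.coe_add,
      EReal.coe_le_coe_iff] at h
    have := mul_le_mul_of_nonneg_left h hη.le
    rwa [mul_add, mul_add, mul_div_cancel₀ _ hη.ne', mul_div_cancel₀ _ hη.ne'] at this
  refine ⟨p, fun y => ?_⟩
  by_cases hy : Q y = ⊤
  · rw [hy, EReal.coe_mul_top_of_pos hη, EReal.top_add_coe]
    exact le_top
  rw [← hQ.coe_toReal hy, ← hQ.coe_toReal hpne, ← EReal.coe_mul, ← EReal.coe_mul, ← EReal.coe_add,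
    ← EReal.coe_add, EReal.coe_le_coe_iff]
  by_cases hyb : y ∈ closedBall θ₀ ρ
  · exact key y hy hyb
  · refine (key θ₀ h₀ (by simpa using hρ0)).trans ?_
    rw [← hr, ← he]
    rw [mem_closedBall, not_le, dist_eq_norm] at hyb
    have hy1 := hmin y hy
    have htri : ‖y - θ₀‖ - e ≤ ‖y - x‖ := by
      have := norm_sub_norm_le (y - θ₀) (x - θ₀)
      rw [norm_sub_rev x θ₀] at this
      simpa using this
    set d := ‖y - θ₀‖
    have hd1 : 1 ≤ d := by nlinarith [mul_nonneg hη.le hk, mul_nonneg hη.le (abs_nonneg r)]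
    have hde : 0 ≤ d - e := by
      nlinarith [mul_nonneg hη.le hk, mul_nonneg hη.le (abs_nonneg r)]
    have hsq : (d - e) ^ 2 ≤ ‖y - x‖ ^ 2 := pow_le_pow_left₀ hde htri 2
    have h1 : η * -(k * (1 + d)) ≤ η * (Q y).toReal := mul_le_mul_of_nonneg_left hy1 hη.le
    have h2 : η * r ≤ η * |r| := mul_le_mul_of_nonneg_left (le_abs_self r) hη.le
    have h3 : η * |r| + η * k + 1 ≤ d / 2 - (η * k + e) := by linarith
    have h4 : η * |r| + η * k + 1 ≤ d * (d / 2 - (η * k + e)) := by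
      have : 0 ≤ η * |r| + η * k + 1 := by positivity
      nlinarith
    nlinarith

theorem proxStep_spec (hQ : ProperClosedConvex Q) {η : ℝ} (hη : 0 < η) (x y : Param q) :
    (η : EReal) * Q (proxStep η Q x) + ((‖proxStep η Q x - x‖ ^ 2 / 2 : ℝ) : EReal)
      ≤ (η : EReal) * Q y + ((‖y - x‖ ^ 2 / 2 : ℝ) : EReal) :=
  Classical.epsilon_spec (hQ.exists_prox hη x) y

theorem proxStep_ne_top (hQ : ProperClosedConvex Q) {η : ℝ} (hη : 0 < η) (x : Param q) :
    Q (proxStep η Q x) ≠ ⊤ := by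
  obtain ⟨θ₀, h₀⟩ := hQ.exists_ne_top
  intro h
  have h' := hQ.proxStep_spec hη x θ₀
  rw [h, EReal.coe_mul_top_of_pos hη, EReal.top_add_coe, ← hQ.coe_toReal h₀, ← EReal.coe_mul,
    ← EReal.coe_add] at h'
  exact EReal.coe_ne_top _ (top_le_iff.1 h')

/-- The variational inequality that characterizes `prox_{ηQ}(x)`. -/
theorem proxStep_variational (hQ : ProperClosedConvex Q) {η : ℝ} (hη : 0 < η) (x : Param q)
    {y : Param q} (hy : Q y ≠ ⊤) :
    η * ((Q (proxStep η Q x)).toReal - (Q y).toReal)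
      ≤ inner ℝ (proxStep η Q x - x) (y - proxStep η Q x) := by
  have hpne := hQ.proxStep_ne_top hη x
  have hspec := hQ.proxStep_spec hη x
  set p := proxStep η Q x
  -- Compare the minimizer with a point at fraction `l` of the way to `y`, divide by `l`, and let
  -- `l` tend to `0` below.
  have hstep : ∀ l : ℝ, 0 < l → l ≤ 1 → η * ((Q p).toReal - (Q y).toReal)
      ≤ inner ℝ (p - x) (y - p) + l * (‖y - p‖ ^ 2 / 2) := by
    intro l hl hl1
    obtain ⟨hne, hle⟩ := hQ.toReal_combination_le hpne hy (a := 1 - l) (c := l)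
      (by linarith) hl.le (by ring)
    have h := hspec ((1 - l) • p + l • y)
    rw [← hQ.coe_toReal hne, ← hQ.coe_toReal hpne, ← EReal.coe_mul, ← EReal.coe_mul,
      ← EReal.coe_add, ← EReal.coe_add, EReal.coe_le_coe_iff] at h
    have e : (1 - l) • p + l • y - x = (p - x) + l • (y - p) := by
      rw [smul_sub, sub_smul, one_smul]; abel
    rw [e, norm_add_sq_real, inner_smul_right, norm_smul, Real.norm_of_nonneg hl.le] at h
    have h' := mul_le_mul_of_nonneg_left hle hη.le
    have : l * (η * ((Q p).toReal - (Q y).toReal))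
        ≤ l * (inner ℝ (p - x) (y - p) + l * (‖y - p‖ ^ 2 / 2)) := by nlinarith
    exact le_of_mul_le_mul_left this hl
  have hlim : Tendsto (fun l : ℝ => inner ℝ (p - x) (y - p) + l * (‖y - p‖ ^ 2 / 2)) (𝓝[>] 0)
      (𝓝 (inner ℝ (p - x) (y - p) + 0 * (‖y - p‖ ^ 2 / 2))) :=
    ((continuous_const.add (continuous_id.mul continuous_const)).tendsto 0).mono_left
      nhdsWithin_le_nhds
  rw [zero_mul, add_zero] at hlim
  refine ge_of_tendsto hlim ?_
  filter_upwards [Ioc_mem_nhdsGT (zero_lt_one (α := ℝ))] with l hl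
  exact hstep l hl.1 hl.2

/-- The proximal operator is nonexpansive. -/
theorem norm_proxStep_sub_le (hQ : ProperClosedConvex Q) {η : ℝ} (hη : 0 < η) (x x' : Param q) :
    ‖proxStep η Q x - proxStep η Q x'‖ ≤ ‖x - x'‖ := by
  have h1 := hQ.proxStep_variational hη x (hQ.proxStep_ne_top hη x')
  have h2 := hQ.proxStep_variational hη x' (hQ.proxStep_ne_top hη x)
  set p := proxStep η Q x
  set p' := proxStep η Q x'
  -- When the two variational inequalities are added, the values of `Q` cancel and this identity
  -- remains to be bounded.
  have h3 : inner ℝ (p - x) (p' - p) + inner ℝ (p' - x') (p - p')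
      = inner ℝ (x - x') (p - p') - ‖p - p'‖ ^ 2 := by
    rw [← real_inner_self_eq_norm_sq, ← neg_sub p p', inner_neg_right]
    simp only [inner_sub_left]
    ring
  have h4 := real_inner_le_norm (x - x') (p - p')
  have h5 : ‖p - p'‖ * ‖p - p'‖ ≤ ‖x - x'‖ * ‖p - p'‖ := by nlinarith
  rcases (norm_nonneg (p - p')).eq_or_lt with h | h
  · rw [← h]; exact norm_nonneg _
  · exact le_of_mul_le_mul_right h5 h

theorem continuous_proxStep (hQ : ProperClosedConvex Q) {η : ℝ} (hη : 0 < η) :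
    Continuous (proxStep η Q) :=
  (LipschitzWith.of_dist_le_mul (K := 1) fun x x' => by
    simpa [dist_eq_norm] using hQ.norm_proxStep_sub_le hη x x').continuous

end ProperClosedConvex

end Proximal

end HSPG

/-! ### Integration over trajectories, one time step after another -/

namespace HSPG

namespace Model

variable {S A : Type*} [MeasurableSpace S] [MeasurableSpace A] {q H : ℕ} (P : Model S A q H)

theorem measurable_cons (n : ℕ) :
    Measurable fun z : (S × A) × Traj S A n => (Fin.cons z.1 z.2 : Traj S A (n + 1)) := by
  refine measurable_pi_lambda _ fun i => ?_
  refine Fin.cases ?_ (fun j => ?_) i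
  · simpa using measurable_fst
  · simp only [Fin.cons_succ]
    exact (measurable_pi_apply j).comp measurable_snd

instance : IsMarkovKernel P.trans := P.trans_markov
instance : IsProbabilityMeasure P.start := P.start_prob
instance : SigmaFinite P.ref := P.ref_sigmaFinite

instance : IsSFiniteKernel P.stepRef := by unfold stepRef; infer_instance

instance isSFiniteKernel_tailRef : ∀ n, IsSFiniteKernel (P.tailRef n)
  | 0 => by unfold tailRef; infer_instance
  | n + 1 => by
    have := isSFiniteKernel_tailRef n
    unfold tailRef
    infer_instance

instance sFinite_trajRef : ∀ n, SFinite (P.trajRef n)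
  | 0 => by unfold trajRef; infer_instance
  | n + 1 => by unfold trajRef; infer_instance

theorem lintegral_tailRef_succ (n : ℕ) (x : S × A) {f : Traj S A (n + 1) → ENNReal}
    (hf : Measurable f) :
    ∫⁻ τ, f τ ∂(P.tailRef (n + 1) x)
      = ∫⁻ s, ∫⁻ a, ∫⁻ τ, f (Fin.cons (s, a) τ) ∂(P.tailRef n (s, a)) ∂P.ref ∂(P.trans x) := by
  have hc : Measurable fun z : (S × A) × Traj S A n => f (Fin.cons z.1 z.2) :=
    hf.comp (measurable_cons n)
  rw [tailRef, Kernel.map_apply _ (measurable_cons n), lintegral_map hf (measurable_cons n),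
    Kernel.lintegral_compProd _ _ _ hc]
  simp only [Kernel.prodMkLeft_apply]
  rw [stepRef, Kernel.lintegral_compProd _ _ _ (Measurable.lintegral_kernel_prod_right hc)]
  simp only [Kernel.const_apply]

theorem lintegral_trajRef_succ (n : ℕ) {f : Traj S A (n + 1) → ENNReal} (hf : Measurable f) :
    ∫⁻ τ, f τ ∂(P.trajRef (n + 1))
      = ∫⁻ s, ∫⁻ a, ∫⁻ τ, f (Fin.cons (s, a) τ) ∂(P.tailRef n (s, a)) ∂P.ref ∂P.start := by
  have hc : Measurable fun z : (S × A) × Traj S A n => f (Fin.cons z.1 z.2) :=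
    hf.comp (measurable_cons n)
  rw [trajRef, lintegral_map hf (measurable_cons n), Measure.lintegral_compProd hc,
    lintegral_prod _ (Measurable.lintegral_kernel_prod_right hc).aemeasurable]

/-- A density of a policy with respect to the reference measure. -/
structure IsPolicyDensity (d : S × A → ENNReal) : Prop where
  measurable : Measurable d
  lintegral_eq_one : ∀ s, ∫⁻ a, d (s, a) ∂P.ref = 1

variable {P}

theorem measurable_prod_density {n : ℕ} {d : Fin n → S × A → ENNReal}
    (hd : ∀ t, Measurable (d t)) : Measurable fun τ : Traj S A n => ∏ t, d t (τ t) :=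
  Finset.measurable_prod _ fun t _ => (hd t).comp (measurable_pi_apply t)

theorem measurable_state_mul_prod {n : ℕ} {d : Fin n → S × A → ENNReal} {h : S → ENNReal}
    (hh : Measurable h) (hd : ∀ t, Measurable (d t)) (t : Fin n) :
    Measurable fun τ : Traj S A n => h (τ t).1 * ∏ u, d u (τ u) :=
  (hh.comp (measurable_fst.comp (measurable_pi_apply t))).mul (measurable_prod_density hd)

/-- `tailRef` and `trajRef` differ only in the law `ν` of the first state, so the inductive step is
proved once for all `ν`: the tail integrates to one, then the first action does. -/
theorem lintegral_cons_prod_eq_one {n : ℕ} (ν : Measure S) [IsProbabilityMeasure ν]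
    {d : Fin (n + 1) → S × A → ENNReal} (hd : ∀ t, P.IsPolicyDensity (d t))
    (htail : ∀ x, ∫⁻ τ, ∏ t, d t.succ (τ t) ∂(P.tailRef n x) = 1) :
    ∫⁻ s, ∫⁻ a, ∫⁻ τ, ∏ t, d t ((Fin.cons (s, a) τ : Traj S A (n + 1)) t)
      ∂(P.tailRef n (s, a)) ∂P.ref ∂ν = 1 := by
  simp only [Fin.prod_univ_succ, Fin.cons_zero, Fin.cons_succ]
  simp_rw [lintegral_const_mul _ (measurable_prod_density fun t => (hd (Fin.succ t)).measurable),
    htail, mul_one, (hd 0).lintegral_eq_one]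
  simp

theorem lintegral_tailRef_prod : ∀ (n : ℕ) {d : Fin n → S × A → ENNReal}
    (_ : ∀ t, P.IsPolicyDensity (d t)) (x : S × A), ∫⁻ τ, ∏ t, d t (τ t) ∂(P.tailRef n x) = 1
  | 0, d, _, x => by simp [tailRef]
  | n + 1, d, hd, x => by
    rw [lintegral_tailRef_succ P n x (measurable_prod_density fun t => (hd t).measurable)]
    exact lintegral_cons_prod_eq_one _ hd fun x => lintegral_tailRef_prod n (fun t => hd t.succ) x

theorem lintegral_trajRef_prod (n : ℕ) {d : Fin n → S × A → ENNReal}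
    (hd : ∀ t, P.IsPolicyDensity (d t)) : ∫⁻ τ, ∏ t, d t (τ t) ∂(P.trajRef n) = 1 := by
  cases n with
  | zero => simp [trajRef]
  | succ n =>
    rw [lintegral_trajRef_succ P n (measurable_prod_density fun t => (hd t).measurable)]
    exact lintegral_cons_prod_eq_one _ hd fun x => lintegral_tailRef_prod n (fun t => hd t.succ) x

/-- The inductive step for `lintegral_trajRef_state_mul_prod`, again for any law `ν` of the first
state. The equation in `htail` lets the caller supply the tail without distinguishing whether `t` is
the first time. -/
theorem lintegral_cons_state_mul_prod {n : ℕ} (ν : Measure S)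
    {d d' : Fin (n + 1) → S × A → ENNReal} (hd : ∀ t, P.IsPolicyDensity (d t))
    (hd' : ∀ t, P.IsPolicyDensity (d' t)) (t : Fin (n + 1)) (heq : ∀ u, u ≠ t → d u = d' u)
    {h : S → ENNReal} (hh : Measurable h)
    (htail : ∀ (t' : Fin n) (x : S × A), t = t'.succ →
      ∫⁻ τ, h (τ t').1 * ∏ u, d (Fin.succ u) (τ u) ∂(P.tailRef n x)
        = ∫⁻ τ, h (τ t').1 * ∏ u, d' (Fin.succ u) (τ u) ∂(P.tailRef n x)) :
    ∫⁻ s, ∫⁻ a, ∫⁻ τ, h ((Fin.cons (s, a) τ : Traj S A (n + 1)) t).1 *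
        ∏ u, d u ((Fin.cons (s, a) τ : Traj S A (n + 1)) u) ∂(P.tailRef n (s, a)) ∂P.ref ∂ν
      = ∫⁻ s, ∫⁻ a, ∫⁻ τ, h ((Fin.cons (s, a) τ : Traj S A (n + 1)) t).1 *
        ∏ u, d' u ((Fin.cons (s, a) τ : Traj S A (n + 1)) u) ∂(P.tailRef n (s, a)) ∂P.ref ∂ν := by
  have hm := measurable_prod_density fun t => (hd (Fin.succ t)).measurable
  have hm' := measurable_prod_density fun t => (hd' (Fin.succ t)).measurable
  simp only [Fin.prod_univ_succ, Fin.cons_zero, Fin.cons_succ]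
  obtain rfl | ⟨t', rfl⟩ := Fin.eq_zero_or_eq_succ t
  -- The state is the first one: `h s` factors out of everything random after it, and both remaining
  -- products integrate to one.
  · simp only [Fin.cons_zero]
    refine lintegral_congr fun s => ?_
    simp_rw [lintegral_const_mul _ (hm.const_mul _), lintegral_const_mul _ (hm'.const_mul _),
      lintegral_const_mul _ hm, lintegral_const_mul _ hm',
      lintegral_tailRef_prod n (fun t => hd (Fin.succ t)),
      lintegral_tailRef_prod n (fun t => hd' (Fin.succ t)), mul_one]
    have h0 : Measurable fun a => d 0 (s, a) := (hd 0).measurable.comp measurable_prodMk_left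
    have h0' : Measurable fun a => d' 0 (s, a) := (hd' 0).measurable.comp measurable_prodMk_left
    rw [lintegral_const_mul _ h0, lintegral_const_mul _ h0', (hd 0).lintegral_eq_one, (hd' 0).lintegral_eq_one]
  -- The state lies in the tail: the first densities coincide because `0 ≠ t`, and the tails agree
  -- by `htail`.
  · simp only [Fin.cons_succ]
    have ht := measurable_state_mul_prod hh (fun u => (hd (Fin.succ u)).measurable) t'
    have ht' := measurable_state_mul_prod hh (fun u => (hd' (Fin.succ u)).measurable) t'
    refine lintegral_congr fun s => lintegral_congr fun a => ?_
    simp_rw [mul_left_comm _ (d 0 (s, a)), mul_left_comm _ (d' 0 (s, a))]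
    rw [lintegral_const_mul _ ht, lintegral_const_mul _ ht',
      htail t' (s, a) rfl, heq 0 (Fin.succ_ne_zero t').symm]

theorem lintegral_tailRef_state_mul_prod : ∀ (n : ℕ) {d d' : Fin n → S × A → ENNReal}
    (_ : ∀ t, P.IsPolicyDensity (d t)) (_ : ∀ t, P.IsPolicyDensity (d' t)) (t : Fin n)
    (_ : ∀ u, u ≠ t → d u = d' u) {h : S → ENNReal} (_ : Measurable h) (x : S × A),
    ∫⁻ τ, h (τ t).1 * ∏ u, d u (τ u) ∂(P.tailRef n x)
      = ∫⁻ τ, h (τ t).1 * ∏ u, d' u (τ u) ∂(P.tailRef n x)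
  | 0, _, _, _, _, t, _, _, _, _ => t.elim0
  | n + 1, d, d', hd, hd', t, heq, h, hh, x => by
    rw [lintegral_tailRef_succ P n x
        (measurable_state_mul_prod hh (fun t => (hd t).measurable) t),
      lintegral_tailRef_succ P n x
        (measurable_state_mul_prod hh (fun t => (hd' t).measurable) t)]
    exact lintegral_cons_state_mul_prod _ hd hd' t heq hh fun t' x htt =>
      lintegral_tailRef_state_mul_prod n (fun u => hd u.succ) (fun u => hd' u.succ) t'
        (fun u hu => heq _ (by rw [htt]; exact fun hc => hu (Fin.succ_injective _ hc))) hh x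

/-- The state at time `t` does not depend on the policy that is used at time `t`, and what comes
after it integrates out. -/
theorem lintegral_trajRef_state_mul_prod (n : ℕ) {d d' : Fin n → S × A → ENNReal}
    (hd : ∀ t, P.IsPolicyDensity (d t)) (hd' : ∀ t, P.IsPolicyDensity (d' t)) (t : Fin n)
    (heq : ∀ u, u ≠ t → d u = d' u) {h : S → ENNReal} (hh : Measurable h) :
    ∫⁻ τ, h (τ t).1 * ∏ u, d u (τ u) ∂(P.trajRef n)
      = ∫⁻ τ, h (τ t).1 * ∏ u, d' u (τ u) ∂(P.trajRef n) := by
  cases n with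
  | zero => exact t.elim0
  | succ n =>
    rw [lintegral_trajRef_succ P n
        (measurable_state_mul_prod hh (fun t => (hd t).measurable) t),
      lintegral_trajRef_succ P n
        (measurable_state_mul_prod hh (fun t => (hd' t).measurable) t)]
    exact lintegral_cons_state_mul_prod _ hd hd' t heq hh fun t' x htt =>
      lintegral_tailRef_state_mul_prod n (fun u => hd u.succ) (fun u => hd' u.succ) t'
        (fun u hu => heq _ (by rw [htt]; exact fun hc => hu (Fin.succ_injective _ hc))) hh x

end Model
end HSPG

/-! ### Differentiation under the integral and Lipschitz gradients -/

namespace HSPG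

open Filter Topology

section Analysis

variable {q : ℕ}

theorem abs_exp_sub_one_le_mul_exp {x k : ℝ} (h : |x| ≤ k) : |Real.exp x - 1| ≤ |x| * Real.exp k := by
  have hk : 1 ≤ Real.exp k := Real.one_le_exp ((abs_nonneg x).trans h)
  rcases le_total 0 x with hx | hx
  · rw [abs_of_nonneg hx] at h ⊢
    have h1 : Real.exp x ≤ Real.exp k := Real.exp_le_exp.2 h
    have h2 := Real.one_sub_le_exp_neg x
    have h3 : Real.exp x * Real.exp (-x) = 1 := by rw [← Real.exp_add]; simp
    rw [abs_of_nonneg (by have := Real.one_le_exp hx; linarith)]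
    nlinarith [Real.exp_pos x, mul_le_mul_of_nonneg_left h1 hx]
  · rw [abs_of_nonpos hx, abs_of_nonpos (by have := Real.exp_le_one_iff.2 hx; linarith)]
    have := Real.add_one_le_exp x
    nlinarith

theorem norm_sub_le_of_norm_gradient_le {f : Param q → ℝ} {f' : Param q → Param q} {k : ℝ}
    (hf : ∀ θ, HasGradientAt f (f' θ) θ) (hk : ∀ θ, ‖f' θ‖ ≤ k) (θ₁ θ₂ : Param q) :
    |f θ₂ - f θ₁| ≤ k * ‖θ₂ - θ₁‖ :=
  convex_univ.norm_image_sub_le_of_norm_hasFDerivWithin_le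
    (fun x _ => (hf x).hasFDerivAt.hasFDerivWithinAt) (fun x _ => by simpa using hk x)
    (Set.mem_univ θ₁) (Set.mem_univ θ₂)

/-- Each directional derivative is the limit of difference quotients with step `1/n`, and an
orthonormal basis reassembles the gradient. Joint measurability is needed because the algorithm
evaluates scores at random parameters. -/
theorem measurable_of_hasGradientAt {Ω : Type*} [MeasurableSpace Ω] {f : Param q → Ω → ℝ}
    {f' : Param q → Ω → Param q} (hf : Measurable fun z : Param q × Ω => f z.1 z.2)
    (hf' : ∀ θ ω, HasGradientAt (f · ω) (f' θ ω) θ) :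
    Measurable fun z : Param q × Ω => f' z.1 z.2 := by
  have hinner : ∀ v : Param q, Measurable fun z : Param q × Ω => inner ℝ v (f' z.1 z.2) := by
    intro v
    refine measurable_of_tendsto_metrizable (f := fun (n : ℕ) (z : Param q × Ω) =>
      (n : ℝ) • (f (z.1 + (n : ℝ)⁻¹ • v) z.2 - f z.1 z.2)) (fun n => ?_) ?_
    · exact ((hf.comp (f := fun z : Param q × Ω => (z.1 + (n : ℝ)⁻¹ • v, z.2))
        (by fun_prop)).sub hf).const_smul (n : ℝ)
    · rw [tendsto_pi_nhds]
      intro z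
      have h := ((hf' z.1 z.2).hasFDerivAt.lim_real v).comp tendsto_natCast_atTop_atTop
      simpa [Function.comp_def, real_inner_comm] using h
  have hsum : (fun z : Param q × Ω => f' z.1 z.2) = fun z => ∑ i,
      inner ℝ (EuclideanSpace.basisFun (Fin q) ℝ i) (f' z.1 z.2) •
        EuclideanSpace.basisFun (Fin q) ℝ i := by
    funext z
    exact ((EuclideanSpace.basisFun (Fin q) ℝ).sum_repr' _).symm
  rw [hsum]
  exact Finset.measurable_fun_sum _ fun i _ => (hinner _).smul_const _

/-- Differentiation under the integral sign for a family of densities `exp (ψ θ)`, where `ψ` is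
Lipschitz in `θ`. -/
theorem hasGradientAt_integral_mul_exp {Ω : Type*} [MeasurableSpace Ω] {μ : Measure Ω}
    {φ : Ω → ℝ} {ψ : Param q → Ω → ℝ} {ψ' : Param q → Ω → Param q} {c k : ℝ}
    (hφ : Measurable φ) (hc : ∀ ω, |φ ω| ≤ c) (hψ : ∀ θ, Measurable (ψ θ))
    (hψ' : ∀ θ ω, HasGradientAt (ψ · ω) (ψ' θ ω) θ) (hk : ∀ θ ω, ‖ψ' θ ω‖ ≤ k) (θ : Param q)
    (hm : Measurable (ψ' θ)) (hint : Integrable (fun ω => Real.exp (ψ θ ω)) μ) :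
    HasGradientAt (fun θ' => ∫ ω, φ ω * Real.exp (ψ θ' ω) ∂μ)
      (∫ ω, (φ ω * Real.exp (ψ θ ω)) • ψ' θ ω ∂μ) θ := by
  have key : HasFDerivAt (fun θ' => ∫ ω, φ ω * Real.exp (ψ θ' ω) ∂μ)
      (∫ ω, InnerProductSpace.toDual ℝ (Param q) ((φ ω * Real.exp (ψ θ ω)) • ψ' θ ω) ∂μ) θ := by
    -- On the unit ball around `θ` the exponent moves by at most `k`, so `exp k * exp (ψ θ)`
    -- dominates every nearby density.
    refine hasFDerivAt_integral_of_dominated_of_fderiv_le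
      (F' := fun θ' ω => InnerProductSpace.toDual ℝ (Param q) ((φ ω * Real.exp (ψ θ' ω)) • ψ' θ' ω))
      (bound := fun ω => c * (Real.exp k * Real.exp (ψ θ ω)) * k)
      (Metric.ball_mem_nhds θ one_pos) ?_ ?_ ?_ ?_ ?_ ?_
    · exact Eventually.of_forall fun θ' =>
        (hφ.mul (Real.measurable_exp.comp (hψ θ'))).aestronglyMeasurable
    · exact hint.bdd_mul hφ.aestronglyMeasurable (Eventually.of_forall hc)
    · exact (InnerProductSpace.toDual ℝ (Param q)).continuous.comp_aestronglyMeasurable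
        ((hφ.mul (Real.measurable_exp.comp (hψ θ))).smul hm).aestronglyMeasurable
    · refine Eventually.of_forall fun ω θ' hθ' => ?_
      have hk0 : 0 ≤ k := (norm_nonneg _).trans (hk θ ω)
      have hc0 : 0 ≤ c := (abs_nonneg _).trans (hc ω)
      have h1 := (le_abs_self _).trans (norm_sub_le_of_norm_gradient_le (hψ' · ω) (hk · ω) θ θ')
      have h2 : ‖θ' - θ‖ ≤ 1 := by
        rw [← dist_eq_norm]; exact (Metric.mem_ball.1 hθ').le
      have h3 : ψ θ' ω ≤ k + ψ θ ω := by nlinarith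
      rw [LinearIsometryEquiv.norm_map, norm_smul, norm_mul, Real.norm_eq_abs, Real.norm_eq_abs,
        Real.abs_exp, ← Real.exp_add]
      gcongr
      · exact hc ω
      · exact hk θ' ω
    · exact ((hint.const_mul _).const_mul _).mul_const _
    · refine Eventually.of_forall fun ω θ' _ => ?_
      have h := ((hψ' θ' ω).hasFDerivAt.exp).const_mul (φ ω)
      refine h.congr_fderiv ?_
      ext v
      simp
      ring
  rw [hasGradientAt_iff_hasFDerivAt]
  refine key.congr_fderiv ?_
  exact (InnerProductSpace.toDual ℝ (Param q)).toContinuousLinearEquiv.integral_comp_comm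
    (𝕜 := ℝ) _

/-- The quadratic lower bound for a function with a Lipschitz gradient. -/
theorem add_inner_sub_le_of_lipschitz_gradient {f : Param q → ℝ} (hf : Differentiable ℝ f) {L : ℝ}
    (hL : ∀ x y, ‖gradient f x - gradient f y‖ ≤ L * ‖x - y‖) (x y : Param q) :
    f x + inner ℝ (gradient f x) (y - x) - L / 2 * ‖y - x‖ ^ 2 ≤ f y := by
  set d := y - x with hd
  -- The bound reads `h 0 ≤ h 1`. The derivative of `h` is nonnegative by Cauchy-Schwarz and the
  -- Lipschitz bound along the segment.
  let h : ℝ → ℝ := fun t => f (x + t • d) - t * inner ℝ (gradient f x) d + L / 2 * ‖d‖ ^ 2 * t ^ 2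
  have hder : ∀ t, HasDerivAt h
      (inner ℝ (gradient f (x + t • d)) d - 1 * inner ℝ (gradient f x) d
        + L / 2 * ‖d‖ ^ 2 * (2 * t)) t := by
    intro t
    have h1 : HasDerivAt (fun t : ℝ => x + t • d) d t := by
      simpa using ((hasDerivAt_id t).smul_const d).const_add x
    have h2 := (hf (x + t • d)).hasGradientAt.hasFDerivAt.comp_hasDerivAt t h1
    have h3 := (h2.sub ((hasDerivAt_id t).mul_const (inner ℝ (gradient f x) d))).add
      (((hasDerivAt_pow 2 t)).const_mul (L / 2 * ‖d‖ ^ 2))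
    exact h3.congr_deriv (by simp)
  have hmono : MonotoneOn h (Set.Icc 0 1) := by
    refine monotoneOn_of_deriv_nonneg (convex_Icc 0 1)
      (fun t _ => (hder t).continuousAt.continuousWithinAt)
      (fun t _ => (hder t).differentiableAt.differentiableWithinAt) fun t ht => ?_
    rw [interior_Icc] at ht
    rw [(hder t).deriv]
    have h1 := hL (x + t • d) x
    rw [add_sub_cancel_left, norm_smul, Real.norm_of_nonneg ht.1.le] at h1
    have h2 := (abs_le.1 (abs_real_inner_le_norm (gradient f (x + t • d) - gradient f x) d)).1
    rw [inner_sub_left] at h2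
    nlinarith [norm_nonneg d, mul_le_mul_of_nonneg_right h1 (norm_nonneg d)]
  have := hmono (Set.left_mem_Icc.2 zero_le_one) (Set.right_mem_Icc.2 zero_le_one) zero_le_one
  simp only [h, zero_smul, add_zero, one_smul] at this
  rw [hd, add_sub_cancel] at this
  rw [← hd] at this
  nlinarith

end Analysis

/-! ### Trajectory densities, trajectory laws and importance weights -/

namespace Model

variable {S A : Type*} [MeasurableSpace S] [MeasurableSpace A] {q H : ℕ} (P : Model S A q H)

/-- The density of a trajectory when the policy with parameter `Θ t` is used at time `t`. -/
def mixDens (Θ : Fin H → Param q) (τ : Traj S A H) : ℝ :=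
  ∏ t, P.dens (Θ t) (τ t).1 (τ t).2

theorem mixDens_pos (Θ : Fin H → Param q) (τ : Traj S A H) : 0 < P.mixDens Θ τ :=
  Finset.prod_pos fun _ _ => P.dens_pos _ _ _

theorem trajDens_pos (θ : Param q) (τ : Traj S A H) : 0 < P.trajDens θ τ :=
  P.mixDens_pos (fun _ => θ) τ

theorem mixDens_eq_exp (Θ : Fin H → Param q) (τ : Traj S A H) :
    P.mixDens Θ τ = Real.exp (∑ t, Real.log (P.dens (Θ t) (τ t).1 (τ t).2)) := by
  rw [Real.exp_sum]
  exact Finset.prod_congr rfl fun t _ => (Real.exp_log (P.dens_pos _ _ _)).symm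

theorem measurable_dens_right (θ : Param q) : Measurable fun z : S × A => P.dens θ z.1 z.2 :=
  P.measurable_dens.comp measurable_prodMk_left

theorem measurable_mixDens (Θ : Fin H → Param q) : Measurable (P.mixDens Θ) :=
  Finset.measurable_fun_prod _ fun t _ =>
    (P.measurable_dens_right (Θ t)).comp (measurable_pi_apply t)

theorem measurable_trajDens_uncurry :
    Measurable fun z : Param q × Traj S A H => P.trajDens z.1 z.2 := by
  refine Finset.measurable_fun_prod _ fun t _ => P.measurable_dens.comp (f := fun
    z : Param q × Traj S A H => (z.1, (z.2 t).1, (z.2 t).2)) ?_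
  fun_prop

theorem measurable_trajDens (θ : Param q) : Measurable (P.trajDens θ) :=
  P.measurable_mixDens fun _ => θ

theorem isPolicyDensity_dens (θ : Param q) :
    P.IsPolicyDensity fun z => ENNReal.ofReal (P.dens θ z.1 z.2) :=
  ⟨(P.measurable_dens_right θ).ennreal_ofReal, P.lintegral_dens θ⟩

theorem ofReal_mixDens (Θ : Fin H → Param q) (τ : Traj S A H) :
    ENNReal.ofReal (P.mixDens Θ τ) = ∏ t, ENNReal.ofReal (P.dens (Θ t) (τ t).1 (τ t).2) :=
  ENNReal.ofReal_prod_of_nonneg fun _ _ => (P.dens_pos _ _ _).le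

theorem lintegral_mixDens (Θ : Fin H → Param q) :
    ∫⁻ τ, ENNReal.ofReal (P.mixDens Θ τ) ∂(P.trajRef H) = 1 := by
  simp_rw [P.ofReal_mixDens]
  exact lintegral_trajRef_prod H fun t => P.isPolicyDensity_dens (Θ t)

theorem integrable_mixDens (Θ : Fin H → Param q) : Integrable (P.mixDens Θ) (P.trajRef H) := by
  refine ⟨(P.measurable_mixDens Θ).aestronglyMeasurable, ?_⟩
  rw [hasFiniteIntegral_iff_ofReal (Eventually.of_forall fun τ => (P.mixDens_pos Θ τ).le),
    P.lintegral_mixDens]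
  exact ENNReal.one_lt_top

theorem integral_mixDens (Θ : Fin H → Param q) : ∫ τ, P.mixDens Θ τ ∂(P.trajRef H) = 1 := by
  rw [integral_eq_lintegral_of_nonneg_ae (Eventually.of_forall fun τ => (P.mixDens_pos Θ τ).le)
    (P.measurable_mixDens Θ).aestronglyMeasurable, P.lintegral_mixDens, ENNReal.toReal_one]

/-- This is `lintegral_trajRef_state_mul_prod` for signed bounded `f`: adding `c` makes the
integrand nonnegative, and the added mass is `c` whatever the parameter, since `mixDens` integrates
to one. -/
theorem integral_state_mul_mixDens_update (Θ : Fin H → Param q) (t : Fin H) (θ θ' : Param q)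
    {f : S → ℝ} (hf : Measurable f) {c : ℝ} (hc : ∀ s, |f s| ≤ c) :
    ∫ τ, f (τ t).1 * P.mixDens (Function.update Θ t θ) τ ∂(P.trajRef H)
      = ∫ τ, f (τ t).1 * P.mixDens (Function.update Θ t θ') τ ∂(P.trajRef H) := by
  have hmeas : ∀ {g : S → ℝ}, Measurable g → Measurable fun τ : Traj S A H => g (τ t).1 :=
    fun hg => hg.comp (measurable_fst.comp (measurable_pi_apply t))
  have hpos : ∀ s, 0 ≤ f s + c := fun s => by linarith [(abs_le.1 (hc s)).1]
  have hshift : ∀ ϑ, ∫ τ, (f (τ t).1 + c) * P.mixDens (Function.update Θ t ϑ) τ ∂(P.trajRef H)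
      = (∫⁻ τ, ENNReal.ofReal (f (τ t).1 + c) *
          ∏ u, ENNReal.ofReal (P.dens (Function.update Θ t ϑ u) (τ u).1 (τ u).2)
          ∂(P.trajRef H)).toReal := by
    intro ϑ
    rw [integral_eq_lintegral_of_nonneg_ae
      (Eventually.of_forall fun τ => mul_nonneg (hpos _) (P.mixDens_pos _ τ).le)
      ((hmeas (hf.add_const c)).mul (P.measurable_mixDens _)).aestronglyMeasurable]
    simp_rw [ENNReal.ofReal_mul (hpos _), P.ofReal_mixDens]
  have hsplit : ∀ ϑ, ∫ τ, f (τ t).1 * P.mixDens (Function.update Θ t ϑ) τ ∂(P.trajRef H)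
      = ∫ τ, (f (τ t).1 + c) * P.mixDens (Function.update Θ t ϑ) τ ∂(P.trajRef H) - c := by
    intro ϑ
    simp_rw [add_mul]
    rw [integral_add ((P.integrable_mixDens _).bdd_mul (hmeas hf).aestronglyMeasurable
      (Eventually.of_forall fun τ => hc _)) ((P.integrable_mixDens _).const_mul c),
      integral_const_mul, P.integral_mixDens]
    ring
  rw [hsplit, hsplit, hshift, hshift]
  congr 2
  exact lintegral_trajRef_state_mul_prod H (fun u => P.isPolicyDensity_dens _)
    (fun u => P.isPolicyDensity_dens _) t
    (fun u hu => by simp only [Function.update_of_ne hu]) (hf.add_const c).ennreal_ofReal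

instance isProbabilityMeasure_trajLaw (θ : Param q) : IsProbabilityMeasure (P.trajLaw θ) :=
  ⟨by rw [trajLaw, withDensity_apply _ MeasurableSet.univ, Measure.restrict_univ]
      exact P.lintegral_mixDens fun _ => θ⟩

theorem integral_trajLaw {E : Type*} [NormedAddCommGroup E] [NormedSpace ℝ E] (θ : Param q)
    (f : Traj S A H → E) :
    ∫ τ, f τ ∂(P.trajLaw θ) = ∫ τ, P.trajDens θ τ • f τ ∂(P.trajRef H) := by
  rw [trajLaw, integral_withDensity_eq_integral_toReal_smul
    (P.measurable_trajDens θ).ennreal_ofReal (Eventually.of_forall fun _ => ENNReal.ofReal_lt_top)]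
  simp_rw [ENNReal.toReal_ofReal (P.trajDens_pos θ _).le]

theorem trajDens_mul_weight (θ₁ θ₂ : Param q) (τ : Traj S A H) :
    P.trajDens θ₁ τ * P.weight τ θ₁ θ₂ = P.trajDens θ₂ τ :=
  mul_div_cancel₀ _ (P.trajDens_pos θ₁ τ).ne'

/-- Change of measure. No integrability is required: both sides are literally the same integral
against `trajRef`. -/
theorem integral_weight_smul {E : Type*} [NormedAddCommGroup E] [NormedSpace ℝ E]
    (θ₁ θ₂ : Param q) (f : Traj S A H → E) :
    ∫ τ, P.weight τ θ₁ θ₂ • f τ ∂(P.trajLaw θ₁) = ∫ τ, f τ ∂(P.trajLaw θ₂) := by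
  simp_rw [P.integral_trajLaw, smul_smul, P.trajDens_mul_weight]

theorem integral_weight (θ₁ θ₂ : Param q) : ∫ τ, P.weight τ θ₁ θ₂ ∂(P.trajLaw θ₁) = 1 := by
  simpa using P.integral_weight_smul θ₁ θ₂ (fun _ => (1 : ℝ))

theorem measurable_weight_uncurry :
    Measurable fun z : Traj S A H × Param q × Param q => P.weight z.1 z.2.1 z.2.2 :=
  (P.measurable_trajDens_uncurry.comp (f := fun z : Traj S A H × Param q × Param q => (z.2.2, z.1))
    (by fun_prop)).div (P.measurable_trajDens_uncurry.comp
      (f := fun z : Traj S A H × Param q × Param q => (z.2.1, z.1)) (by fun_prop))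

theorem measurable_weight (θ₁ θ₂ : Param q) : Measurable fun τ => P.weight τ θ₁ θ₂ :=
  P.measurable_weight_uncurry.comp (f := fun τ => (τ, θ₁, θ₂)) (by fun_prop)

theorem measurable_ret : Measurable (P.ret) :=
  Finset.measurable_fun_sum _ fun t _ =>
    (P.measurable_reward.comp (measurable_pi_apply t)).const_mul _

end Model
end HSPG

/-! ### Policy gradient theorem and constants of the class -/

namespace HSPG

open Filter Topology

namespace Model

variable {S A : Type*} [MeasurableSpace S] [MeasurableSpace A] {q H : ℕ} {P : Model S A q H}
  {γ R b G M : ℝ}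

namespace Bounded

theorem hasGradientAt_log (hP : P.Bounded γ R b G M) (θ : Param q) (s : S) (a : A) :
    HasGradientAt (fun θ' => Real.log (P.dens θ' s a)) (P.score θ s a) θ :=
  (hP.differentiable_log s a θ).hasGradientAt

theorem measurable_score (hP : P.Bounded γ R b G M) :
    Measurable fun z : Param q × S × A => P.score z.1 z.2.1 z.2.2 :=
  measurable_of_hasGradientAt (f := fun θ (z : S × A) => Real.log (P.dens θ z.1 z.2))
    (Real.measurable_log.comp P.measurable_dens) fun θ z => hP.hasGradientAt_log θ z.1 z.2

theorem measurable_score_traj (hP : P.Bounded γ R b G M) (t : Fin H) :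
    Measurable fun z : Traj S A H × Param q => P.score z.2 (z.1 t).1 (z.1 t).2 :=
  hP.measurable_score.comp (f := fun z : Traj S A H × Param q => (z.2, (z.1 t).1, (z.1 t).2))
    (by fun_prop)

theorem measurable_g_uncurry (hP : P.Bounded γ R b G M) :
    Measurable fun z : Traj S A H × Param q => P.g z.1 z.2 := by
  refine Finset.measurable_fun_sum _ fun t _ => Measurable.fun_smul (Measurable.fun_sub ?_ ?_) ?_
  · exact P.measurable_ret.comp measurable_fst
  · exact (P.measurable_baseline t).comp (f := fun z : Traj S A H × Param q => (z.1 t).1)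
      (by fun_prop)
  · exact hP.measurable_score_traj t

theorem measurable_g (hP : P.Bounded γ R b G M) (θ : Param q) : Measurable fun τ => P.g τ θ :=
  hP.measurable_g_uncurry.comp (f := fun τ => (τ, θ)) (by fun_prop)

theorem norm_score_sub_le (hP : P.Bounded γ R b G M) (θ₁ θ₂ : Param q) (s : S) (a : A) :
    ‖P.score θ₁ s a - P.score θ₂ s a‖ ≤ M * ‖θ₁ - θ₂‖ :=
  convex_univ.norm_image_sub_le_of_norm_fderiv_le (fun θ _ => hP.differentiable_score s a θ)
    (fun θ _ => hP.hessian_le θ s a) (Set.mem_univ θ₂) (Set.mem_univ θ₁)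

theorem abs_ret_le (hP : P.Bounded γ R b G M) (hγ0 : 0 ≤ γ) (hγ1 : γ < 1) (τ : Traj S A H) :
    |P.ret τ| ≤ H * R := by
  refine (Finset.abs_sum_le_sum_abs _ _).trans ?_
  have : ∀ t ∈ (Finset.univ : Finset (Fin H)),
      |P.discount ^ (t : ℕ) * P.reward (τ t).1 (τ t).2| ≤ R := by
    intro t _
    rw [hP.discount_eq, abs_mul, abs_of_nonneg (pow_nonneg hγ0 _)]
    refine (mul_le_mul_of_nonneg_right (pow_le_one₀ hγ0 hγ1.le) (abs_nonneg _)).trans ?_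
    rw [one_mul]
    exact hP.reward_le _ _
  refine (Finset.sum_le_card_nsmul _ _ _ this).trans ?_
  simp

theorem abs_ret_sub_baseline_le (hP : P.Bounded γ R b G M) (hγ0 : 0 ≤ γ) (hγ1 : γ < 1)
    (τ : Traj S A H) (t : Fin H) : |P.ret τ - P.baseline t (τ t).1| ≤ H * R + b :=
  (abs_sub _ _).trans (add_le_add (hP.abs_ret_le hγ0 hγ1 τ) (hP.baseline_le _ _))

theorem norm_g_le (hP : P.Bounded γ R b G M) (hγ0 : 0 ≤ γ) (hγ1 : γ < 1) (τ : Traj S A H)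
    (θ : Param q) : ‖P.g τ θ‖ ≤ H * ((H * R + b) * G) := by
  refine (norm_sum_le _ _).trans ?_
  have : ∀ t ∈ (Finset.univ : Finset (Fin H)),
      ‖(P.ret τ - P.baseline t (τ t).1) • P.score θ (τ t).1 (τ t).2‖ ≤ (H * R + b) * G := by
    intro t _
    rw [norm_smul, Real.norm_eq_abs]
    exact mul_le_mul (hP.abs_ret_sub_baseline_le hγ0 hγ1 τ t) (hP.score_le _ _ _) (norm_nonneg _)
      ((abs_nonneg _).trans (hP.abs_ret_sub_baseline_le hγ0 hγ1 τ t))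
  refine (Finset.sum_le_card_nsmul _ _ _ this).trans ?_
  simp

theorem norm_g_sub_le (hP : P.Bounded γ R b G M) (hγ0 : 0 ≤ γ) (hγ1 : γ < 1) (τ : Traj S A H)
    (θ₁ θ₂ : Param q) :
    ‖P.g τ θ₁ - P.g τ θ₂‖ ≤ H * ((H * R + b) * M) * ‖θ₁ - θ₂‖ := by
  rw [g, g, ← Finset.sum_sub_distrib]
  refine (norm_sum_le _ _).trans ?_
  have : ∀ t ∈ (Finset.univ : Finset (Fin H)),
      ‖(P.ret τ - P.baseline t (τ t).1) • P.score θ₁ (τ t).1 (τ t).2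
        - (P.ret τ - P.baseline t (τ t).1) • P.score θ₂ (τ t).1 (τ t).2‖
      ≤ (H * R + b) * (M * ‖θ₁ - θ₂‖) := by
    intro t _
    rw [← smul_sub, norm_smul, Real.norm_eq_abs]
    exact mul_le_mul (hP.abs_ret_sub_baseline_le hγ0 hγ1 τ t) (hP.norm_score_sub_le _ _ _ _)
      (norm_nonneg _) ((abs_nonneg _).trans (hP.abs_ret_sub_baseline_le hγ0 hγ1 τ t))
  refine (Finset.sum_le_card_nsmul _ _ _ this).trans (le_of_eq ?_)
  simp
  ring

/-- The logarithm of the weight is a sum of `H` differences, each at most `G * ‖θ₁ - θ₂‖`. The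
restriction to distance one keeps the exponential factor constant. -/
theorem abs_weight_sub_one_le (hP : P.Bounded γ R b G M) (hG : 0 < G) (τ : Traj S A H)
    {θ₁ θ₂ : Param q} (hθ : ‖θ₁ - θ₂‖ ≤ 1) :
    |P.weight τ θ₁ θ₂ - 1| ≤ H * G * Real.exp (H * G) * ‖θ₁ - θ₂‖ := by
  set x := ∑ t, (Real.log (P.dens θ₂ (τ t).1 (τ t).2) - Real.log (P.dens θ₁ (τ t).1 (τ t).2))
    with hx
  have hw : P.weight τ θ₁ θ₂ = Real.exp x := by
    rw [hx, Finset.sum_sub_distrib, Real.exp_sub]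
    exact congrArg₂ _ (P.mixDens_eq_exp (fun _ => θ₂) τ) (P.mixDens_eq_exp (fun _ => θ₁) τ)
  have hxle : |x| ≤ H * G * ‖θ₁ - θ₂‖ := by
    refine (Finset.abs_sum_le_sum_abs _ _).trans ?_
    refine (Finset.sum_le_card_nsmul _ _ (G * ‖θ₁ - θ₂‖) fun t _ => ?_).trans (le_of_eq ?_)
    · rw [norm_sub_rev]
      exact norm_sub_le_of_norm_gradient_le
        (fun θ => hP.hasGradientAt_log θ (τ t).1 (τ t).2) (fun θ => hP.score_le _ _ _) θ₁ θ₂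
    · simp
      ring
  have hxle' : |x| ≤ H * G := hxle.trans (mul_le_of_le_one_right (by positivity) hθ)
  rw [hw]
  refine (abs_exp_sub_one_le_mul_exp hxle').trans ?_
  rw [mul_right_comm]
  exact mul_le_mul_of_nonneg_right hxle (Real.exp_pos _).le

theorem integrable_of_norm_le {E : Type*} [NormedAddCommGroup E] {f : Traj S A H → E}
    (P : Model S A q H) (θ : Param q) (hf : AEStronglyMeasurable f (P.trajLaw θ)) {c : ℝ}
    (hc : ∀ τ, ‖f τ‖ ≤ c) :
    Integrable f (P.trajLaw θ) :=
  Integrable.of_bound hf c (Eventually.of_forall hc)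

/-- Only the policies at times in `I` vary. `I = {t}` serves to eliminate the baseline at time `t`,
and `I = univ` gives the gradient of `J`. -/
theorem hasGradientAt_integral_mixDens (hP : P.Bounded γ R b G M) {f : Traj S A H → ℝ}
    (hf : Measurable f) {c : ℝ} (hc : ∀ τ, |f τ| ≤ c) (I : Finset (Fin H)) (θ : Param q) :
    HasGradientAt (fun θ' => ∫ τ, f τ * P.mixDens (fun u => if u ∈ I then θ' else θ) τ
        ∂(P.trajRef H))
      (∫ τ, f τ • ∑ u ∈ I, P.score θ (τ u).1 (τ u).2 ∂(P.trajLaw θ)) θ := by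
  have hm : ∀ θ', Measurable fun τ : Traj S A H => ∑ u ∈ I, P.score θ' (τ u).1 (τ u).2 :=
    fun θ' => Finset.measurable_fun_sum _ fun u _ =>
      (hP.measurable_score_traj u).comp (f := fun τ => (τ, θ')) (by fun_prop)
  have h := hasGradientAt_integral_mul_exp (μ := P.trajRef H) (φ := f)
    (ψ := fun θ' τ => ∑ u, Real.log (P.dens (if u ∈ I then θ' else θ) (τ u).1 (τ u).2))
    (ψ' := fun θ' τ => ∑ u ∈ I, P.score θ' (τ u).1 (τ u).2) (k := I.card • G) hf hc
    (fun θ' => Finset.measurable_fun_sum _ fun u _ => Real.measurable_log.comp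
      ((P.measurable_dens_right _).comp (measurable_pi_apply u)))
    (fun θ' τ => ?_) (fun θ' τ => (norm_sum_le _ _).trans
      (Finset.sum_le_card_nsmul _ _ _ fun u _ => hP.score_le _ _ _)) θ (hm θ) ?_
  · simp_rw [← P.mixDens_eq_exp] at h
    rw [P.integral_trajLaw]
    convert h using 1
    refine integral_congr_ae (Eventually.of_forall fun τ => ?_)
    simp [smul_smul, mul_comm, mixDens, trajDens]
  · rw [hasGradientAt_iff_hasFDerivAt, map_sum, ← Finset.univ_inter I, ← Finset.sum_ite_mem,
      Finset.univ_inter]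
    refine HasFDerivAt.fun_sum fun u _ => ?_
    by_cases hu : u ∈ I
    · simpa only [hu, if_true] using (hP.hasGradientAt_log θ' (τ u).1 (τ u).2).hasFDerivAt
    · simpa only [hu, if_false] using hasFDerivAt_const _ _
  · simp_rw [← P.mixDens_eq_exp]
    exact P.integrable_mixDens _

/-- The left side is the gradient of the mean of `f` at the state of time `t` with respect to the
policy of time `t` alone. That mean does not depend on this policy. -/
theorem integral_state_smul_score (hP : P.Bounded γ R b G M) (t : Fin H) {f : S → ℝ}
    (hf : Measurable f) {c : ℝ} (hc : ∀ s, |f s| ≤ c) (θ : Param q) :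
    ∫ τ, f (τ t).1 • P.score θ (τ t).1 (τ t).2 ∂(P.trajLaw θ) = 0 := by
  have h := hP.hasGradientAt_integral_mixDens (f := fun τ => f (τ t).1)
    (hf.comp (measurable_fst.comp (measurable_pi_apply t))) (fun τ => hc _) {t} θ
  simp only [Finset.sum_singleton] at h
  refine h.unique ?_
  have hconst : (fun θ' => ∫ τ, f (τ t).1 *
      P.mixDens (fun u => if u ∈ ({t} : Finset (Fin H)) then θ' else θ) τ ∂(P.trajRef H))
      = fun _ => ∫ τ, f (τ t).1 * P.mixDens (Function.update (fun _ => θ) t θ) τ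
        ∂(P.trajRef H) := by
    funext θ'
    rw [P.integral_state_mul_mixDens_update (fun _ => θ) t θ θ' hf hc]
    refine integral_congr_ae (Eventually.of_forall fun τ => ?_)
    simp only [Finset.mem_singleton, mixDens, Function.update_apply]
  rw [hconst]
  exact hasGradientAt_const _ _

/-- The policy gradient theorem with a baseline. -/
theorem hasGradientAt_J (hP : P.Bounded γ R b G M) (hγ0 : 0 ≤ γ) (hγ1 : γ < 1) (θ : Param q) :
    HasGradientAt P.J (∫ τ, P.g τ θ ∂(P.trajLaw θ)) θ := by
  have h := hP.hasGradientAt_integral_mixDens P.measurable_ret (hP.abs_ret_le hγ0 hγ1)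
    Finset.univ θ
  have hJ : P.J = fun θ' => ∫ τ, P.ret τ *
      P.mixDens (fun u => if u ∈ (Finset.univ : Finset (Fin H)) then θ' else θ) τ
        ∂(P.trajRef H) := by
    funext θ'
    rw [J, P.integral_trajLaw]
    simp [mixDens, trajDens, mul_comm]
  rw [hJ]
  convert h using 1
  have hb : ∀ t : Fin H, Measurable fun τ : Traj S A H => P.baseline t (τ t).1 := fun t =>
    (P.measurable_baseline t).comp (measurable_fst.comp (measurable_pi_apply t))
  have hs : ∀ t : Fin H, Measurable fun τ : Traj S A H => P.score θ (τ t).1 (τ t).2 := fun t =>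
    (hP.measurable_score_traj t).comp (f := fun τ => (τ, θ)) (by fun_prop)
  have hi : ∀ {f : Traj S A H → ℝ}, Measurable f → ∀ {c : ℝ}, (∀ τ, |f τ| ≤ c) → ∀ t,
      Integrable (fun τ => f τ • P.score θ (τ t).1 (τ t).2) (P.trajLaw θ) := by
    intro f hf c hc t
    refine integrable_of_norm_le P θ (hf.smul (hs t)).aestronglyMeasurable (c := c * G)
      fun τ => ?_
    rw [norm_smul]
    exact mul_le_mul (hc τ) (hP.score_le _ _ _) (norm_nonneg _) ((abs_nonneg _).trans (hc τ))
  simp_rw [g, Finset.smul_sum, sub_smul]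
  rw [integral_finsetSum (f := fun t (τ : Traj S A H) => P.ret τ • P.score θ (τ t).1 (τ t).2
      - P.baseline t (τ t).1 • P.score θ (τ t).1 (τ t).2) _ fun t _ =>
      (hi P.measurable_ret (hP.abs_ret_le hγ0 hγ1) t).sub
        (hi (hb t) (fun τ => hP.baseline_le _ _) t), integral_finsetSum _ fun t _ => hi P.measurable_ret (hP.abs_ret_le hγ0 hγ1) t]
  refine Finset.sum_congr rfl fun t _ => ?_
  rw [integral_sub (hi P.measurable_ret (hP.abs_ret_le hγ0 hγ1) t)
    (hi (hb t) (fun τ => hP.baseline_le _ _) t),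
    hP.integral_state_smul_score t (P.measurable_baseline t) (hP.baseline_le t), sub_zero]

theorem gradient_J (hP : P.Bounded γ R b G M) (hγ0 : 0 ≤ γ) (hγ1 : γ < 1) (θ : Param q) :
    gradient P.J θ = ∫ τ, P.g τ θ ∂(P.trajLaw θ) :=
  (hP.hasGradientAt_J hγ0 hγ1 θ).gradient

theorem integrable_g (hP : P.Bounded γ R b G M) (hγ0 : 0 ≤ γ) (hγ1 : γ < 1) (θ θ' : Param q) :
    Integrable (fun τ => P.g τ θ) (P.trajLaw θ') :=
  integrable_of_norm_le P θ' (hP.measurable_g θ).aestronglyMeasurable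
    fun τ => hP.norm_g_le hγ0 hγ1 τ θ

theorem norm_gradient_J_le (hP : P.Bounded γ R b G M) (hγ0 : 0 ≤ γ) (hγ1 : γ < 1)
    (θ : Param q) : ‖gradient P.J θ‖ ≤ H * ((H * R + b) * G) := by
  rw [hP.gradient_J hγ0 hγ1]
  simpa using norm_integral_le_of_norm_le_const (μ := P.trajLaw θ)
    (Eventually.of_forall fun τ => hP.norm_g_le hγ0 hγ1 τ θ)

theorem norm_g_sub_weight_smul_g_le (hP : P.Bounded γ R b G M) (hγ0 : 0 ≤ γ) (hγ1 : γ < 1)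
    (τ : Traj S A H) (θ₁ θ₂ : Param q) :
    ‖P.g τ θ₁ - P.weight τ θ₁ θ₂ • P.g τ θ₂‖
      ≤ H * ((H * R + b) * M) * ‖θ₁ - θ₂‖
        + H * ((H * R + b) * G) * |P.weight τ θ₁ θ₂ - 1| := by
  have e : P.g τ θ₁ - P.weight τ θ₁ θ₂ • P.g τ θ₂
      = (P.g τ θ₁ - P.g τ θ₂) - (P.weight τ θ₁ θ₂ - 1) • P.g τ θ₂ := by
    rw [sub_smul, one_smul]; abel
  rw [e]
  refine (norm_sub_le _ _).trans (add_le_add (hP.norm_g_sub_le hγ0 hγ1 τ θ₁ θ₂) ?_)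
  rw [norm_smul, Real.norm_eq_abs, mul_comm]
  exact mul_le_mul_of_nonneg_right (hP.norm_g_le hγ0 hγ1 τ θ₂) (abs_nonneg _)

/-- At distance at most one, importance weighting writes the difference as one integral under the
law of `θ₁`, with a pointwise bounded integrand. Beyond distance one, twice the uniform bound on the
gradient is already linear in the distance; it is the last summand of the constant. -/
theorem norm_gradient_J_sub_le (hP : P.Bounded γ R b G M) (hγ0 : 0 ≤ γ) (hγ1 : γ < 1)
    (hR : 0 < R) (hb : 0 ≤ b) (hG : 0 < G) (hM : 0 < M) (θ₁ θ₂ : Param q) :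
    ‖gradient P.J θ₁ - gradient P.J θ₂‖
      ≤ (H * ((H * R + b) * M) + H * ((H * R + b) * G) * (H * G * Real.exp (H * G))
        + 2 * (H * ((H * R + b) * G))) * ‖θ₁ - θ₂‖ := by
  have hd := norm_nonneg (θ₁ - θ₂)
  by_cases hθ : ‖θ₁ - θ₂‖ ≤ 1
  · have hbound : ∀ τ, ‖P.g τ θ₁ - P.weight τ θ₁ θ₂ • P.g τ θ₂‖
        ≤ (H * ((H * R + b) * M) + H * ((H * R + b) * G) * (H * G * Real.exp (H * G)))
          * ‖θ₁ - θ₂‖ := by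
      intro τ
      refine (hP.norm_g_sub_weight_smul_g_le hγ0 hγ1 τ θ₁ θ₂).trans ?_
      have := mul_le_mul_of_nonneg_left (hP.abs_weight_sub_one_le hG τ hθ)
        (show 0 ≤ H * ((H * R + b) * G) by positivity)
      linarith
    have hm : Measurable fun τ => P.weight τ θ₁ θ₂ • P.g τ θ₂ :=
      (P.measurable_weight θ₁ θ₂).smul (hP.measurable_g θ₂)
    have hi : Integrable (fun τ => P.weight τ θ₁ θ₂ • P.g τ θ₂) (P.trajLaw θ₁) := by
      have := (hP.integrable_g hγ0 hγ1 θ₁ θ₁).sub (integrable_of_norm_le P θ₁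
        ((hP.measurable_g θ₁).sub hm).aestronglyMeasurable hbound)
      simpa [Pi.sub_def] using this
    have e : gradient P.J θ₁ - gradient P.J θ₂
        = ∫ τ, (P.g τ θ₁ - P.weight τ θ₁ θ₂ • P.g τ θ₂) ∂(P.trajLaw θ₁) := by
      rw [integral_sub (hP.integrable_g hγ0 hγ1 θ₁ θ₁) hi, P.integral_weight_smul,
        hP.gradient_J hγ0 hγ1, hP.gradient_J hγ0 hγ1]
    rw [e]
    have := norm_integral_le_of_norm_le_const (μ := P.trajLaw θ₁) (Eventually.of_forall hbound)
    rw [probReal_univ, mul_one] at this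
    refine this.trans (mul_le_mul_of_nonneg_right ?_ hd)
    have : 0 ≤ H * ((H * R + b) * G) := by positivity
    linarith
  · push Not at hθ
    have h1 := hP.norm_gradient_J_le hγ0 hγ1 θ₁
    have h2 := hP.norm_gradient_J_le hγ0 hγ1 θ₂
    have h3 := norm_sub_le (gradient P.J θ₁) (gradient P.J θ₂)
    have h4 : 0 ≤ H * ((H * R + b) * M) + H * ((H * R + b) * G) * (H * G * Real.exp (H * G)) := by
      positivity
    have h5 : 0 ≤ H * ((H * R + b) * G) := by positivity
    nlinarith

theorem weightVar_eq (P : Model S A q H) (θ₁ θ₂ : Param q) :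
    P.weightVar θ₁ θ₂
      = ∫⁻ τ, ENNReal.ofReal ((P.weight τ θ₁ θ₂ - 1) ^ 2) ∂(P.trajLaw θ₁) := by
  rw [weightVar, evariance, P.integral_weight]
  refine lintegral_congr fun τ => ?_
  rw [Real.enorm_eq_ofReal_abs, ← ENNReal.ofReal_pow (abs_nonneg _), sq_abs]

/-- The hypothesis only bounds the variance, and a bound proportional to the squared distance is
wanted. Nearby it follows from the pointwise bound on `ω - 1`; beyond distance one `‖θ₁ - θ₂‖ ^ 2 ≥
1`, so `W` itself suffices. -/
theorem weightVar_le (hP : P.Bounded γ R b G M) (hG : 0 < G) {W : ℝ} (hW : 0 < W)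
    {θ₁ θ₂ : Param q} (h : P.weightVar θ₁ θ₂ ≤ ENNReal.ofReal W) :
    P.weightVar θ₁ θ₂
      ≤ ENNReal.ofReal (((H * G * Real.exp (H * G)) ^ 2 + W) * ‖θ₁ - θ₂‖ ^ 2) := by
  by_cases hθ : ‖θ₁ - θ₂‖ ≤ 1
  · rw [weightVar_eq]
    have hle : ∀ τ, ENNReal.ofReal ((P.weight τ θ₁ θ₂ - 1) ^ 2)
        ≤ ENNReal.ofReal (((H * G * Real.exp (H * G)) ^ 2 + W) * ‖θ₁ - θ₂‖ ^ 2) := by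
      intro τ
      refine ENNReal.ofReal_le_ofReal ?_
      rw [← sq_abs]
      refine (pow_le_pow_left₀ (abs_nonneg _) (hP.abs_weight_sub_one_le hG τ hθ) 2).trans ?_
      rw [mul_pow]
      exact mul_le_mul_of_nonneg_right (by linarith) (by positivity)
    refine (lintegral_mono hle).trans ?_
    simp
  · push Not at hθ
    refine h.trans (ENNReal.ofReal_le_ofReal ?_)
    have h1 : 1 ≤ ‖θ₁ - θ₂‖ ^ 2 := one_le_pow₀ hθ.le
    have h2 := sq_nonneg (H * G * Real.exp (H * G))
    nlinarith

/-- Split into the change of `g`, Lipschitz in the parameter, and `(ω - 1) g`, whose mean square is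
controlled by the variance of `ω` because `ω` has mean one. -/
theorem lintegral_sq_norm_g_sub_weight_smul_g_le (hP : P.Bounded γ R b G M) (hγ0 : 0 ≤ γ)
    (hγ1 : γ < 1) (hG : 0 < G) {W : ℝ} (hW : 0 < W)
    {θ₁ θ₂ : Param q} (h : P.weightVar θ₁ θ₂ ≤ ENNReal.ofReal W) :
    ∫⁻ τ, ENNReal.ofReal (‖P.g τ θ₁ - P.weight τ θ₁ θ₂ • P.g τ θ₂‖ ^ 2) ∂(P.trajLaw θ₁)
      ≤ ENNReal.ofReal ((2 * (H * ((H * R + b) * M)) ^ 2 + 2 * (H * ((H * R + b) * G)) ^ 2 *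
          ((H * G * Real.exp (H * G)) ^ 2 + W)) * ‖θ₁ - θ₂‖ ^ 2) := by
  set l := H * ((H * R + b) * M)
  set k := H * ((H * R + b) * G)
  have hle : ∀ τ, ENNReal.ofReal (‖P.g τ θ₁ - P.weight τ θ₁ θ₂ • P.g τ θ₂‖ ^ 2)
      ≤ ENNReal.ofReal (2 * l ^ 2 * ‖θ₁ - θ₂‖ ^ 2)
        + ENNReal.ofReal (2 * k ^ 2) * ENNReal.ofReal ((P.weight τ θ₁ θ₂ - 1) ^ 2) := by
    intro τ
    rw [← ENNReal.ofReal_mul (by positivity), ← ENNReal.ofReal_add (by positivity) (by positivity)]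
    refine ENNReal.ofReal_le_ofReal ?_
    refine (pow_le_pow_left₀ (norm_nonneg _)
      (hP.norm_g_sub_weight_smul_g_le hγ0 hγ1 τ θ₁ θ₂) 2).trans ?_
    rw [← sq_abs (P.weight τ θ₁ θ₂ - 1)]
    nlinarith [sq_nonneg (l * ‖θ₁ - θ₂‖ - k * |P.weight τ θ₁ θ₂ - 1|)]
  refine (lintegral_mono hle).trans ?_
  have hm : Measurable fun τ => ENNReal.ofReal ((P.weight τ θ₁ θ₂ - 1) ^ 2) :=
    (((P.measurable_weight θ₁ θ₂).sub_const 1).pow_const 2).ennreal_ofReal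
  rw [lintegral_add_left measurable_const, lintegral_const_mul _ hm, ← weightVar_eq,
    lintegral_const, measure_univ, mul_one]
  refine (add_le_add_right (mul_le_mul_right (hP.weightVar_le hG hW h) _) _).trans
    (le_of_eq ?_)
  rw [← ENNReal.ofReal_mul (by positivity), ← ENNReal.ofReal_add (by positivity) (by positivity)]
  congr 1
  ring

end Bounded

theorem SmoothnessConstants.mono {W L₀ σ₀ C₀ L σ C : ℝ} (h : P.SmoothnessConstants W L₀ σ₀ C₀)
    (hL : L₀ ≤ L) (hσ0 : 0 ≤ σ₀) (hσ : σ₀ ≤ σ) (hC : C₀ ≤ C) :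
    P.SmoothnessConstants W L σ C where
  differentiable := h.differentiable
  lipschitz θ₁ θ₂ := (h.lipschitz θ₁ θ₂).trans (mul_le_mul_of_nonneg_right hL (norm_nonneg _))
  variance τ θ := (h.variance τ θ).trans (pow_le_pow_left₀ hσ0 hσ 2)
  meanSquare θ₁ θ₂ hθ := (h.meanSquare θ₁ θ₂ hθ).trans
    (ENNReal.ofReal_le_ofReal (mul_le_mul_of_nonneg_right hC (by positivity)))

/-- Constants of smoothness and of variance that depend only on the bounds of the class. -/
theorem exists_smoothnessConstants (H : ℕ) (γ R b G M W : ℝ) (hγ0 : 0 ≤ γ) (hγ1 : γ < 1)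
    (hR : 0 < R) (hb : 0 ≤ b) (hG : 0 < G) (hM : 0 < M) (hW : 0 < W) :
    ∃ L₀ σ₀ C₀ : ℝ, 0 < L₀ ∧ 0 < σ₀ ∧ 0 < C₀ ∧
      ∀ (S : Type*) (A : Type*) [MeasurableSpace S] [MeasurableSpace A] (q : ℕ)
        (P : Model S A q H), P.Bounded γ R b G M → P.SmoothnessConstants W L₀ σ₀ C₀ := by
  have hl : 0 ≤ H * ((H * R + b) * M) := by positivity
  have hk : 0 ≤ H * ((H * R + b) * G) := by positivity
  -- The summands `+ 1` keep the three constants positive when `H = 0`.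
  refine ⟨H * ((H * R + b) * M) + H * ((H * R + b) * G) * (H * G * Real.exp (H * G))
    + 2 * (H * ((H * R + b) * G)) + 1, 2 * (H * ((H * R + b) * G)) + 1,
    2 * (H * ((H * R + b) * M)) ^ 2 + 2 * (H * ((H * R + b) * G)) ^ 2 *
      ((H * G * Real.exp (H * G)) ^ 2 + W) + 1, by positivity, by positivity, by positivity, ?_⟩
  intro S A _ _ q P hP
  refine ⟨fun θ => (hP.hasGradientAt_J hγ0 hγ1 θ).differentiableAt, fun θ₁ θ₂ => ?_,
    fun τ θ => ?_, fun θ₁ θ₂ h => ?_⟩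
  · refine (hP.norm_gradient_J_sub_le hγ0 hγ1 hR hb hG hM θ₁ θ₂).trans ?_
    exact mul_le_mul_of_nonneg_right (by linarith) (norm_nonneg _)
  · refine pow_le_pow_left₀ (norm_nonneg _) ?_ 2
    have h1 := norm_sub_le (P.g τ θ) (gradient P.J θ)
    have h2 := hP.norm_g_le hγ0 hγ1 τ θ
    have h3 := hP.norm_gradient_J_le hγ0 hγ1 θ
    linarith
  · refine (hP.lintegral_sq_norm_g_sub_weight_smul_g_le hγ0 hγ1 hG hW h).trans ?_
    exact ENNReal.ofReal_le_ofReal (mul_le_mul_of_nonneg_right (by linarith) (by positivity))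

end Model
end HSPG

/-! ### Second moments of sums of independent vectors -/

namespace HSPG

open Filter Topology

section Probability

variable {Ω Ω' : Type*} [MeasurableSpace Ω] [MeasurableSpace Ω'] {q : ℕ}

/-- The cross term is the inner product of `a` with a mean that vanishes. The free vector `a` lets
independent samples be absorbed one at a time. -/
theorem lintegral_sq_norm_add {μ : Measure Ω} [IsProbabilityMeasure μ] {X : Ω → Param q}
    (hX : MemLp X 2 μ) (h0 : ∫ ω, X ω ∂μ = 0) (a : Param q) :
    ∫⁻ ω, ENNReal.ofReal (‖a + X ω‖ ^ 2) ∂μ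
      = ENNReal.ofReal (‖a‖ ^ 2) + ∫⁻ ω, ENNReal.ofReal (‖X ω‖ ^ 2) ∂μ := by
  have hi : Integrable X μ := hX.integrable (by norm_num)
  have hsq : Integrable (fun ω => ‖X ω‖ ^ 2) μ :=
    (memLp_two_iff_integrable_sq_norm hX.aestronglyMeasurable).1 hX
  have hin : Integrable (fun ω => 2 * inner ℝ a (X ω)) μ := (hi.const_inner a).const_mul 2
  have hca : Integrable (fun ω => ‖a‖ ^ 2 + 2 * inner ℝ a (X ω)) μ :=
    (integrable_const (‖a‖ ^ 2)).add hin
  have e : (fun ω => ‖a + X ω‖ ^ 2) = fun ω => ‖a‖ ^ 2 + 2 * inner ℝ a (X ω) + ‖X ω‖ ^ 2 := by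
    funext ω
    exact norm_add_sq_real a (X ω)
  have hall : Integrable (fun ω => ‖a + X ω‖ ^ 2) μ := by
    rw [e]; exact hca.add hsq
  rw [← ofReal_integral_eq_lintegral_ofReal hall (Eventually.of_forall fun ω => by positivity),
    ← ofReal_integral_eq_lintegral_ofReal hsq (Eventually.of_forall fun ω => by positivity),
    ← ENNReal.ofReal_add (by positivity) (integral_nonneg fun ω => by positivity), e,
    integral_add hca hsq, integral_add (integrable_const _) hin, integral_const_mul,
    integral_inner hi, h0]
  simp

theorem lintegral_sq_norm_centered_le {μ : Measure Ω} [IsProbabilityMeasure μ] {X : Ω → Param q}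
    (hX : MemLp X 2 μ) {m : Param q} (hm : ∫ ω, X ω ∂μ = m) :
    ∫⁻ ω, ENNReal.ofReal (‖X ω - m‖ ^ 2) ∂μ ≤ ∫⁻ ω, ENNReal.ofReal (‖X ω‖ ^ 2) ∂μ := by
  have h := lintegral_sq_norm_add (X := fun ω => X ω - m) (hX.sub (memLp_const m))
    (by rw [integral_sub (hX.integrable (by norm_num)) (integrable_const m), hm]; simp) m
  simp only [add_sub_cancel] at h
  rw [h]
  exact le_add_self

/-- The second moment of a sum of independent centered random vectors. -/
theorem lintegral_sq_norm_add_sum {μ : Measure Ω} [IsProbabilityMeasure μ] {X : Ω → Param q}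
    (hXm : Measurable X) (hX : MemLp X 2 μ) (h0 : ∫ ω, X ω ∂μ = 0) (n : ℕ) (a : Param q) :
    ∫⁻ x, ENNReal.ofReal (‖a + ∑ i, X (x i)‖ ^ 2) ∂(Measure.pi fun _ : Fin n => μ)
      = ENNReal.ofReal (‖a‖ ^ 2) + n * ∫⁻ ω, ENNReal.ofReal (‖X ω‖ ^ 2) ∂μ := by
  induction n generalizing a with
  | zero => simp
  | succ n ih =>
    -- Sample `0` is split off; for each of its values it joins `a`, and the induction hypothesis
    -- applies to the others.
    have hmp := measurePreserving_piFinSuccAbove (fun _ : Fin (n + 1) => μ) 0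
    have hf : Measurable fun z : Ω × (Fin n → Ω) =>
        ENNReal.ofReal (‖(a + X z.1) + ∑ i, X (z.2 i)‖ ^ 2) := by
      refine (Measurable.pow_const (Measurable.norm ?_) 2).ennreal_ofReal
      exact ((hXm.comp measurable_fst).const_add a).add (Finset.measurable_fun_sum _ fun i _ =>
        hXm.comp ((measurable_pi_apply i).comp measurable_snd))
    have h1 := hmp.lintegral_comp hf
    have h2 : ∀ x : Fin (n + 1) → Ω,
        (a + X ((MeasurableEquiv.piFinSuccAbove (fun _ => Ω) 0) x).1)
          + ∑ i, X (((MeasurableEquiv.piFinSuccAbove (fun _ => Ω) 0) x).2 i)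
          = a + ∑ i, X (x i) := by
      intro x
      rw [Fin.sum_univ_succ, add_assoc]
      rfl
    simp_rw [h2] at h1
    rw [h1, lintegral_prod _ hf.aemeasurable]
    simp_rw [ih]
    have hm1 : Measurable fun ω => ENNReal.ofReal (‖a + X ω‖ ^ 2) :=
      ((hXm.const_add a).norm.pow_const 2).ennreal_ofReal
    rw [lintegral_add_left hm1, lintegral_const, measure_univ, mul_one,
      lintegral_sq_norm_add hX h0]
    push_cast
    ring

theorem memLp_two_of_sq_norm_le {μ : Measure Ω} [IsProbabilityMeasure μ] {X : Ω → Param q}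
    (hX : Measurable X) {k : ℝ} (h : ∀ ω, ‖X ω‖ ^ 2 ≤ k) : MemLp X 2 μ :=
  MemLp.of_bound hX.aestronglyMeasurable √k
    (Eventually.of_forall fun ω => Real.le_sqrt_of_sq_le (h ω))

theorem lintegral_sq_norm_smul {μ : Measure Ω} {X : Ω → Param q} (hX : Measurable X) (s : ℝ) :
    ∫⁻ ω, ENNReal.ofReal (‖s • X ω‖ ^ 2) ∂μ
      = ENNReal.ofReal (s ^ 2) * ∫⁻ ω, ENNReal.ofReal (‖X ω‖ ^ 2) ∂μ := by
  rw [← lintegral_const_mul _ (hX.norm.pow_const 2).ennreal_ofReal]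
  refine lintegral_congr fun ω => ?_
  rw [← ENNReal.ofReal_mul (by positivity), norm_smul, mul_pow, Real.norm_eq_abs, sq_abs]

theorem sum_const_smul_sub {n : ℕ} (hn : 0 < n) (f : Fin n → Param q) (s : ℝ) (m : Param q) :
    ∑ i, (s / n) • (f i - m) = (s / n) • ∑ i, f i - s • m := by
  have hn' : (n : ℝ) ≠ 0 := by exact_mod_cast hn.ne'
  rw [← Finset.smul_sum, Finset.sum_sub_distrib, smul_sub, Finset.sum_const, Finset.card_univ,
    Fintype.card_fin, ← Nat.cast_smul_eq_nsmul ℝ, smul_smul, div_mul_cancel₀ _ hn']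

/-- The second moment of the sum of two independent batches of centered random vectors. -/
theorem lintegral_sq_norm_add_sum_add_sum {μ : Measure Ω} [IsProbabilityMeasure μ]
    {X Y : Ω → Param q} (hXm : Measurable X) (hX : MemLp X 2 μ) (hX0 : ∫ ω, X ω ∂μ = 0)
    (hYm : Measurable Y) (hY : MemLp Y 2 μ) (hY0 : ∫ ω, Y ω ∂μ = 0) (n : ℕ) (a : Param q) :
    ∫⁻ z, ENNReal.ofReal (‖(a + ∑ i, X (z.1 i)) + ∑ i, Y (z.2 i)‖ ^ 2)
        ∂((Measure.pi fun _ : Fin n => μ).prod (Measure.pi fun _ : Fin n => μ))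
      = ENNReal.ofReal (‖a‖ ^ 2) + n * ∫⁻ ω, ENNReal.ofReal (‖X ω‖ ^ 2) ∂μ
        + n * ∫⁻ ω, ENNReal.ofReal (‖Y ω‖ ^ 2) ∂μ := by
  have hmeas : Measurable fun z : (Fin n → Ω) × (Fin n → Ω) =>
      ENNReal.ofReal (‖(a + ∑ i, X (z.1 i)) + ∑ i, Y (z.2 i)‖ ^ 2) := by
    refine (Measurable.pow_const (Measurable.norm ?_) 2).ennreal_ofReal
    exact ((Finset.measurable_fun_sum _ fun i _ =>
      hXm.comp ((measurable_pi_apply i).comp measurable_fst)).const_add a).add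
      (Finset.measurable_fun_sum _ fun i _ => hYm.comp ((measurable_pi_apply i).comp measurable_snd))
  have hmeas1 : Measurable fun x : Fin n → Ω => ENNReal.ofReal (‖a + ∑ i, X (x i)‖ ^ 2) :=
    (((Finset.measurable_fun_sum _ fun i _ =>
      hXm.comp (measurable_pi_apply i)).const_add a).norm.pow_const 2).ennreal_ofReal
  rw [lintegral_prod _ hmeas.aemeasurable]
  simp only [lintegral_sq_norm_add_sum hYm hY hY0]
  rw [lintegral_add_left hmeas1, lintegral_const, measure_univ, mul_one,
    lintegral_sq_norm_add_sum hXm hX hX0]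

/-- Makes `firstIter` and `iter` measurable in the current state, so that integrals against the
binds in `law` can be computed. -/
theorem measurable_map_of_kernel {Ω'' : Type*} [MeasurableSpace Ω''] (κ : Kernel Ω Ω')
    [IsSFiniteKernel κ] {f : Ω × Ω' → Ω''} (hf : Measurable f) :
    Measurable fun x => (κ x).map fun y => f (x, y) := by
  refine Measure.measurable_of_measurable_coe _ fun s hs => ?_
  have h : ∀ x, ((κ x).map fun y => f (x, y)) s = κ x (Prod.mk x ⁻¹' (f ⁻¹' s)) := fun x =>
    Measure.map_apply (hf.comp measurable_prodMk_left) hs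
  simp_rw [h]
  exact Kernel.measurable_kernel_prodMk_left (hf hs)

theorem isProbabilityMeasure_bind {μ : Measure Ω} [IsProbabilityMeasure μ] {f : Ω → Measure Ω'}
    (hf : Measurable f) (h : ∀ x, IsProbabilityMeasure (f x)) :
    IsProbabilityMeasure (μ.bind f) :=
  ⟨by rw [Measure.bind_apply MeasurableSet.univ hf.aemeasurable]; simp⟩

end Probability

/-! ### Measurability of the algorithm and error of its estimators -/

namespace Model

variable {S A : Type*} [MeasurableSpace S] [MeasurableSpace A] {q H : ℕ} {P : Model S A q H}

theorem measurable_trajLaw (P : Model S A q H) : Measurable P.trajLaw := by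
  refine Measure.measurable_of_measurable_coe _ fun s hs => ?_
  simp_rw [trajLaw, withDensity_apply _ hs]
  exact Measurable.lintegral_prod_right' (ν := (P.trajRef H).restrict s)
    P.measurable_trajDens_uncurry.ennreal_ofReal

instance isProbabilityMeasure_batch (θ : Param q) (n : ℕ) :
    IsProbabilityMeasure (P.batch θ n) := by unfold batch; infer_instance

/-- Boxes form a generating π-system, and on a box the mass is a finite product of measurable
functions of `θ`. -/
theorem measurable_batch (P : Model S A q H) (n : ℕ) : Measurable fun θ => P.batch θ n := by
  refine Measurable.measure_of_isPiSystem_of_isProbabilityMeasure generateFrom_pi.symm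
    isPiSystem_pi fun s hs => ?_
  obtain ⟨t, ht, rfl⟩ := hs
  simp_rw [batch, Measure.pi_pi]
  exact Finset.measurable_fun_prod _ fun i _ =>
    (Measure.measurable_coe (s := t i) (ht i (Set.mem_univ i))).comp P.measurable_trajLaw

/-- The batches of size `n`, as a Markov kernel. -/
def batchKernel (P : Model S A q H) (n : ℕ) : Kernel (Param q) (Fin n → Traj S A H) :=
  ⟨fun θ => P.batch θ n, P.measurable_batch n⟩

instance (n : ℕ) : IsMarkovKernel (P.batchKernel n) :=
  ⟨fun θ => inferInstanceAs (IsProbabilityMeasure (P.batch θ n))⟩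

section Algorithm

variable {γ R b G M : ℝ} {Q : Param q → EReal} {c : Config}

theorem measurable_next (hprox : Measurable (proxStep c.η Q)) :
    Measurable fun z : Param q × Param q => next Q c z.1 z.2 := by
  have h : Measurable fun z : Param q × Param q => z.1 + c.η • z.2 := by fun_prop
  exact (measurable_fst.const_smul (1 - c.α)).add ((hprox.comp h).const_smul c.α)

theorem Bounded.measurable_firstEstimator (hP : P.Bounded γ R b G M) :
    Measurable fun z : Param q × (Fin c.N → Traj S A H) => P.firstEstimator c z.1 z.2 := by
  refine Measurable.fun_const_smul (Finset.measurable_fun_sum _ fun i _ => ?_) _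
  exact hP.measurable_g_uncurry.comp (f := fun z : Param q × (Fin c.N → Traj S A H) =>
    (z.2 i, z.1)) (by fun_prop)

/-- The first stochastic gradient difference of the hybrid estimator. -/
def gradDiff (P : Model S A q H) (τ : Traj S A H) (θ θ' : Param q) : Param q :=
  P.g τ θ - P.weight τ θ θ' • P.g τ θ'

theorem Bounded.measurable_gradDiff_uncurry (hP : P.Bounded γ R b G M) :
    Measurable fun z : Traj S A H × Param q × Param q => P.gradDiff z.1 z.2.1 z.2.2 :=
  (hP.measurable_g_uncurry.comp (f := fun z : Traj S A H × Param q × Param q => (z.1, z.2.1))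
    (by fun_prop)).sub (P.measurable_weight_uncurry.smul (hP.measurable_g_uncurry.comp
      (f := fun z : Traj S A H × Param q × Param q => (z.1, z.2.2)) (by fun_prop)))

theorem Bounded.measurable_gradDiff (hP : P.Bounded γ R b G M) (θ θ' : Param q) :
    Measurable fun τ => P.gradDiff τ θ θ' :=
  hP.measurable_gradDiff_uncurry.comp (f := fun τ => (τ, θ, θ')) (by fun_prop)

theorem Bounded.measurable_hybridEstimator (hP : P.Bounded γ R b G M) :
    Measurable fun z : (Param q × Param q × Param q) ×
        ((Fin c.B → Traj S A H) × (Fin c.B → Traj S A H)) =>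
      P.hybridEstimator c z.1.1 z.1.2.1 z.1.2.2 z.2.1 z.2.2 := by
  refine Measurable.fun_add (Measurable.fun_add ?_ ?_) ?_
  · fun_prop
  · refine Measurable.fun_const_smul (Finset.measurable_fun_sum _ fun i _ => ?_) _
    exact hP.measurable_gradDiff_uncurry.comp (f := fun z : (Param q × Param q × Param q) ×
        ((Fin c.B → Traj S A H) × (Fin c.B → Traj S A H)) => (z.2.1 i, z.1.2.2, z.1.1))
      (by fun_prop)
  · refine Measurable.fun_const_smul (Finset.measurable_fun_sum _ fun i _ => ?_) _
    exact hP.measurable_g_uncurry.comp (f := fun z : (Param q × Param q × Param q) ×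
        ((Fin c.B → Traj S A H) × (Fin c.B → Traj S A H)) => (z.2.2 i, z.1.2.2))
      (by fun_prop)

/-- The state after the first update, as a function of the input and of the first batch. -/
def firstState (P : Model S A q H) (Q : Param q → EReal) (c : Config)
    (z : (Param q × ℕ × ℕ) × (Fin c.N → Traj S A H)) : State q :=
  ((z.1.1, P.firstEstimator c z.1.1 z.2, next Q c z.1.1 (P.firstEstimator c z.1.1 z.2)),
    (z.1.2.1 + c.N, z.1.2.2 + 1))

/-- The state after one more iteration, as a function of the current state and of the batches. -/
def nextState (P : Model S A q H) (Q : Param q → EReal) (c : Config)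
    (z : State q × ((Fin c.B → Traj S A H) × (Fin c.B → Traj S A H))) : State q :=
  ((z.1.1.2.2, P.hybridEstimator c z.1.1.1 z.1.1.2.1 z.1.1.2.2 z.2.1 z.2.2,
    next Q c z.1.1.2.2 (P.hybridEstimator c z.1.1.1 z.1.1.2.1 z.1.1.2.2 z.2.1 z.2.2)),
    (z.1.2.1 + (c.B + c.B), z.1.2.2 + 1))

theorem Bounded.measurable_firstState (hP : P.Bounded γ R b G M)
    (hprox : Measurable (proxStep c.η Q)) : Measurable (P.firstState Q c) := by
  have hv : Measurable fun z : (Param q × ℕ × ℕ) × (Fin c.N → Traj S A H) =>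
      P.firstEstimator c z.1.1 z.2 :=
    hP.measurable_firstEstimator.comp (f := fun z : (Param q × ℕ × ℕ) × (Fin c.N → Traj S A H) =>
      (z.1.1, z.2)) (by fun_prop)
  have hn : Measurable fun z : (Param q × ℕ × ℕ) × (Fin c.N → Traj S A H) =>
      next Q c z.1.1 (P.firstEstimator c z.1.1 z.2) :=
    (measurable_next hprox).comp (f := fun z : (Param q × ℕ × ℕ) × (Fin c.N → Traj S A H) =>
      (z.1.1, P.firstEstimator c z.1.1 z.2)) (by fun_prop)
  unfold firstState
  fun_prop

theorem Bounded.measurable_nextState (hP : P.Bounded γ R b G M)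
    (hprox : Measurable (proxStep c.η Q)) : Measurable (P.nextState Q c) := by
  have hv : Measurable fun z : State q × ((Fin c.B → Traj S A H) × (Fin c.B → Traj S A H)) =>
      P.hybridEstimator c z.1.1.1 z.1.1.2.1 z.1.1.2.2 z.2.1 z.2.2 :=
    hP.measurable_hybridEstimator.comp (f := fun z : State q × ((Fin c.B → Traj S A H) ×
      (Fin c.B → Traj S A H)) => (z.1.1, z.2)) (by fun_prop)
  have hn : Measurable fun z : State q × ((Fin c.B → Traj S A H) × (Fin c.B → Traj S A H)) =>
      next Q c z.1.1.2.2 (P.hybridEstimator c z.1.1.1 z.1.1.2.1 z.1.1.2.2 z.2.1 z.2.2) :=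
    (measurable_next hprox).comp (f := fun z : State q × ((Fin c.B → Traj S A H) ×
      (Fin c.B → Traj S A H)) =>
      (z.1.1.2.2, P.hybridEstimator c z.1.1.1 z.1.1.2.1 z.1.1.2.2 z.2.1 z.2.2)) (by fun_prop)
  unfold nextState
  fun_prop

theorem Bounded.measurable_firstIter (hP : P.Bounded γ R b G M)
    (hprox : Measurable (proxStep c.η Q)) : Measurable (P.firstIter Q c) :=
  measurable_map_of_kernel ((P.batchKernel c.N).comap Prod.fst measurable_fst)
    (hP.measurable_firstState hprox)

theorem Bounded.measurable_iter (hP : P.Bounded γ R b G M)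
    (hprox : Measurable (proxStep c.η Q)) : Measurable (P.iter Q c) := by
  have h := measurable_map_of_kernel
    (((P.batchKernel c.B) ×ₖ (P.batchKernel c.B)).comap (fun x : State q => x.1.2.2)
      (by fun_prop)) (hP.measurable_nextState hprox)
  simp only [Kernel.comap_apply, Kernel.prod_apply] at h
  exact h

theorem Bounded.lintegral_firstIter (hP : P.Bounded γ R b G M)
    (hprox : Measurable (proxStep c.η Q)) (x : Param q × ℕ × ℕ) {f : State q → ENNReal}
    (hf : Measurable f) :
    ∫⁻ y, f y ∂(P.firstIter Q c x) = ∫⁻ z, f (P.firstState Q c (x, z)) ∂(P.batch x.1 c.N) :=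
  lintegral_map hf ((hP.measurable_firstState hprox).comp measurable_prodMk_left)

theorem Bounded.lintegral_iter (hP : P.Bounded γ R b G M)
    (hprox : Measurable (proxStep c.η Q)) (x : State q) {f : State q → ENNReal}
    (hf : Measurable f) :
    ∫⁻ y, f y ∂(P.iter Q c x)
      = ∫⁻ z, f (P.nextState Q c (x, z)) ∂((P.batch x.1.2.2 c.B).prod (P.batch x.1.2.2 c.B)) :=
  lintegral_map hf ((hP.measurable_nextState hprox).comp measurable_prodMk_left)

theorem Bounded.isProbabilityMeasure_firstIter (hP : P.Bounded γ R b G M)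
    (hprox : Measurable (proxStep c.η Q)) (x : Param q × ℕ × ℕ) :
    IsProbabilityMeasure (P.firstIter Q c x) :=
  Measure.isProbabilityMeasure_map
    ((hP.measurable_firstState hprox).comp measurable_prodMk_left).aemeasurable

theorem Bounded.isProbabilityMeasure_iter (hP : P.Bounded γ R b G M)
    (hprox : Measurable (proxStep c.η Q)) (x : State q) :
    IsProbabilityMeasure (P.iter Q c x) :=
  Measure.isProbabilityMeasure_map
    ((hP.measurable_nextState hprox).comp measurable_prodMk_left).aemeasurable

theorem Bounded.isProbabilityMeasure_law (hP : P.Bounded γ R b G M)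
    (hprox : Measurable (proxStep c.η Q)) (ν : Measure (Param q × ℕ × ℕ))
    [IsProbabilityMeasure ν] : ∀ t, IsProbabilityMeasure (P.law Q c ν t)
  | 0 => isProbabilityMeasure_bind (hP.measurable_firstIter hprox)
      (hP.isProbabilityMeasure_firstIter hprox)
  | t + 1 => by
    have := hP.isProbabilityMeasure_law hprox ν t
    exact isProbabilityMeasure_bind (hP.measurable_iter hprox) (hP.isProbabilityMeasure_iter hprox)

theorem Bounded.isProbabilityMeasure_stageStart (hP : P.Bounded γ R b G M)
    (hprox : Measurable (proxStep c.η Q)) (θ₀ : Param q) :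
    ∀ s, IsProbabilityMeasure (P.stageStart Q c θ₀ s)
  | 0 => by unfold stageStart; infer_instance
  | s + 1 => by
    have := hP.isProbabilityMeasure_stageStart hprox θ₀ s
    have := hP.isProbabilityMeasure_law hprox (P.stageStart Q c θ₀ s) c.m
    exact Measure.isProbabilityMeasure_map (by fun_prop)

theorem Bounded.integral_smul_g_sub (hP : P.Bounded γ R b G M) (hγ0 : 0 ≤ γ) (hγ1 : γ < 1)
    (θ : Param q) (s : ℝ) :
    ∫ τ, s • (P.g τ θ - gradient P.J θ) ∂(P.trajLaw θ) = 0 := by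
  rw [integral_smul, integral_sub (hP.integrable_g hγ0 hγ1 θ θ) (integrable_const _),
    ← hP.gradient_J hγ0 hγ1]
  simp

theorem SmoothnessConstants.lintegral_sq_norm_g_sub_le {W L σ C : ℝ}
    (hS : P.SmoothnessConstants W L σ C) (θ : Param q) :
    ∫⁻ τ, ENNReal.ofReal (‖P.g τ θ - gradient P.J θ‖ ^ 2) ∂(P.trajLaw θ)
      ≤ ENNReal.ofReal (σ ^ 2) :=
  (lintegral_mono fun τ => ENNReal.ofReal_le_ofReal (hS.variance τ θ)).trans (by simp)

theorem Bounded.memLp_smul_g_sub (hP : P.Bounded γ R b G M) {W L σ C : ℝ}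
    (hS : P.SmoothnessConstants W L σ C) (θ : Param q) (s : ℝ) :
    MemLp (fun τ => s • (P.g τ θ - gradient P.J θ)) 2 (P.trajLaw θ) :=
  (memLp_two_of_sq_norm_le ((hP.measurable_g θ).sub_const _) fun τ =>
    hS.variance τ θ).const_smul s

/-- Variance of a batch: `n` independent terms, each scaled by `s / n`, contribute `s² / n` times
the single variance. -/
theorem natCast_mul_ofReal_sq_div {n : ℕ} (hn : 0 < n) (s r : ℝ) :
    (n : ENNReal) * (ENNReal.ofReal ((s / n) ^ 2) * ENNReal.ofReal r)
      = ENNReal.ofReal (s ^ 2 / n * r) := by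
  have hn' : (n : ℝ) ≠ 0 := by exact_mod_cast hn.ne'
  rw [← ENNReal.ofReal_natCast, ← ENNReal.ofReal_mul (by positivity),
    ← ENNReal.ofReal_mul (by positivity)]
  congr 1
  field_simp

/-- The second moment of the error of the first estimator. -/
theorem Bounded.lintegral_sq_norm_firstEstimator_sub_le (hP : P.Bounded γ R b G M) (hγ0 : 0 ≤ γ)
    (hγ1 : γ < 1) {W L σ C : ℝ} (hS : P.SmoothnessConstants W L σ C) (hN : 0 < c.N)
    (θ : Param q) :
    ∫⁻ z, ENNReal.ofReal (‖P.firstEstimator c θ z - gradient P.J θ‖ ^ 2) ∂(P.batch θ c.N)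
      ≤ ENNReal.ofReal (σ ^ 2 / c.N) := by
  have hg := (hP.measurable_g θ).sub_const (gradient P.J θ)
  have h := lintegral_sq_norm_add_sum (hg.fun_const_smul ((1 : ℝ) / c.N))
    (hP.memLp_smul_g_sub hS θ _) (hP.integral_smul_g_sub hγ0 hγ1 θ _) c.N 0
  have e : ∀ z : Fin c.N → Traj S A H, P.firstEstimator c θ z - gradient P.J θ
      = 0 + ∑ i, ((1 : ℝ) / c.N) • (P.g (z i) θ - gradient P.J θ) := by
    intro z
    rw [zero_add, sum_const_smul_sub hN (fun i => P.g (z i) θ), firstEstimator, one_div, one_smul]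
  simp_rw [e, batch]
  rw [h, lintegral_sq_norm_smul hg]
  simp only [norm_zero, ne_eq, OfNat.ofNat_ne_zero, not_false_eq_true, zero_pow,
    ENNReal.ofReal_zero, zero_add]
  refine (mul_le_mul_right (mul_le_mul_right (hS.lintegral_sq_norm_g_sub_le θ) _) _).trans
    (le_of_eq ?_)
  rw [natCast_mul_ofReal_sq_div hN]
  congr 1
  ring

/-- Weights need not be bounded, so square integrability has to come from the variance condition,
through the mean square constant. -/
theorem Bounded.memLp_gradDiff (hP : P.Bounded γ R b G M) {W L σ C : ℝ}
    (hS : P.SmoothnessConstants W L σ C) {θ θ' : Param q}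
    (hW : P.weightVar θ θ' ≤ ENNReal.ofReal W) :
    MemLp (fun τ => P.gradDiff τ θ θ') 2 (P.trajLaw θ) := by
  have hm := (hP.measurable_gradDiff θ θ')
  refine (memLp_two_iff_integrable_sq_norm hm.aestronglyMeasurable).2
    ⟨(hm.norm.pow_const 2).aestronglyMeasurable, ?_⟩
  rw [hasFiniteIntegral_iff_ofReal (Eventually.of_forall fun τ => by positivity)]
  exact (hS.meanSquare θ θ' hW).trans_lt ENNReal.ofReal_lt_top

/-- The importance weight corrects for sampling at `θ` instead of `θ'`, so `gradDiff` estimates the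
change of the gradient without bias. -/
theorem Bounded.integral_gradDiff (hP : P.Bounded γ R b G M) (hγ0 : 0 ≤ γ) (hγ1 : γ < 1)
    {W L σ C : ℝ} (hS : P.SmoothnessConstants W L σ C) {θ θ' : Param q}
    (hW : P.weightVar θ θ' ≤ ENNReal.ofReal W) :
    ∫ τ, P.gradDiff τ θ θ' ∂(P.trajLaw θ) = gradient P.J θ - gradient P.J θ' := by
  have hg := hP.integrable_g hγ0 hγ1 θ θ
  have hd := (hP.memLp_gradDiff hS hW).integrable (by norm_num)
  have hi : Integrable (fun τ => P.weight τ θ θ' • P.g τ θ') (P.trajLaw θ) := by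
    simpa [gradDiff, Pi.sub_def] using hg.sub hd
  simp only [gradDiff]
  rw [integral_sub hg hi, P.integral_weight_smul, hP.gradient_J hγ0 hγ1, hP.gradient_J hγ0 hγ1]

/-- The recursion for the second moment of the error of the hybrid estimator. -/
theorem Bounded.lintegral_sq_norm_hybridEstimator_sub_le (hP : P.Bounded γ R b G M)
    (hγ0 : 0 ≤ γ) (hγ1 : γ < 1) {W L σ C : ℝ} (hS : P.SmoothnessConstants W L σ C)
    (hB : 0 < c.B) {θ θ' : Param q} (v' : Param q)
    (hW : P.weightVar θ θ' ≤ ENNReal.ofReal W) :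
    ∫⁻ z, ENNReal.ofReal (‖P.hybridEstimator c θ' v' θ z.1 z.2 - gradient P.J θ‖ ^ 2)
        ∂((P.batch θ c.B).prod (P.batch θ c.B))
      ≤ ENNReal.ofReal (c.β ^ 2) * ENNReal.ofReal (‖v' - gradient P.J θ'‖ ^ 2)
        + ENNReal.ofReal (c.β ^ 2 / c.B) * ENNReal.ofReal (C * ‖θ - θ'‖ ^ 2)
        + ENNReal.ofReal ((1 - c.β) ^ 2 / c.B * σ ^ 2) := by
  have hD := hP.memLp_gradDiff hS hW
  have hDm := hP.integral_gradDiff hγ0 hγ1 hS hW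
  have hgm := (hP.measurable_g θ).sub_const (gradient P.J θ)
  have hdm := (hP.measurable_gradDiff θ θ').sub_const (gradient P.J θ - gradient P.J θ')
  have h0 : ∫ τ, (c.β / c.B) • (P.gradDiff τ θ θ' - (gradient P.J θ - gradient P.J θ'))
      ∂(P.trajLaw θ) = 0 := by
    rw [integral_smul, integral_sub (hD.integrable (by norm_num)) (integrable_const _), hDm]
    simp
  have hLp : MemLp (fun τ => (c.β / c.B) •
      (P.gradDiff τ θ θ' - (gradient P.J θ - gradient P.J θ'))) 2 (P.trajLaw θ) :=
    (hD.sub (memLp_const _)).const_smul (c.β / c.B)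
  have h := lintegral_sq_norm_add_sum_add_sum (hdm.fun_const_smul (c.β / c.B)) hLp h0
    (hgm.fun_const_smul ((1 - c.β) / c.B))
    (hP.memLp_smul_g_sub hS θ ((1 - c.β) / c.B))
    (hP.integral_smul_g_sub hγ0 hγ1 θ ((1 - c.β) / c.B)) c.B
    (c.β • (v' - gradient P.J θ'))
  -- The new error is `β` times the old one plus two independent sums of centered terms: `β` of the
  -- gradient change and `1 - β` of the new gradient exactly account for `∇J(θ)`.
  have e : ∀ z : (Fin c.B → Traj S A H) × (Fin c.B → Traj S A H),
      P.hybridEstimator c θ' v' θ z.1 z.2 - gradient P.J θ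
        = (c.β • (v' - gradient P.J θ') + ∑ i, (c.β / c.B) •
            (P.gradDiff (z.1 i) θ θ' - (gradient P.J θ - gradient P.J θ')))
          + ∑ i, ((1 - c.β) / c.B) • (P.g (z.2 i) θ - gradient P.J θ) := by
    intro z
    rw [sum_const_smul_sub hB (fun i => P.g (z.2 i) θ),
      sum_const_smul_sub hB (fun i => P.gradDiff (z.1 i) θ θ'), hybridEstimator]
    simp only [gradDiff, smul_sub, sub_smul, one_smul]
    abel
  simp_rw [e]
  unfold batch
  rw [h, lintegral_sq_norm_smul hdm, lintegral_sq_norm_smul hgm]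
  refine add_le_add (add_le_add (le_of_eq ?_) ?_) ?_
  · rw [norm_smul, mul_pow, ENNReal.ofReal_mul (by positivity), Real.norm_eq_abs, sq_abs]
  -- The variance of `gradDiff` is replaced by its second moment, which is what `meanSquare` bounds.
  · refine (mul_le_mul_right (mul_le_mul_right ((lintegral_sq_norm_centered_le hD hDm).trans
      (hS.meanSquare θ θ' hW)) _) _).trans (le_of_eq ?_)
    rw [natCast_mul_ofReal_sq_div hB, ENNReal.ofReal_mul (by positivity)]
  · refine (mul_le_mul_right (mul_le_mul_right (hS.lintegral_sq_norm_g_sub_le θ) _) _).trans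
      (le_of_eq ?_)
    rw [natCast_mul_ofReal_sq_div hB]

end Algorithm

end Model
end HSPG

/-! ### Lyapunov summation -/

namespace HSPG

open Filter Topology

theorem ae_bind_of_ae {Ω Ω' : Type*} [MeasurableSpace Ω] [MeasurableSpace Ω'] {μ : Measure Ω}
    {f : Ω → Measure Ω'} (hf : Measurable f) {p : Ω' → Prop} (hp : MeasurableSet {x | p x})
    (h : ∀ᵐ a ∂μ, ∀ᵐ x ∂(f a), p x) : ∀ᵐ x ∂(μ.bind f), p x := by
  rw [ae_iff, ← Set.compl_ofPred, Measure.bind_apply hp.compl hf.aemeasurable]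
  exact lintegral_eq_zero_of_ae_eq_zero (h.mono fun a ha => ha)

/-- Summation of the descent inequality and of the variance recursion with the Lyapunov function
`a t + K * E t`. -/
theorem sum_le_of_lyapunov {a E D : ℕ → ENNReal} {m : ℕ} {α w k ρ e K : ℝ} (hα : 0 < α)
    (hw : 0 ≤ w) (hk : 0 ≤ k) (hρ : 0 ≤ ρ) (he : 0 ≤ e) (hKα : α ≤ K) (hKw : α + K * w ≤ K)
    (hKk : K * k ≤ α)
    (h1 : ∀ t ≤ m, a (t + 1) + ENNReal.ofReal (3 * α / 2) * D t
      ≤ a t + ENNReal.ofReal (α / 2) * E t)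
    (h2 : ∀ t < m, E (t + 1)
      ≤ ENNReal.ofReal w * E t + ENNReal.ofReal k * D t + ENNReal.ofReal ρ)
    (h0 : E 0 ≤ ENNReal.ofReal e) (ha : a 0 ≠ ⊤) :
    ENNReal.ofReal (α / 2) * ∑ t ∈ Finset.range (m + 1), (E t + D t) + a (m + 1)
      ≤ a 0 + ENNReal.ofReal (K * e + m * (K * ρ)) := by
  have hK : 0 < K := hα.trans_le hKα
  -- Finiteness is propagated along the recursion first, so that the summation can be done in real
  -- numbers, where subtraction cancels.
  have hstep : ∀ t ≤ m, a t ≠ ⊤ → E t ≠ ⊤ → a (t + 1) ≠ ⊤ ∧ D t ≠ ⊤ := by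
    intro t ht hat hEt
    have hfin : a (t + 1) + ENNReal.ofReal (3 * α / 2) * D t ≠ ⊤ :=
      ne_top_of_le_ne_top (ENNReal.add_ne_top.2
        ⟨hat, ENNReal.mul_ne_top ENNReal.ofReal_ne_top hEt⟩) (h1 t ht)
    obtain ⟨h3, h4⟩ := ENNReal.add_ne_top.1 hfin
    refine ⟨h3, fun hD => h4 ?_⟩
    rw [hD, ENNReal.mul_top]
    rw [ne_eq, ENNReal.ofReal_eq_zero, not_le]
    positivity
  have hfin : ∀ t ≤ m, a t ≠ ⊤ ∧ E t ≠ ⊤ := by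
    intro t
    induction t with
    | zero => exact fun _ => ⟨ha, ne_top_of_le_ne_top ENNReal.ofReal_ne_top h0⟩
    | succ t ih =>
      intro ht
      obtain ⟨hat, hEt⟩ := ih (by omega)
      obtain ⟨ha', hD⟩ := hstep t (by omega) hat hEt
      refine ⟨ha', ne_top_of_le_ne_top ?_ (h2 t (by omega))⟩
      simp [ENNReal.mul_ne_top, hEt, hD]
  have hfa : ∀ t ≤ m + 1, a t ≠ ⊤ := by
    intro t ht
    rcases Nat.lt_or_ge m t with h | h
    · obtain rfl : t = m + 1 := by omega
      exact (hstep m le_rfl (hfin m le_rfl).1 (hfin m le_rfl).2).1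
    · exact (hfin t h).1
  have hfE : ∀ t ≤ m, E t ≠ ⊤ := fun t ht => (hfin t ht).2
  have hfD : ∀ t ≤ m, D t ≠ ⊤ := fun t ht => (hstep t ht (hfin t ht).1 (hfin t ht).2).2
  have r1 : ∀ t ≤ m, (a (t + 1)).toReal + 3 * α / 2 * (D t).toReal
      ≤ (a t).toReal + α / 2 * (E t).toReal := by
    intro t ht
    have := ENNReal.toReal_mono (ENNReal.add_ne_top.2 ⟨hfa t (by omega),
      ENNReal.mul_ne_top ENNReal.ofReal_ne_top (hfE t ht)⟩) (h1 t ht)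
    rwa [ENNReal.toReal_add (hfa _ (by omega)) (ENNReal.mul_ne_top ENNReal.ofReal_ne_top
      (hfD t ht)), ENNReal.toReal_add (hfa _ (by omega)) (ENNReal.mul_ne_top
      ENNReal.ofReal_ne_top (hfE t ht)), ENNReal.toReal_mul, ENNReal.toReal_mul,
      ENNReal.toReal_ofReal (by positivity), ENNReal.toReal_ofReal (by positivity)] at this
  have r2 : ∀ t < m, (E (t + 1)).toReal ≤ w * (E t).toReal + k * (D t).toReal + ρ := by
    intro t ht
    have hx := ENNReal.mul_ne_top (ENNReal.ofReal_ne_top (r := w)) (hfE t ht.le)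
    have hy := ENNReal.mul_ne_top (ENNReal.ofReal_ne_top (r := k)) (hfD t ht.le)
    have hxy := ENNReal.add_ne_top.2 ⟨hx, hy⟩
    have := ENNReal.toReal_mono (ENNReal.add_ne_top.2 ⟨hxy, ENNReal.ofReal_ne_top⟩) (h2 t ht)
    rwa [ENNReal.toReal_add hxy ENNReal.ofReal_ne_top, ENNReal.toReal_add hx hy,
      ENNReal.toReal_mul, ENNReal.toReal_mul, ENNReal.toReal_ofReal hw, ENNReal.toReal_ofReal hk,
      ENNReal.toReal_ofReal hρ] at this
  have r0 : (E 0).toReal ≤ e := ENNReal.toReal_le_of_le_ofReal he h0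
  -- Per step the coefficient of `E t` is `α/2 + α/2 + K w ≤ K`, and that of `D t` is `α/2 - 3α/2 +
  -- K k ≤ 0`.
  have key : ∀ t ≤ m, α / 2 * ∑ i ∈ Finset.range t, ((E i).toReal + (D i).toReal)
      + (a t).toReal + K * (E t).toReal ≤ (a 0).toReal + K * e + t * (K * ρ) := by
    intro t
    induction t with
    | zero =>
      intro _
      have := mul_le_mul_of_nonneg_left r0 hK.le
      simp only [Finset.range_zero, Finset.sum_empty, Nat.cast_zero]
      linarith
    | succ t ih =>
      intro ht
      have h3 := ih (by omega)
      have h4 := r1 t (by omega)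
      have h5 := mul_le_mul_of_nonneg_left (r2 t (by omega)) hK.le
      have h6 := mul_le_mul_of_nonneg_right hKw (ENNReal.toReal_nonneg (a := E t))
      have h7 := mul_le_mul_of_nonneg_right hKk (ENNReal.toReal_nonneg (a := D t))
      rw [Finset.sum_range_succ]
      push_cast
      linarith
  -- The last update has no variance recursion after it. The term `K * E m` still in hand pays for
  -- its error, by `α ≤ K`.
  have hlast : α / 2 * ∑ i ∈ Finset.range (m + 1), ((E i).toReal + (D i).toReal)
      + (a (m + 1)).toReal ≤ (a 0).toReal + (K * e + m * (K * ρ)) := by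
    have h3 := key m le_rfl
    have h4 := r1 m le_rfl
    have h5 := mul_le_mul_of_nonneg_right hKα (ENNReal.toReal_nonneg (a := E m))
    have h6 := mul_nonneg hα.le (ENNReal.toReal_nonneg (a := D m))
    rw [Finset.sum_range_succ]
    linarith
  have hED : ∀ t ∈ Finset.range (m + 1), E t + D t ≠ ⊤ := fun t ht =>
    ENNReal.add_ne_top.2 ⟨hfE t (by simpa [Nat.lt_succ_iff] using ht),
      hfD t (by simpa [Nat.lt_succ_iff] using ht)⟩
  have hsum : ∑ t ∈ Finset.range (m + 1), (E t + D t) ≠ ⊤ := ENNReal.sum_ne_top.2 hED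
  rw [← ENNReal.toReal_le_toReal (ENNReal.add_ne_top.2
      ⟨ENNReal.mul_ne_top ENNReal.ofReal_ne_top hsum, hfa _ le_rfl⟩)
      (ENNReal.add_ne_top.2 ⟨ha, ENNReal.ofReal_ne_top⟩),
    ENNReal.toReal_add (ENNReal.mul_ne_top ENNReal.ofReal_ne_top hsum) (hfa _ le_rfl),
    ENNReal.toReal_add ha ENNReal.ofReal_ne_top, ENNReal.toReal_mul,
    ENNReal.toReal_ofReal (by positivity), ENNReal.toReal_ofReal (by positivity),
    ENNReal.toReal_sum hED]
  refine le_trans (le_of_eq ?_) hlast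
  congr 2
  refine Finset.sum_congr rfl fun t ht => ?_
  have ht' : t ≤ m := by simpa [Nat.lt_succ_iff] using ht
  exact ENNReal.toReal_add (hfE t ht') (hfD t ht')

/-- Step-sizes and batch sizes for which the Lyapunov function decreases. -/
structure Config.Admissible (c : Config) (L C : ℝ) : Prop where
  N_pos : 0 < c.N
  B_pos : 0 < c.B
  α_pos : 0 < c.α
  α_le : c.α ≤ 1
  β_nonneg : 0 ≤ c.β
  β_lt : c.β < 1
  η_eq : c.η = 2 / (4 + L * c.α)
  L_nonneg : 0 ≤ L
  C_nonneg : 0 ≤ C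
  C_mul_le : C * c.α ^ 2 ≤ c.B * (1 - c.β)

theorem Config.Admissible.η_pos {c : Config} {L C : ℝ} (h : c.Admissible L C) : 0 < c.η := by
  have := mul_nonneg h.L_nonneg h.α_pos.le
  rw [h.η_eq]
  positivity

theorem Config.Admissible.inv_η {c : Config} {L C : ℝ} (h : c.Admissible L C) :
    c.η⁻¹ = 2 + L * c.α / 2 := by
  rw [h.η_eq, inv_div]
  ring

/-! ### Descent of the optimality gap, within a stage and across stages -/

namespace Model

variable {S A : Type*} [MeasurableSpace S] [MeasurableSpace A] {q H : ℕ} {P : Model S A q H}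
  {γ R b G M : ℝ} {Q : Param q → EReal} {c : Config} {L C σ W Fs : ℝ}

/-- The optimality gap `Fs - F(θ)`. -/
def gap (P : Model S A q H) (Q : Param q → EReal) (Fs : ℝ) (θ : Param q) : ENNReal :=
  if Q θ = ⊤ then ⊤ else ENNReal.ofReal ((Q θ).toReal + Fs - P.J θ)

theorem measurable_gap (hQ : ProperClosedConvex Q) (hJ : Continuous P.J) :
    Measurable (P.gap Q Fs) := by
  have hm : Measurable Q := hQ.closed.measurable
  exact Measurable.ite (measurableSet_eq_fun hm measurable_const) measurable_const
    (((measurable_ereal_toReal.comp hm).add_const Fs).sub hJ.measurable).ennreal_ofReal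

/-- `prox_{ηQ}(θ + η v) - θ`. -/
def direction (Q : Param q → EReal) (c : Config) (θ v : Param q) : Param q :=
  proxStep c.η Q (θ + c.η • v) - θ

theorem next_eq (θ v : Param q) : next Q c θ v = θ + c.α • direction Q c θ v := by
  rw [next, direction, smul_sub, sub_smul, one_smul]
  abel

/-- The variational inequality at `y = θ`, combined with convexity, lowers `Q` by `α(‖d‖²/η - ⟨v,
d⟩)`, and smoothness of `J` costs `Lα²‖d‖²/2`. Since `1/η = 2 + Lα/2`, this cost cancels and
`2α‖d‖²` remains, of which Young's inequality for `⟨v - ∇J, d⟩` spends `α‖d‖²/2`. -/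
theorem gap_next_add_le (hQ : ProperClosedConvex Q) (hS : P.SmoothnessConstants W L σ C)
    (hc : c.Admissible L C) (hFs : ∀ θ, Q θ ≠ ⊤ → P.J θ - (Q θ).toReal ≤ Fs) (θ v : Param q) :
    P.gap Q Fs (next Q c θ v)
        + ENNReal.ofReal (3 * c.α / 2) * ENNReal.ofReal (‖direction Q c θ v‖ ^ 2)
      ≤ P.gap Q Fs θ + ENNReal.ofReal (c.α / 2) * ENNReal.ofReal (‖v - gradient P.J θ‖ ^ 2) := by
  by_cases hθ : Q θ = ⊤
  · simp [gap, hθ]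
  have hα := hc.α_pos
  set p := proxStep c.η Q (θ + c.η • v) with hp
  have hpne : Q p ≠ ⊤ := hQ.proxStep_ne_top hc.η_pos _
  set d := direction Q c θ v with hd
  have hdp : p - θ = d := rfl
  obtain ⟨hne, hle⟩ := hQ.toReal_combination_le hθ hpne (a := 1 - c.α) (c := c.α)
    (by linarith [hc.α_le]) hα.le (by ring)
  have hnext : next Q c θ v = (1 - c.α) • θ + c.α • p := rfl
  rw [← hnext] at hne hle
  have hvar := hQ.proxStep_variational hc.η_pos (θ + c.η • v) hθ
  rw [← hp] at hvar
  have e1 : p - (θ + c.η • v) = d - c.η • v := by rw [← hdp]; abel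
  have e2 : θ - p = -d := by rw [← hdp]; abel
  rw [e1, e2, inner_neg_right, inner_sub_left, inner_smul_left, real_inner_self_eq_norm_sq] at hvar
  have hvar' : (Q p).toReal - (Q θ).toReal
      ≤ -(2 + L * c.α / 2) * ‖d‖ ^ 2 + inner ℝ v d := by
    have h := mul_le_mul_of_nonneg_left hvar (inv_nonneg.2 hc.η_pos.le)
    rw [← mul_assoc, inv_mul_cancel₀ hc.η_pos.ne', one_mul] at h
    refine h.trans (le_of_eq ?_)
    rw [← hc.inv_η]
    have := hc.η_pos.ne'
    simp only [conj_trivial]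
    field_simp
    ring
  have hsm := add_inner_sub_le_of_lipschitz_gradient hS.differentiable hS.lipschitz θ
    (next Q c θ v)
  have e3 : next Q c θ v - θ = c.α • d := by rw [next_eq, ← hd, add_sub_cancel_left]
  rw [e3, inner_smul_right, norm_smul, Real.norm_of_nonneg hα.le] at hsm
  have hyoung : inner ℝ v d - inner ℝ (gradient P.J θ) d
      ≤ ‖v - gradient P.J θ‖ ^ 2 / 2 + ‖d‖ ^ 2 / 2 := by
    rw [← inner_sub_left]
    have := real_inner_le_norm (v - gradient P.J θ) d
    nlinarith [sq_nonneg (‖v - gradient P.J θ‖ - ‖d‖)]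
  have hreal : ((Q (next Q c θ v)).toReal + Fs - P.J (next Q c θ v)) + 3 * c.α / 2 * ‖d‖ ^ 2
      ≤ ((Q θ).toReal + Fs - P.J θ) + c.α / 2 * ‖v - gradient P.J θ‖ ^ 2 := by
    have h1 := mul_le_mul_of_nonneg_left hvar' hα.le
    have h2 := mul_le_mul_of_nonneg_left hyoung hα.le
    nlinarith
  -- Here `Fs` must dominate `F`: both gaps have to be nonnegative, so that truncation at zero loses
  -- nothing.
  rw [gap, gap, if_neg hθ, if_neg hne, ← ENNReal.ofReal_mul (by positivity),
    ← ENNReal.ofReal_mul (by positivity),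
    ← ENNReal.ofReal_add (by linarith [hFs _ hne]) (by positivity),
    ← ENNReal.ofReal_add (by linarith [hFs _ hθ]) (by positivity)]
  exact ENNReal.ofReal_le_ofReal hreal

/-- Replacing `∇J(θ)` by `v` inside the prox moves it by at most `η‖v - ∇J(θ)‖`, so the gradient
mapping is at most `‖e‖ + ‖d‖/η`; moreover `1/η ≤ (4 + L)/2` because `α ≤ 1`. -/
theorem sq_norm_gradMap_le (hQ : ProperClosedConvex Q) (hc : c.Admissible L C) (θ v : Param q) :
    ‖P.gradMap c.η Q θ‖ ^ 2
      ≤ (4 + L) ^ 2 / 2 * (‖v - gradient P.J θ‖ ^ 2 + ‖direction Q c θ v‖ ^ 2) := by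
  have hη := hc.η_pos
  have h1 := hQ.norm_proxStep_sub_le hη (θ + c.η • gradient P.J θ) (θ + c.η • v)
  rw [add_sub_add_left_eq_sub, ← smul_sub, norm_smul, Real.norm_of_nonneg hη.le, norm_sub_rev
    (gradient P.J θ)] at h1
  have e : proxStep c.η Q (θ + c.η • gradient P.J θ) - θ
      = (proxStep c.η Q (θ + c.η • gradient P.J θ) - proxStep c.η Q (θ + c.η • v))
        + direction Q c θ v := by
    rw [direction]; abel
  have h2 : ‖P.gradMap c.η Q θ‖ ≤ ‖v - gradient P.J θ‖ + c.η⁻¹ * ‖direction Q c θ v‖ := by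
    rw [gradMap, norm_smul, e, Real.norm_of_nonneg (inv_nonneg.2 hη.le)]
    refine (mul_le_mul_of_nonneg_left ((norm_add_le _ _).trans (add_le_add_left h1 _))
      (inv_nonneg.2 hη.le)).trans (le_of_eq ?_)
    field_simp
  have h3 : c.η⁻¹ ≤ (4 + L) / 2 := by
    rw [hc.inv_η]
    nlinarith [hc.α_le, hc.L_nonneg]
  have h4 : 1 ≤ (4 + L) / 2 := by linarith [hc.L_nonneg]
  have h5 : ‖P.gradMap c.η Q θ‖
      ≤ (4 + L) / 2 * (‖v - gradient P.J θ‖ + ‖direction Q c θ v‖) := by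
    have := mul_le_mul_of_nonneg_right h3 (norm_nonneg (direction Q c θ v))
    have := mul_le_mul_of_nonneg_right h4 (norm_nonneg (v - gradient P.J θ))
    linarith
  refine (pow_le_pow_left₀ (norm_nonneg _) h5 2).trans ?_
  rw [mul_pow]
  have := mul_le_mul_of_nonneg_left (show (‖v - gradient P.J θ‖ + ‖direction Q c θ v‖) ^ 2
    ≤ 2 * (‖v - gradient P.J θ‖ ^ 2 + ‖direction Q c θ v‖ ^ 2) by
      nlinarith [sq_nonneg (‖v - gradient P.J θ‖ - ‖direction Q c θ v‖)])
    (show 0 ≤ ((4 + L) / 2) ^ 2 by positivity)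
  linarith

theorem SmoothnessConstants.continuous_gradient (hS : P.SmoothnessConstants W L σ C) :
    Continuous (gradient P.J) :=
  (LipschitzWith.of_dist_le_mul (K := L.toNNReal) fun x y => by
    rw [dist_eq_norm, dist_eq_norm]
    exact (hS.lipschitz x y).trans (mul_le_mul_of_nonneg_right (Real.le_coe_toNNReal L)
      (norm_nonneg _))).continuous

theorem measurable_gradMap (hQ : ProperClosedConvex Q) (hη : 0 < c.η)
    (hS : P.SmoothnessConstants W L σ C) : Measurable (P.gradMap c.η Q) := by
  have h1 : Continuous fun θ => θ + c.η • gradient P.J θ :=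
    continuous_id.add (hS.continuous_gradient.fun_const_smul c.η)
  exact ((((hQ.continuous_proxStep hη).comp h1).sub continuous_id).const_smul c.η⁻¹).measurable

/-- `‖v_t - ∇J(θ_t)‖²`. -/
def errSq (P : Model S A q H) (x : State q) : ENNReal :=
  ENNReal.ofReal (‖x.1.2.1 - gradient P.J x.1.1‖ ^ 2)

/-- `‖prox_{ηQ}(θ_t + η v_t) - θ_t‖²`. -/
def dirSq (Q : Param q → EReal) (c : Config) (x : State q) : ENNReal :=
  ENNReal.ofReal (‖direction Q c x.1.1 x.1.2.1‖ ^ 2)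

theorem measurable_errSq (hS : P.SmoothnessConstants W L σ C) : Measurable P.errSq := by
  have h : Measurable fun x : State q => gradient P.J x.1.1 :=
    hS.continuous_gradient.measurable.comp (by fun_prop)
  have h' : Measurable fun x : State q => x.1.2.1 := by fun_prop
  exact ((h'.sub h).norm.pow_const 2).ennreal_ofReal

theorem measurable_dirSq (hprox : Measurable (proxStep c.η Q)) :
    Measurable (dirSq (q := q) Q c) := by
  have h : Measurable fun x : State q => x.1.1 + c.η • x.1.2.1 := by fun_prop
  have h' : Measurable fun x : State q => x.1.1 := by fun_prop
  exact (((hprox.comp h).sub h').norm.pow_const 2).ennreal_ofReal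

namespace Bounded

/-- Gives access to `θ_{t+1} - θ_t = α d_t` under the law of the state, which stores the three
vectors separately. -/
theorem ae_law_next_eq (hP : P.Bounded γ R b G M) (hprox : Measurable (proxStep c.η Q))
    (ν : Measure (Param q × ℕ × ℕ)) (t : ℕ) :
    ∀ᵐ x ∂(P.law Q c ν t), x.1.2.2 = next Q c x.1.1 x.1.2.1 := by
  have hs : MeasurableSet {x : State q | x.1.2.2 = next Q c x.1.1 x.1.2.1} :=
    measurableSet_eq_fun (by fun_prop) ((measurable_next hprox).comp
      (f := fun x : State q => (x.1.1, x.1.2.1)) (by fun_prop))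
  cases t with
  | zero =>
    refine ae_bind_of_ae (hP.measurable_firstIter hprox) hs (Eventually.of_forall fun z => ?_)
    refine (ae_map_iff ((hP.measurable_firstState hprox).comp
      measurable_prodMk_left).aemeasurable hs).2 (Eventually.of_forall fun y => rfl)
  | succ t =>
    refine ae_bind_of_ae (hP.measurable_iter hprox) hs (Eventually.of_forall fun z => ?_)
    refine (ae_map_iff ((hP.measurable_nextState hprox).comp
      measurable_prodMk_left).aemeasurable hs).2 (Eventually.of_forall fun y => rfl)

/-- The counters are deterministic. -/
theorem ae_law_counters (hP : P.Bounded γ R b G M) (hprox : Measurable (proxStep c.η Q))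
    {ν : Measure (Param q × ℕ × ℕ)} {n k : ℕ} (hν : ∀ᵐ z ∂ν, z.2 = (n, k)) (t : ℕ) :
    ∀ᵐ x ∂(P.law Q c ν t), x.2 = (n + c.N + t * (c.B + c.B), k + 1 + t) := by
  have hs : ∀ y : ℕ × ℕ, MeasurableSet {x : State q | x.2 = y} := fun y =>
    measurable_snd (measurableSet_singleton y)
  induction t with
  | zero =>
    refine ae_bind_of_ae (hP.measurable_firstIter hprox) (hs _) (hν.mono fun z hz => ?_)
    refine (ae_map_iff ((hP.measurable_firstState hprox).comp
      measurable_prodMk_left).aemeasurable (hs _)).2 (Eventually.of_forall fun y => ?_)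
    simp [firstState, hz]
  | succ t ih =>
    refine ae_bind_of_ae (hP.measurable_iter hprox) (hs _) (ih.mono fun z hz => ?_)
    refine (ae_map_iff ((hP.measurable_nextState hprox).comp
      measurable_prodMk_left).aemeasurable (hs _)).2 (Eventually.of_forall fun y => ?_)
    change (z.2.1 + (c.B + c.B), z.2.2 + 1) = _
    rw [hz, Prod.mk.injEq]
    constructor <;> ring

theorem ae_stageStart_counters (hP : P.Bounded γ R b G M) (hprox : Measurable (proxStep c.η Q))
    (θ₀ : Param q) (s : ℕ) :
    ∀ᵐ z ∂(P.stageStart Q c θ₀ s), z.2 = (s * (c.N + c.m * (c.B + c.B)), s * (c.m + 1)) := by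
  have hs : ∀ y : ℕ × ℕ, MeasurableSet {x : Param q × ℕ × ℕ | x.2 = y} := fun y =>
    measurable_snd (measurableSet_singleton y)
  induction s with
  | zero =>
    rw [stageStart, ae_dirac_iff (hs _)]
    simp
  | succ s ih =>
    rw [stageStart, ae_map_iff (by fun_prop) (hs _)]
    refine (hP.ae_law_counters hprox ih c.m).mono fun x hx => ?_
    simp only [hx, Prod.mk.injEq]
    constructor <;> ring

theorem lintegral_law_zero (hP : P.Bounded γ R b G M) (hprox : Measurable (proxStep c.η Q))
    (ν : Measure (Param q × ℕ × ℕ)) {f : State q → ENNReal} (hf : Measurable f) :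
    ∫⁻ x, f x ∂(P.law Q c ν 0)
      = ∫⁻ z, ∫⁻ y, f (P.firstState Q c (z, y)) ∂(P.batch z.1 c.N) ∂ν := by
  rw [law, Measure.lintegral_bind (hP.measurable_firstIter hprox).aemeasurable hf.aemeasurable]
  exact lintegral_congr fun z => hP.lintegral_firstIter hprox z hf

theorem lintegral_law_succ (hP : P.Bounded γ R b G M) (hprox : Measurable (proxStep c.η Q))
    (ν : Measure (Param q × ℕ × ℕ)) (t : ℕ) {f : State q → ENNReal} (hf : Measurable f) :
    ∫⁻ x, f x ∂(P.law Q c ν (t + 1))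
      = ∫⁻ z, ∫⁻ y, f (P.nextState Q c (z, y))
        ∂((P.batch z.1.2.2 c.B).prod (P.batch z.1.2.2 c.B)) ∂(P.law Q c ν t) := by
  rw [law, Measure.lintegral_bind (hP.measurable_iter hprox).aemeasurable hf.aemeasurable]
  exact lintegral_congr fun z => hP.lintegral_iter hprox z hf

/-- The mean of `f(θ_t)`. -/
def meanIterate (P : Model S A q H) (Q : Param q → EReal) (c : Config)
    (ν : Measure (Param q × ℕ × ℕ)) (f : Param q → ENNReal) : ℕ → ENNReal
  | 0 => ∫⁻ z, f z.1 ∂ν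
  | t + 1 => ∫⁻ x, f x.1.2.2 ∂(P.law Q c ν t)

/-- The first component at time `t + 1` is the third one at time `t`. Hence the mean gap after the
last update is available from `law` at `m`, with no further iteration. -/
theorem lintegral_law_iterate (hP : P.Bounded γ R b G M) (hprox : Measurable (proxStep c.η Q))
    (ν : Measure (Param q × ℕ × ℕ)) {f : Param q → ENNReal} (hf : Measurable f) (t : ℕ) :
    ∫⁻ x, f x.1.1 ∂(P.law Q c ν t) = meanIterate P Q c ν f t := by
  have hf' : Measurable fun x : State q => f x.1.1 := hf.comp (by fun_prop)
  cases t with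
  | zero =>
    rw [hP.lintegral_law_zero hprox ν hf']
    simp [firstState, meanIterate]
  | succ t =>
    rw [hP.lintegral_law_succ hprox ν t hf']
    simp [nextState, meanIterate]

theorem lintegral_law_gap_add_le (hP : P.Bounded γ R b G M) (hQ : ProperClosedConvex Q)
    (hS : P.SmoothnessConstants W L σ C) (hc : c.Admissible L C)
    (hFs : ∀ θ, Q θ ≠ ⊤ → P.J θ - (Q θ).toReal ≤ Fs) (ν : Measure (Param q × ℕ × ℕ)) (t : ℕ) :
    meanIterate P Q c ν (P.gap Q Fs) (t + 1)
        + ENNReal.ofReal (3 * c.α / 2) * ∫⁻ x, dirSq Q c x ∂(P.law Q c ν t)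
      ≤ meanIterate P Q c ν (P.gap Q Fs) t
        + ENNReal.ofReal (c.α / 2) * ∫⁻ x, P.errSq x ∂(P.law Q c ν t) := by
  have hprox := (hQ.continuous_proxStep hc.η_pos).measurable
  have hg := measurable_gap (P := P) (Fs := Fs) hQ hS.differentiable.continuous
  have hg1 : Measurable fun x : State q => P.gap Q Fs x.1.1 := hg.comp (by fun_prop)
  have hg2 : Measurable fun x : State q => P.gap Q Fs x.1.2.2 := hg.comp (by fun_prop)
  rw [← hP.lintegral_law_iterate hprox ν hg t, meanIterate,
    ← lintegral_const_mul _ (measurable_dirSq hprox), ← lintegral_const_mul _ (measurable_errSq hS),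
    ← lintegral_add_left hg2, ← lintegral_add_left hg1]
  refine lintegral_mono_ae ((hP.ae_law_next_eq hprox ν t).mono fun x hx => ?_)
  rw [hx]
  exact gap_next_add_le hQ hS hc hFs x.1.1 x.1.2.1

theorem lintegral_law_zero_errSq_le (hP : P.Bounded γ R b G M) (hγ0 : 0 ≤ γ) (hγ1 : γ < 1)
    (hQ : ProperClosedConvex Q) (hS : P.SmoothnessConstants W L σ C) (hc : c.Admissible L C)
    (ν : Measure (Param q × ℕ × ℕ)) [IsProbabilityMeasure ν] :
    ∫⁻ x, P.errSq x ∂(P.law Q c ν 0) ≤ ENNReal.ofReal (σ ^ 2 / c.N) := by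
  rw [hP.lintegral_law_zero (hQ.continuous_proxStep hc.η_pos).measurable ν (measurable_errSq hS)]
  have hle : ∀ z : Param q × ℕ × ℕ, ∫⁻ y, P.errSq (P.firstState Q c (z, y)) ∂(P.batch z.1 c.N)
      ≤ ENNReal.ofReal (σ ^ 2 / c.N) := fun z => by
    simp only [errSq, firstState]
    exact hP.lintegral_sq_norm_firstEstimator_sub_le hγ0 hγ1 hS hc.N_pos z.1
  refine (lintegral_mono hle).trans (le_of_eq ?_)
  rw [lintegral_const, measure_univ, mul_one]

theorem lintegral_law_succ_errSq_le (hP : P.Bounded γ R b G M) (hγ0 : 0 ≤ γ) (hγ1 : γ < 1)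
    (hQ : ProperClosedConvex Q) (hS : P.SmoothnessConstants W L σ C) (hc : c.Admissible L C)
    (ν : Measure (Param q × ℕ × ℕ)) [IsProbabilityMeasure ν] (t : ℕ)
    (hW : ∀ᵐ x ∂(P.law Q c ν t), P.weightVar x.1.2.2 x.1.1 ≤ ENNReal.ofReal W) :
    ∫⁻ x, P.errSq x ∂(P.law Q c ν (t + 1))
      ≤ ENNReal.ofReal (c.β ^ 2) * ∫⁻ x, P.errSq x ∂(P.law Q c ν t)
        + ENNReal.ofReal (c.β ^ 2 / c.B * (C * c.α ^ 2)) * ∫⁻ x, dirSq Q c x ∂(P.law Q c ν t)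
        + ENNReal.ofReal ((1 - c.β) ^ 2 / c.B * σ ^ 2) := by
  have hprox := (hQ.continuous_proxStep hc.η_pos).measurable
  have hC := hc.C_nonneg
  have := hP.isProbabilityMeasure_law hprox ν t
  have h1 := (measurable_errSq hS).const_mul (ENNReal.ofReal (c.β ^ 2))
  have h2 := (measurable_dirSq hprox).const_mul (ENNReal.ofReal (c.β ^ 2 / c.B * (C * c.α ^ 2)))
  rw [hP.lintegral_law_succ hprox ν t (measurable_errSq hS)]
  have hle : ∀ᵐ x ∂(P.law Q c ν t), ∫⁻ y, P.errSq (P.nextState Q c (x, y))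
      ∂((P.batch x.1.2.2 c.B).prod (P.batch x.1.2.2 c.B))
      ≤ ENNReal.ofReal (c.β ^ 2) * P.errSq x
        + ENNReal.ofReal (c.β ^ 2 / c.B * (C * c.α ^ 2)) * dirSq Q c x
        + ENNReal.ofReal ((1 - c.β) ^ 2 / c.B * σ ^ 2) := by
    filter_upwards [hW, hP.ae_law_next_eq hprox ν t] with x hx hx'
    simp only [errSq, nextState]
    refine (hP.lintegral_sq_norm_hybridEstimator_sub_le hγ0 hγ1 hS hc.B_pos x.1.2.1 hx).trans
      (le_of_eq ?_)
    congr 2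
    rw [dirSq, ← ENNReal.ofReal_mul (by positivity), ← ENNReal.ofReal_mul (by positivity), hx',
      next_eq, add_sub_cancel_left, norm_smul, mul_pow, Real.norm_eq_abs, sq_abs]
    congr 1
    ring
  refine (lintegral_mono_ae hle).trans (le_of_eq ?_)
  rw [lintegral_add_right _ measurable_const, lintegral_add_left h1,
    lintegral_const_mul _ (measurable_errSq hS), lintegral_const_mul _ (measurable_dirSq hprox),
    lintegral_const, measure_univ, mul_one]

/-- The total variance that enters the bound on one stage. -/
def stageNoise (c : Config) (σ : ℝ) : ℝ :=
  c.α / (1 - c.β) * (σ ^ 2 / c.N) + c.m * (c.α / (1 - c.β) * ((1 - c.β) ^ 2 / c.B * σ ^ 2))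

/-- One stage of the algorithm: the gradient mapping along the iterates against the decrease of the
optimality gap. -/
theorem sum_lintegral_law_gradMap_le (hP : P.Bounded γ R b G M) (hγ0 : 0 ≤ γ) (hγ1 : γ < 1)
    (hQ : ProperClosedConvex Q) (hS : P.SmoothnessConstants W L σ C) (hc : c.Admissible L C)
    (hFs : ∀ θ, Q θ ≠ ⊤ → P.J θ - (Q θ).toReal ≤ Fs) (ν : Measure (Param q × ℕ × ℕ))
    [IsProbabilityMeasure ν] (hW : P.WeightsBounded Q c ν W)
    (hν : ∫⁻ z, P.gap Q Fs z.1 ∂ν ≠ ⊤) :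
    ENNReal.ofReal (c.α / (4 + L) ^ 2) * ∑ t ∈ Finset.range (c.m + 1),
        ∫⁻ x, ENNReal.ofReal (‖P.gradMap c.η Q x.1.1‖ ^ 2) ∂(P.law Q c ν t)
      + ∫⁻ x, P.gap Q Fs x.1.2.2 ∂(P.law Q c ν c.m)
      ≤ ∫⁻ z, P.gap Q Fs z.1 ∂ν + ENNReal.ofReal (stageNoise c σ) := by
  have hprox := (hQ.continuous_proxStep hc.η_pos).measurable
  have hα := hc.α_pos
  have hβ : 0 < 1 - c.β := by linarith [hc.β_lt]
  have hβ0 := hc.β_nonneg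
  have hB : (0 : ℝ) < c.B := by exact_mod_cast hc.B_pos
  have hC := hc.C_nonneg
  have hL := hc.L_nonneg
  have hK : c.α / (1 - c.β) * (1 - c.β) = c.α := div_mul_cancel₀ _ hβ.ne'
  have hKpos : 0 < c.α / (1 - c.β) := div_pos hα hβ
  -- With `K = α/(1-β)` the requirement `α + Kβ² ≤ K` becomes `1 - β ≤ 1 - β²`, true for `0 ≤ β <
  -- 1`.
  have key := sum_le_of_lyapunov (a := meanIterate P Q c ν (P.gap Q Fs))
    (E := fun t => ∫⁻ x, P.errSq x ∂(P.law Q c ν t))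
    (D := fun t => ∫⁻ x, dirSq Q c x ∂(P.law Q c ν t)) (m := c.m) (α := c.α) (w := c.β ^ 2)
    (k := c.β ^ 2 / c.B * (C * c.α ^ 2)) (ρ := (1 - c.β) ^ 2 / c.B * σ ^ 2) (e := σ ^ 2 / c.N)
    (K := c.α / (1 - c.β)) hα (by positivity) (by positivity) (by positivity) (by positivity)
    (by nlinarith) (by nlinarith) ?_
    (fun t _ => hP.lintegral_law_gap_add_le hQ hS hc hFs ν t)
    (fun t ht => hP.lintegral_law_succ_errSq_le hγ0 hγ1 hQ hS hc ν t (hW t ht))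
    (hP.lintegral_law_zero_errSq_le hγ0 hγ1 hQ hS hc ν) hν
  · refine le_trans (add_le_add_left ?_ _) key
    have hm : Measurable fun x : State q => P.errSq x + dirSq Q c x :=
      (measurable_errSq hS).add (measurable_dirSq hprox)
    have hterm : ∀ t, ∫⁻ x, ENNReal.ofReal (‖P.gradMap c.η Q x.1.1‖ ^ 2) ∂(P.law Q c ν t)
        ≤ ENNReal.ofReal ((4 + L) ^ 2 / 2) * (∫⁻ x, P.errSq x ∂(P.law Q c ν t)
          + ∫⁻ x, dirSq Q c x ∂(P.law Q c ν t)) := by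
      intro t
      rw [← lintegral_add_left (measurable_errSq hS), ← lintegral_const_mul _ hm]
      refine lintegral_mono fun x => ?_
      rw [errSq, dirSq, ← ENNReal.ofReal_add (by positivity) (by positivity),
        ← ENNReal.ofReal_mul (by positivity)]
      exact ENNReal.ofReal_le_ofReal (sq_norm_gradMap_le hQ hc x.1.1 x.1.2.1)
    refine (mul_le_mul_right (Finset.sum_le_sum fun t _ => hterm t) _).trans (le_of_eq ?_)
    rw [← Finset.mul_sum, ← mul_assoc, ← ENNReal.ofReal_mul (by positivity)]
    congr 2
    field_simp
  -- This is where `C α² ≤ B (1 - β)` enters: it gives `k ≤ 1 - β`, that is `K k ≤ α`.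
  · have h1 : c.β ^ 2 ≤ 1 := pow_le_one₀ hβ0 hc.β_lt.le
    have h2 : c.β ^ 2 / c.B * (C * c.α ^ 2) ≤ 1 - c.β := by
      have h3 : c.β ^ 2 / c.B * (C * c.α ^ 2) ≤ c.β ^ 2 / c.B * (c.B * (1 - c.β)) :=
        mul_le_mul_of_nonneg_left hc.C_mul_le (by positivity)
      have h4 : c.β ^ 2 / c.B * (c.B * (1 - c.β)) = c.β ^ 2 * (1 - c.β) := by
        field_simp
      nlinarith
    calc _ ≤ c.α / (1 - c.β) * (1 - c.β) := mul_le_mul_of_nonneg_left h2 hKpos.le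
      _ = c.α := hK

/-- All stages of the restarting algorithm. -/
theorem sum_sum_lintegral_stageLaw_gradMap_le (hP : P.Bounded γ R b G M) (hγ0 : 0 ≤ γ)
    (hγ1 : γ < 1) (hQ : ProperClosedConvex Q) (hS : P.SmoothnessConstants W L σ C)
    (hc : c.Admissible L C) (hFs : ∀ θ, Q θ ≠ ⊤ → P.J θ - (Q θ).toReal ≤ Fs) {θ₀ : Param q}
    (hθ₀ : P.gap Q Fs θ₀ ≠ ⊤) (K : ℕ)
    (hW : ∀ s < K, P.WeightsBounded Q c (P.stageStart Q c θ₀ s) W) :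
    ENNReal.ofReal (c.α / (4 + L) ^ 2) * ∑ s ∈ Finset.range K, ∑ t ∈ Finset.range (c.m + 1),
        ∫⁻ x, ENNReal.ofReal (‖P.gradMap c.η Q x.1.1‖ ^ 2) ∂(P.stageLaw Q c θ₀ s t)
      + ∫⁻ z, P.gap Q Fs z.1 ∂(P.stageStart Q c θ₀ K)
      ≤ P.gap Q Fs θ₀ + K * ENNReal.ofReal (stageNoise c σ) := by
  have hprox := (hQ.continuous_proxStep hc.η_pos).measurable
  have hg := measurable_gap (P := P) (Fs := Fs) hQ hS.differentiable.continuous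
  have hg' : Measurable fun z : Param q × ℕ × ℕ => P.gap Q Fs z.1 := hg.comp measurable_fst
  induction K with
  | zero =>
    rw [stageStart, lintegral_dirac' _ hg']
    simp
  | succ K ih =>
    have h := ih fun s hs => hW s (by omega)
    have := hP.isProbabilityMeasure_stageStart hprox θ₀ K
    have hfin : ∫⁻ z, P.gap Q Fs z.1 ∂(P.stageStart Q c θ₀ K) ≠ ⊤ := by
      refine ne_top_of_le_ne_top ?_ (le_add_self.trans h)
      exact ENNReal.add_ne_top.2 ⟨hθ₀, ENNReal.mul_ne_top (ENNReal.natCast_ne_top K)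
        ENNReal.ofReal_ne_top⟩
    have hstage := hP.sum_lintegral_law_gradMap_le hγ0 hγ1 hQ hS hc hFs
      (P.stageStart Q c θ₀ K) (hW K (by omega)) hfin
    -- The final gap of one stage is the initial gap of the next, so the stages telescope and each
    -- adds its noise once.
    rw [Finset.sum_range_succ, mul_add, stageStart, lintegral_map hg' (by fun_prop), add_assoc]
    refine (add_le_add_right hstage _).trans ?_
    rw [← add_assoc]
    refine (add_le_add_left h _).trans (le_of_eq ?_)
    push_cast
    ring

end Bounded

end Model
end HSPG

/-! ### Step sizes, rate and cost -/

namespace HSPG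

open Filter Topology

section StepSizes

variable {L σ C c' ĉ : ℝ} {B m : ℕ}

/-- `(B N (m+1))^{1/4}`, in terms of which `α` and `1 - β` are simple. -/
def configScale (L σ C c' ĉ : ℝ) (B m : ℕ) : ℝ :=
  ((B : ℝ) * ((config L σ C c' ĉ B m).N * ((m : ℝ) + 1))) ^ (1 / 4 : ℝ)

theorem config_N_ge :
    c' * σ ^ (8 / 3 : ℝ) * ((B : ℝ) * (m + 1)) ^ (1 / 3 : ℝ) ≤ (config L σ C c' ĉ B m).N :=
  Nat.le_ceil _

theorem one_le_batch_mul (hB : 0 < B) (m : ℕ) : (1 : ℝ) ≤ B * ((m : ℝ) + 1) := by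
  have h1 : (1 : ℝ) ≤ B := by exact_mod_cast hB
  have h2 : (0 : ℝ) ≤ m := Nat.cast_nonneg m
  nlinarith

theorem one_le_rpow_third (hB : 0 < B) (m : ℕ) :
    (1 : ℝ) ≤ ((B : ℝ) * ((m : ℝ) + 1)) ^ (1 / 3 : ℝ) :=
  Real.one_le_rpow (one_le_batch_mul hB m) (by norm_num)

theorem rpow_third_pow (hB : 0 < B) (m : ℕ) :
    (((B : ℝ) * ((m : ℝ) + 1)) ^ (1 / 3 : ℝ)) ^ 3 = B * ((m : ℝ) + 1) := by
  rw [← Real.rpow_natCast, ← Real.rpow_mul (zero_le_one.trans (one_le_batch_mul hB m))]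
  norm_num

theorem config_N_le (hσ : 0 < σ) (hc' : 0 < c') (hB : 0 < B) :
    ((config L σ C c' ĉ B m).N : ℝ)
      ≤ (c' * σ ^ (8 / 3 : ℝ) + 1) * ((B : ℝ) * (m + 1)) ^ (1 / 3 : ℝ) := by
  have h1 := one_le_rpow_third hB m
  have h2 : 0 ≤ c' * σ ^ (8 / 3 : ℝ) * ((B : ℝ) * (m + 1)) ^ (1 / 3 : ℝ) := by positivity
  have h3 := (Nat.ceil_lt_add_one h2).le
  rw [add_mul, one_mul]
  exact h3.trans (add_le_add_right h1 _)

theorem config_N_pos (hσ : 0 < σ) (hc' : 0 < c') (hB : 0 < B) :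
    0 < (config L σ C c' ĉ B m).N := by
  have h1 := one_le_rpow_third hB m
  refine Nat.ceil_pos.2 ?_
  positivity

theorem configScale_pow (hσ : 0 < σ) (hc' : 0 < c') (hB : 0 < B) :
    configScale L σ C c' ĉ B m ^ 4 = B * ((config L σ C c' ĉ B m).N * ((m : ℝ) + 1)) := by
  have hN : (0 : ℝ) < (config L σ C c' ĉ B m).N := by exact_mod_cast config_N_pos hσ hc' hB
  rw [configScale, ← Real.rpow_natCast, ← Real.rpow_mul (by positivity)]
  norm_num

theorem configScale_pos (hσ : 0 < σ) (hc' : 0 < c') (hB : 0 < B) :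
    0 < configScale L σ C c' ĉ B m := by
  have hN : (0 : ℝ) < (config L σ C c' ĉ B m).N := by exact_mod_cast config_N_pos hσ hc' hB
  have hB' : (0 : ℝ) < B := by exact_mod_cast hB
  unfold configScale
  positivity

/-- With scale `r` and `k = ĉ√2/√(3C)`, this and `config_one_sub_β` read `α = kB/r` and `1 - β =
B/r²`; all later estimates are algebra in `r`. -/
theorem config_α (hσ : 0 < σ) (hc' : 0 < c') (hB : 0 < B) :
    (config L σ C c' ĉ B m).α = ĉ * √2 / √(3 * C) * B / configScale L σ C c' ĉ B m := by
  have hN : (0 : ℝ) < (config L σ C c' ĉ B m).N := by exact_mod_cast config_N_pos hσ hc' hB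
  have hB' : (0 : ℝ) < B := by exact_mod_cast hB
  have e : (config L σ C c' ĉ B m).α = ĉ * √2 * (B : ℝ) ^ (3 / 4 : ℝ) /
      (√(3 * C) * ((config L σ C c' ĉ B m).N : ℝ) ^ (1 / 4 : ℝ) * ((m : ℝ) + 1) ^ (1 / 4 : ℝ)) :=
    rfl
  have e2 : (B : ℝ) = (B : ℝ) ^ (3 / 4 : ℝ) * (B : ℝ) ^ (1 / 4 : ℝ) := by
    rw [← Real.rpow_add hB']
    norm_num
  have h1 : (0 : ℝ) < (B : ℝ) ^ (1 / 4 : ℝ) := by positivity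
  rw [e, configScale, Real.mul_rpow hB'.le (by positivity), Real.mul_rpow hN.le (by positivity)]
  nth_rewrite 2 [e2]
  rw [div_mul_eq_mul_div, div_div, ← mul_assoc, mul_left_comm (√(3 * C)), ← mul_assoc (√(3 * C)),
    mul_comm ((B : ℝ) ^ (1 / 4 : ℝ)) (√(3 * C) * _ * _), mul_div_mul_right _ _ h1.ne']

theorem config_one_sub_β (hσ : 0 < σ) (hc' : 0 < c') (hB : 0 < B) :
    1 - (config L σ C c' ĉ B m).β = B / configScale L σ C c' ĉ B m ^ 2 := by
  have hN : (0 : ℝ) < (config L σ C c' ĉ B m).N := by exact_mod_cast config_N_pos hσ hc' hB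
  have hB' : (0 : ℝ) < B := by exact_mod_cast hB
  have hr := configScale_pos (L := L) (C := C) (ĉ := ĉ) (m := m) hσ hc' hB
  have e : (config L σ C c' ĉ B m).β
      = 1 - √(B : ℝ) / √(((config L σ C c' ĉ B m).N : ℝ) * (m + 1)) := rfl
  have e2 : configScale L σ C c' ĉ B m ^ 2
      = √(B : ℝ) * √(((config L σ C c' ĉ B m).N : ℝ) * (m + 1)) := by
    rw [← Real.sqrt_mul hB'.le, ← configScale_pow (L := L) (C := C) (ĉ := ĉ) hσ hc' hB]
    rw [show configScale L σ C c' ĉ B m ^ 4 = (configScale L σ C c' ĉ B m ^ 2) ^ 2 by ring,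
      Real.sqrt_sq (by positivity)]
  rw [e, e2, sub_sub_cancel]
  have h1 : 0 < √(B : ℝ) := Real.sqrt_pos.2 hB'
  nth_rewrite 2 [← Real.mul_self_sqrt hB'.le]
  rw [mul_div_mul_left _ _ h1.ne']

theorem sq_stepFactor (hC : 0 < C) : (ĉ * √2 / √(3 * C)) ^ 2 = 2 * ĉ ^ 2 / (3 * C) := by
  rw [div_pow, mul_pow, Real.sq_sqrt (by norm_num), Real.sq_sqrt (by positivity)]
  ring

/-- `B ≤ N(m+1)` means `B ≤ r²`, hence `β ≥ 0`. The bound `ĉ ≤ √(3C/(2B))` means `k²B ≤ 1`, hence `α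
≤ 1`. Finally `Cα² = (2ĉ²/3) B(1-β)`, and `ĉ ≤ 1` suffices. -/
theorem config_admissible (hL : 0 < L) (hσ : 0 < σ) (hC : 0 < C) (hc' : 0 < c') (hĉ : 0 < ĉ)
    (hĉ1 : ĉ ≤ 1) (hĉ2 : ĉ ≤ √(3 * C / (2 * B))) (hB : 0 < B)
    (hm : (B : ℝ) ≤ (config L σ C c' ĉ B m).N * ((m : ℝ) + 1)) :
    (config L σ C c' ĉ B m).Admissible L C := by
  have hB' : (0 : ℝ) < B := by exact_mod_cast hB
  have hr := configScale_pos (L := L) (C := C) (ĉ := ĉ) (m := m) hσ hc' hB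
  have hr4 := configScale_pow (L := L) (C := C) (ĉ := ĉ) (m := m) hσ hc' hB
  have hα := config_α (L := L) (C := C) (ĉ := ĉ) (m := m) hσ hc' hB
  have hβ := config_one_sub_β (L := L) (C := C) (ĉ := ĉ) (m := m) hσ hc' hB
  have hk := sq_stepFactor (ĉ := ĉ) hC
  have hkpos : 0 < ĉ * √2 / √(3 * C) := by positivity
  set k := ĉ * √2 / √(3 * C)
  set r := configScale L σ C c' ĉ B m
  have hBr : (B : ℝ) ≤ r ^ 2 := by
    have : (B : ℝ) ^ 2 ≤ (r ^ 2) ^ 2 := by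
      calc (B : ℝ) ^ 2 = B * B := sq _
        _ ≤ B * ((config L σ C c' ĉ B m).N * ((m : ℝ) + 1)) := mul_le_mul_of_nonneg_left hm hB'.le
        _ = (r ^ 2) ^ 2 := by rw [← hr4]; ring
    exact le_of_sq_le_sq this (by positivity)
  have hkB : k ^ 2 * B ≤ 1 := by
    have h1 : ĉ ^ 2 ≤ 3 * C / (2 * B) := by
      calc ĉ ^ 2 ≤ √(3 * C / (2 * B)) ^ 2 := pow_le_pow_left₀ hĉ.le hĉ2 2
        _ = 3 * C / (2 * B) := Real.sq_sqrt (by positivity)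
    rw [hk]
    rw [le_div_iff₀ (by positivity)] at h1
    rw [div_mul_eq_mul_div, div_le_one (by positivity)]
    linarith
  refine ⟨config_N_pos hσ hc' hB, hB, ?_, ?_, ?_, ?_, rfl, hL.le, hC.le, ?_⟩
  · rw [hα]; positivity
  · rw [hα, div_le_one hr]
    refine le_of_sq_le_sq ?_ hr.le
    calc (k * (B : ℝ)) ^ 2 = (k ^ 2 * (B : ℝ)) * (B : ℝ) := by ring
      _ ≤ 1 * (B : ℝ) := mul_le_mul_of_nonneg_right hkB hB'.le
      _ ≤ r ^ 2 := by rw [one_mul]; exact hBr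
  · have : (B : ℝ) / r ^ 2 ≤ 1 := (div_le_one (by positivity)).2 hBr
    linarith
  · have : 0 < (B : ℝ) / r ^ 2 := by positivity
    linarith
  · rw [hα, hβ, div_pow, mul_pow, hk]
    have h1 : ĉ ^ 2 ≤ 1 := pow_le_one₀ hĉ.le hĉ1
    have e : C * (2 * ĉ ^ 2 / (3 * C) * B ^ 2 / r ^ 2) = 2 / 3 * ĉ ^ 2 * (B * (B / r ^ 2)) := by
      field_simp
    have h2 : 0 ≤ (B : ℝ) * (B / r ^ 2) := by positivity
    change C * (2 * ĉ ^ 2 / (3 * C) * B ^ 2 / r ^ 2) ≤ B * (B / r ^ 2)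
    rw [e]
    nlinarith

/-- The constant in the bound `K [B(m+1)]^{-2/3}` on the mean squared gradient mapping. -/
def rateConstant (L σ C c' ĉ D : ℝ) : ℝ :=
  (4 + L) ^ 2 * (|D| * (c' * σ ^ (8 / 3 : ℝ) + 1) / (ĉ * √2 / √(3 * C))
    + 2 * σ ^ 2 / √(c' * σ ^ (8 / 3 : ℝ)))

theorem rateConstant_pos (hL : 0 < L) (hσ : 0 < σ) (hC : 0 < C) (hc' : 0 < c') (hĉ : 0 < ĉ)
    (D : ℝ) : 0 < rateConstant L σ C c' ĉ D := by
  unfold rateConstant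
  positivity

/-- Put `Z = [B(m+1)]^{1/3}`. As `N` is of order `Z`, the scale `r` is of order `Z` too. Then
`α(m+1) = kZ³/r` is of order `Z²`, while the noise is at most `α(m+1) · 2σ²/r²`: both contributions
have order `Z⁻²`. -/
theorem add_mul_stageNoise_le (hL : 0 < L) (hσ : 0 < σ) (hC : 0 < C) (hc' : 0 < c') (hĉ : 0 < ĉ)
    (hB : 0 < B) (D : ℝ) {K : ℕ} (hK : 1 ≤ K) :
    |D| + K * Model.Bounded.stageNoise (config L σ C c' ĉ B m) σ
      ≤ (config L σ C c' ĉ B m).α / (4 + L) ^ 2 * (K * ((m : ℝ) + 1)) *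
        (rateConstant L σ C c' ĉ D / (((B : ℝ) * ((m : ℝ) + 1)) ^ (1 / 3 : ℝ)) ^ 2) := by
  have hB' : (0 : ℝ) < B := by exact_mod_cast hB
  have hK' : (1 : ℝ) ≤ K := by exact_mod_cast hK
  have hr := configScale_pos (L := L) (C := C) (ĉ := ĉ) (m := m) hσ hc' hB
  have hr4 := configScale_pow (L := L) (C := C) (ĉ := ĉ) (m := m) hσ hc' hB
  have hα := config_α (L := L) (C := C) (ĉ := ĉ) (m := m) hσ hc' hB
  have hβ := config_one_sub_β (L := L) (C := C) (ĉ := ĉ) (m := m) hσ hc' hB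
  have hN : (0 : ℝ) < (config L σ C c' ĉ B m).N := by exact_mod_cast config_N_pos hσ hc' hB
  have hNge := config_N_ge (L := L) (C := C) (ĉ := ĉ) (σ := σ) (c' := c') (B := B) (m := m)
  have hNle := config_N_le (L := L) (C := C) (ĉ := ĉ) (m := m) hσ hc' hB
  have hZ1 := one_le_rpow_third hB m
  have hZ3 := rpow_third_pow hB m
  have hk : 0 < ĉ * √2 / √(3 * C) := by positivity
  have hp : 0 < c' * σ ^ (8 / 3 : ℝ) := by positivity
  have hbm : (config L σ C c' ĉ B m).B = B := rfl
  have hmm : (config L σ C c' ĉ B m).m = m := rfl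
  rw [rateConstant, Model.Bounded.stageNoise, hβ, hα, hbm, hmm]
  set k := ĉ * √2 / √(3 * C)
  set p := c' * σ ^ (8 / 3 : ℝ)
  set Z := ((B : ℝ) * ((m : ℝ) + 1)) ^ (1 / 3 : ℝ)
  set r := configScale L σ C c' ĉ B m
  set N : ℝ := ((config L σ C c' ĉ B m).N : ℝ)
  have hm0 : (0 : ℝ) ≤ m := Nat.cast_nonneg m
  have hZ : 0 < Z := by linarith
  have hr4' : r ^ 4 = N * Z ^ 3 := by rw [hr4, hZ3]; ring
  have hrlow : √p * Z ^ 2 ≤ r ^ 2 := by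
    refine le_of_sq_le_sq ?_ (by positivity)
    rw [mul_pow, Real.sq_sqrt hp.le]
    calc p * (Z ^ 2) ^ 2 = (p * Z) * Z ^ 3 := by ring
      _ ≤ N * Z ^ 3 := mul_le_mul_of_nonneg_right hNge (by positivity)
      _ = (r ^ 2) ^ 2 := by rw [← hr4']; ring
  -- The exponent of `p + 1` is raised from `1` to `4` to avoid a fourth root in the constant.
  have hrup : r ≤ (p + 1) * Z := by
    refine le_of_pow_le_pow_left₀ (n := 4) (by norm_num) (by positivity) ?_
    rw [hr4', mul_pow]
    calc N * Z ^ 3 ≤ ((p + 1) * Z) * Z ^ 3 := mul_le_mul_of_nonneg_right hNle (by positivity)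
      _ = (p + 1) * Z ^ 4 := by ring
      _ ≤ (p + 1) ^ 4 * Z ^ 4 := mul_le_mul_of_nonneg_right
          (le_self_pow₀ (by linarith) (by norm_num)) (by positivity)
  have hαm : k * B / r * ((m : ℝ) + 1) = k * Z ^ 3 / r := by rw [hZ3]; ring
  have hsp : 0 < √p := Real.sqrt_pos.2 hp
  have hD : |D| ≤ k * B / r * (K * ((m : ℝ) + 1)) * (|D| * (p + 1) / k / Z ^ 2) := by
    have e : k * B / r * (K * ((m : ℝ) + 1)) * (|D| * (p + 1) / k / Z ^ 2)
        = |D| * (K * ((p + 1) * Z / r)) := by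
      rw [show k * B / r * (K * ((m : ℝ) + 1)) = K * (k * B / r * ((m : ℝ) + 1)) by ring, hαm]
      field_simp
    rw [e]
    have : 1 ≤ (p + 1) * Z / r := (one_le_div hr).2 hrup
    exact le_mul_of_one_le_right (abs_nonneg D) (one_le_mul_of_one_le_of_one_le hK' this)
  have hnoise : k * B / r / (B / r ^ 2) * (σ ^ 2 / N)
        + m * (k * B / r / (B / r ^ 2) * ((B / r ^ 2) ^ 2 / B * σ ^ 2))
      ≤ k * B / r * ((m : ℝ) + 1) * (2 * σ ^ 2 / √p / Z ^ 2) := by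
    -- By `r⁴ = BN(m+1)`, the error of the first batch weighs as much as `m + 1` noise terms
    -- `σ²/r²`; `N` and `β` balance these two sources.
    have e1 : k * B / r / (B / r ^ 2) * (σ ^ 2 / N) = k * B / r * (((m : ℝ) + 1) * (σ ^ 2 / r ^ 2)) := by
      field_simp
      rw [hr4]
      ring
    have e2 : m * (k * B / r / (B / r ^ 2) * ((B / r ^ 2) ^ 2 / B * σ ^ 2))
        = k * B / r * (m * (σ ^ 2 / r ^ 2)) := by
      field_simp
    rw [e1, e2, ← mul_add, mul_assoc]
    refine mul_le_mul_of_nonneg_left ?_ (by positivity)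
    have h1 : σ ^ 2 / r ^ 2 ≤ σ ^ 2 / √p / Z ^ 2 := by
      rw [div_div]
      exact div_le_div_of_nonneg_left (by positivity) (by positivity) hrlow
    have h2 : 0 ≤ σ ^ 2 / r ^ 2 := by positivity
    have e3 : 2 * σ ^ 2 / √p / Z ^ 2 = 2 * (σ ^ 2 / √p / Z ^ 2) := by ring
    rw [e3]
    nlinarith
  have hnoise' := mul_le_mul_of_nonneg_left hnoise (zero_le_one.trans hK')
  refine (add_le_add hD hnoise').trans (le_of_eq ?_)
  have : (4 + L) ^ 2 ≠ 0 := by positivity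
  field_simp

/-- The choice of `m` solved for `Z²`. The exact factor `K^{2/3}` is weakened to `K²` through `K ≤
K³`; bounded `K` makes this harmless. -/
theorem sq_rpow_third_ge (hσ : 0 < σ) (hB : 0 < B) {Ψ ε : ℝ} (hΨ : 0 < Ψ) (hε : 0 < ε) {K : ℕ}
    (hK : 1 ≤ K) (hm : Ψ ^ (3 / 2 : ℝ) * σ / (K * B * ε ^ 3) ≤ (m : ℝ) + 1) :
    Ψ * (σ ^ (1 / 3 : ℝ)) ^ 2 / (K ^ 2 * ε ^ 2)
      ≤ (((B : ℝ) * ((m : ℝ) + 1)) ^ (1 / 3 : ℝ)) ^ 2 := by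
  have hB' : (0 : ℝ) < B := by exact_mod_cast hB
  have hK' : (1 : ℝ) ≤ K := by exact_mod_cast hK
  have hZ1 := one_le_rpow_third hB m
  have hZ3 := rpow_third_pow hB m
  set Z := ((B : ℝ) * ((m : ℝ) + 1)) ^ (1 / 3 : ℝ)
  have hs : (σ ^ (1 / 3 : ℝ)) ^ 3 = σ := by
    rw [← Real.rpow_natCast, ← Real.rpow_mul hσ.le]
    norm_num
  have hs0 : 0 < σ ^ (1 / 3 : ℝ) := by positivity
  set s := σ ^ (1 / 3 : ℝ)
  have hΨ3 : Ψ ^ (3 / 2 : ℝ) = √Ψ ^ 3 := by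
    rw [Real.sqrt_eq_rpow, ← Real.rpow_natCast, ← Real.rpow_mul hΨ.le]
    norm_num
  have hle : √Ψ * s / (K * ε) ≤ Z := by
    refine le_of_pow_le_pow_left₀ (n := 3) (by norm_num) (by linarith) ?_
    rw [hZ3, div_pow, mul_pow, hs, mul_pow, ← hΨ3]
    rw [div_le_iff₀ (by positivity)] at hm ⊢
    have h1 : (K : ℝ) ≤ K ^ 3 := le_self_pow₀ hK' (by norm_num)
    refine hm.trans ?_
    have h2 : 0 ≤ (B : ℝ) * ((m : ℝ) + 1) * ε ^ 3 := by positivity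
    nlinarith [mul_le_mul_of_nonneg_left h1 h2]
  have h := pow_le_pow_left₀ (by positivity) hle 2
  rwa [div_pow, mul_pow, mul_pow, Real.sq_sqrt hΨ.le] at h

/-- For `Ψ` large the bound on the mean squared gradient mapping is at most `ε² / 2`. -/
theorem add_mul_stageNoise_le_sq (hL : 0 < L) (hσ : 0 < σ) (hC : 0 < C) (hc' : 0 < c')
    (hĉ : 0 < ĉ) (hB : 0 < B) (D : ℝ) {K K₀ : ℕ} (hK : 1 ≤ K) (hK₀ : K ≤ K₀) {Ψ ε : ℝ}
    (hΨ : 2 * rateConstant L σ C c' ĉ D * K₀ ^ 2 / (σ ^ (1 / 3 : ℝ)) ^ 2 ≤ Ψ) (hε : 0 < ε)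
    (hm : Ψ ^ (3 / 2 : ℝ) * σ / (K * B * ε ^ 3) ≤ (m : ℝ) + 1) :
    |D| + K * Model.Bounded.stageNoise (config L σ C c' ĉ B m) σ
      ≤ (config L σ C c' ĉ B m).α / (4 + L) ^ 2 * (K * ((m : ℝ) + 1)) * (ε ^ 2 / 2) := by
  have hB' : (0 : ℝ) < B := by exact_mod_cast hB
  have hK' : (1 : ℝ) ≤ K := by exact_mod_cast hK
  have hKK : (K : ℝ) ≤ K₀ := by exact_mod_cast hK₀
  have hrc := rateConstant_pos hL hσ hC hc' hĉ D
  have hr := configScale_pos (L := L) (C := C) (ĉ := ĉ) (m := m) hσ hc' hB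
  have hK₀' : (0 : ℝ) < K₀ := by linarith
  have hΨ0 : 0 < Ψ := lt_of_lt_of_le (by positivity) hΨ
  have hZ := sq_rpow_third_ge hσ hB hΨ0 hε hK hm
  have hZ1 := one_le_rpow_third hB m
  refine (add_mul_stageNoise_le hL hσ hC hc' hĉ hB D hK).trans
    (mul_le_mul_of_nonneg_left ?_ ?_)
  · rw [div_le_div_iff₀ (by positivity) (by norm_num)]
    rw [div_le_iff₀ (by positivity)] at hZ hΨ
    have h1 : (K : ℝ) ^ 2 ≤ K₀ ^ 2 := pow_le_pow_left₀ (by linarith) hKK 2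
    have h2 : rateConstant L σ C c' ĉ D * 2 * K ^ 2
        ≤ (ε ^ 2 * (((B : ℝ) * ((m : ℝ) + 1)) ^ (1 / 3 : ℝ)) ^ 2) * K ^ 2 := by
      calc rateConstant L σ C c' ĉ D * 2 * K ^ 2
          ≤ 2 * rateConstant L σ C c' ĉ D * K₀ ^ 2 := by nlinarith
        _ ≤ Ψ * (σ ^ (1 / 3 : ℝ)) ^ 2 := hΨ
        _ ≤ _ := hZ
        _ = _ := by ring
    exact le_of_mul_le_mul_right h2 (by positivity)
  · rw [config_α hσ hc' hB]
    positivity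

/-- Rounding up adds at most one, and `1 ≤ 1/ε³` for `ε ≤ 1`. -/
theorem batch_mul_le (hB : 0 < B) {Ψ ε : ℝ} (hΨ : 0 < Ψ) (hσ : 0 < σ) (hε : 0 < ε) (hε1 : ε ≤ 1)
    {K : ℕ} (hK : 1 ≤ K) (hm : m + 1 = ⌈Ψ ^ (3 / 2 : ℝ) * σ / (K * B * ε ^ 3)⌉₊) :
    (B : ℝ) * ((m : ℝ) + 1) ≤ (Ψ ^ (3 / 2 : ℝ) * σ + B) / ε ^ 3 := by
  have hB' : (0 : ℝ) < B := by exact_mod_cast hB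
  have hK' : (1 : ℝ) ≤ K := by exact_mod_cast hK
  have h1 := (Nat.ceil_lt_add_one
    (show 0 ≤ Ψ ^ (3 / 2 : ℝ) * σ / (K * B * ε ^ 3) by positivity)).le
  rw [← hm] at h1
  push_cast at h1
  have h2 : Ψ ^ (3 / 2 : ℝ) * σ / (K * B * ε ^ 3) ≤ Ψ ^ (3 / 2 : ℝ) * σ / (B * ε ^ 3) := by
    refine div_le_div_of_nonneg_left (by positivity) (by positivity) ?_
    have : 0 < (B : ℝ) * ε ^ 3 := by positivity
    nlinarith
  have h3 : (1 : ℝ) ≤ 1 / ε ^ 3 := by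
    rw [le_div_iff₀ (by positivity), one_mul]
    exact pow_le_one₀ hε.le hε1
  calc (B : ℝ) * ((m : ℝ) + 1) ≤ B * (Ψ ^ (3 / 2 : ℝ) * σ / (B * ε ^ 3) + 1 / ε ^ 3) :=
        mul_le_mul_of_nonneg_left (by linarith) hB'.le
    _ = (Ψ ^ (3 / 2 : ℝ) * σ + B) / ε ^ 3 := by field_simp

/-- The number of trajectories and the number of proximal steps of `K` stages. -/
theorem stage_costs_le (hσ : 0 < σ) (hc' : 0 < c') (hB : 0 < B) {Ψ ε : ℝ} (hΨ : 0 < Ψ)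
    (hε : 0 < ε) (hε1 : ε ≤ 1) {K K₀ : ℕ} (hK : 1 ≤ K) (hK₀ : K ≤ K₀)
    (hm : m + 1 = ⌈Ψ ^ (3 / 2 : ℝ) * σ / (K * B * ε ^ 3)⌉₊) :
    ((K * ((config L σ C c' ĉ B m).N + m * (B + B)) : ℕ) : ℝ)
        ≤ K₀ * (c' * σ ^ (8 / 3 : ℝ) + 3) * (Ψ ^ (3 / 2 : ℝ) * σ + B) / ε ^ 3 ∧
      ((K * (m + 1) : ℕ) : ℝ)
        ≤ K₀ * (c' * σ ^ (8 / 3 : ℝ) + 3) * (Ψ ^ (3 / 2 : ℝ) * σ + B) / ε ^ 3 := by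
  have hB' : (1 : ℝ) ≤ B := by exact_mod_cast hB
  have hKK : (K : ℝ) ≤ K₀ := by exact_mod_cast hK₀
  have hp : 0 < c' * σ ^ (8 / 3 : ℝ) := by positivity
  have hX := batch_mul_le hB hΨ hσ hε hε1 hK hm
  have hNle := config_N_le (L := L) (C := C) (ĉ := ĉ) (m := m) hσ hc' hB
  have hZ1 := one_le_rpow_third hB m
  have hZ3 := rpow_third_pow hB m
  -- So `N`, of order `Z`, is also dominated by `B(m+1)`, like the mini-batches and the iterations.
  have hZX : ((B : ℝ) * ((m : ℝ) + 1)) ^ (1 / 3 : ℝ) ≤ B * ((m : ℝ) + 1) := by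
    conv_rhs => rw [← hZ3]
    exact le_self_pow₀ hZ1 (by norm_num)
  have hX1 := one_le_batch_mul hB m
  have hm0 : (0 : ℝ) ≤ m := Nat.cast_nonneg m
  have e : (K₀ : ℝ) * (c' * σ ^ (8 / 3 : ℝ) + 3) * (Ψ ^ (3 / 2 : ℝ) * σ + B) / ε ^ 3
      = K₀ * ((c' * σ ^ (8 / 3 : ℝ) + 3) * ((Ψ ^ (3 / 2 : ℝ) * σ + B) / ε ^ 3)) := by ring
  have hT : (c' * σ ^ (8 / 3 : ℝ) + 3) * (B * ((m : ℝ) + 1))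
      ≤ (c' * σ ^ (8 / 3 : ℝ) + 3) * ((Ψ ^ (3 / 2 : ℝ) * σ + B) / ε ^ 3) :=
    mul_le_mul_of_nonneg_left hX (by linarith)
  have hT0 : 0 ≤ (c' * σ ^ (8 / 3 : ℝ) + 3) * (B * ((m : ℝ) + 1)) := by positivity
  rw [e]
  push_cast
  constructor
  · refine mul_le_mul hKK (le_trans ?_ hT) (by positivity) (by positivity)
    have h1 := mul_le_mul_of_nonneg_left hZX (show 0 ≤ c' * σ ^ (8 / 3 : ℝ) + 1 by linarith)
    nlinarith
  · refine mul_le_mul hKK (le_trans ?_ hT) (by positivity) (by positivity)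
    nlinarith

/-- For small `ε` already `m + 1 ≥ B`, and `N ≥ 1`. Using `K₀ + 1` keeps the threshold positive when
`K₀ = 0`. -/
theorem batch_le_of_small (hσ : 0 < σ) (hc' : 0 < c') (hB : 0 < B) {Ψ ε : ℝ}
    (hε : 0 < ε) {K K₀ : ℕ} (hK : 1 ≤ K) (hK₀ : K ≤ K₀)
    (hε₀ : ε ≤ min 1 (Ψ ^ (3 / 2 : ℝ) * σ / ((K₀ + 1) * B ^ 2)))
    (hm : Ψ ^ (3 / 2 : ℝ) * σ / (K * B * ε ^ 3) ≤ (m : ℝ) + 1) :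
    (B : ℝ) ≤ (config L σ C c' ĉ B m).N * ((m : ℝ) + 1) := by
  have hB' : (0 : ℝ) < B := by exact_mod_cast hB
  have hK' : (1 : ℝ) ≤ K := by exact_mod_cast hK
  have hKK : (K : ℝ) ≤ K₀ := by exact_mod_cast hK₀
  have hN : (1 : ℝ) ≤ (config L σ C c' ĉ B m).N := by exact_mod_cast config_N_pos hσ hc' hB
  have hε1 : ε ≤ 1 := hε₀.trans (min_le_left _ _)
  have h1 := hε₀.trans (min_le_right _ _)
  have h2 : ε ^ 3 ≤ ε := pow_le_of_le_one hε.le hε1 (by norm_num)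
  have hm0 : (0 : ℝ) ≤ m := Nat.cast_nonneg m
  have h3 : (B : ℝ) ≤ Ψ ^ (3 / 2 : ℝ) * σ / (K * B * ε ^ 3) := by
    rw [le_div_iff₀ (by positivity)]
    rw [le_div_iff₀ (by positivity)] at h1
    calc (B : ℝ) * (K * B * ε ^ 3) = ε ^ 3 * (K * B ^ 2) := by ring
      _ ≤ ε * ((K₀ + 1) * B ^ 2) := by
        refine mul_le_mul h2 ?_ (by positivity) hε.le
        exact mul_le_mul_of_nonneg_right (by linarith) (by positivity)
      _ ≤ _ := h1
  nlinarith

end StepSizes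

end HSPG

/-! ### Accuracy of the random output -/

namespace HSPG

open Filter Topology

namespace Model

variable {S A : Type*} [MeasurableSpace S] [MeasurableSpace A] {q H : ℕ} {P : Model S A q H}
  {γ R b G M : ℝ} {Q : Param q → EReal} {L C σ W c' ĉ D Ψ ε : ℝ} {B m K K₀ : ℕ} {θ₀ : Param q}

/-- The supremum is real: finite above by assumption, and not `⊥` because `F(θ₀)` is finite. -/
theorem exists_optimal_value (hQ : ProperClosedConvex Q) (hF : (⨆ θ, P.F Q θ) < ⊤)
    (hθ₀ : Q θ₀ ≠ ⊤) (hD : (⨆ θ, P.F Q θ) ≤ P.F Q θ₀ + (D : EReal)) :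
    ∃ Fs : ℝ, (∀ θ, Q θ ≠ ⊤ → P.J θ - (Q θ).toReal ≤ Fs) ∧
      P.gap Q Fs θ₀ ≤ ENNReal.ofReal |D| := by
  have hcoe : ∀ θ, Q θ ≠ ⊤ → P.F Q θ = ((P.J θ - (Q θ).toReal : ℝ) : EReal) := by
    intro θ hθ
    rw [F, ← hQ.coe_toReal hθ, ← EReal.coe_sub, EReal.toReal_coe]
  have hle : ∀ θ, P.F Q θ ≤ ⨆ θ, P.F Q θ := fun θ => le_iSup (P.F Q) θ
  have hbot : (⨆ θ, P.F Q θ) ≠ ⊥ := by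
    intro h
    have := hle θ₀
    rw [h, hcoe θ₀ hθ₀] at this
    exact EReal.coe_ne_bot _ (le_bot_iff.1 this)
  have hs := EReal.coe_toReal hF.ne hbot
  refine ⟨(⨆ θ, P.F Q θ).toReal, fun θ hθ => ?_, ?_⟩
  · have := hle θ
    rw [hcoe θ hθ, ← hs] at this
    exact_mod_cast this
  · rw [← hs, hcoe θ₀ hθ₀, ← EReal.coe_add, EReal.coe_le_coe_iff] at hD
    rw [gap, if_neg hθ₀]
    refine ENNReal.ofReal_le_ofReal ?_
    linarith [le_abs_self D]

/-- Both outputs are uniform mixtures of laws of iterates, with index set the times or the pairs of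
stage and time. -/
theorem accurate_mixture {c : Config} (hgrad : Measurable (P.gradMap c.η Q)) {ι : Type*}
    {I : Finset ι} (hI : I.Nonempty) {μ : ι → Measure (State q)}
    (hμ : ∀ i ∈ I, IsProbabilityMeasure (μ i))
    (hle : (I.card : ENNReal)⁻¹ * ∑ i ∈ I, ∫⁻ x, ENNReal.ofReal (‖P.gradMap c.η Q x.1.1‖ ^ 2) ∂(μ i)
      ≤ ENNReal.ofReal (ε ^ 2)) :
    P.Accurate Q c ε ((I.card : ENNReal)⁻¹ • ∑ i ∈ I, (μ i).map fun x => x.1.1) := by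
  have hm : Measurable fun x : State q => x.1.1 := by fun_prop
  have hg : Measurable fun θ => ENNReal.ofReal (‖P.gradMap c.η Q θ‖ ^ 2) :=
    (hgrad.norm.pow_const 2).ennreal_ofReal
  refine ⟨⟨?_⟩, ?_⟩
  · rw [Measure.smul_apply, Measure.finsetSum_apply]
    have : ∀ i ∈ I, (μ i).map (fun x => x.1.1) Set.univ = 1 := by
      intro i hi
      have := hμ i hi
      rw [Measure.map_apply hm MeasurableSet.univ, Set.preimage_univ, measure_univ]
    rw [Finset.sum_congr rfl this, Finset.sum_const, nsmul_eq_mul, mul_one, smul_eq_mul]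
    exact ENNReal.inv_mul_cancel (by simpa using hI.ne_empty) (ENNReal.natCast_ne_top _)
  · rw [lintegral_smul_measure, lintegral_finsetSum_measure, smul_eq_mul]
    simp_rw [lintegral_map hg hm]
    exact hle

theorem inv_mul_le_of_mul_le {a e d : ℝ} {n : ℕ} (ha : 0 < a) (hn : 0 < n) {X : ENNReal}
    (h : ENNReal.ofReal a * X ≤ ENNReal.ofReal d) (hd : d ≤ a * n * e) :
    (n : ENNReal)⁻¹ * X ≤ ENNReal.ofReal e := by
  have hn' : (0 : ℝ) < n := by exact_mod_cast hn
  rw [← ENNReal.div_eq_inv_mul]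
  refine ENNReal.div_le_of_le_mul ?_
  have h2 : ENNReal.ofReal a * X ≤ ENNReal.ofReal a * (ENNReal.ofReal e * n) := by
    refine h.trans ((ENNReal.ofReal_le_ofReal hd).trans (le_of_eq ?_))
    rw [mul_assoc, ENNReal.ofReal_mul ha.le, mul_comm (n : ℝ), ENNReal.ofReal_mul' hn'.le,
      ENNReal.ofReal_natCast]
  exact (ENNReal.mul_le_mul_iff_right (by simpa using ha) ENNReal.ofReal_ne_top).1 h2

namespace Bounded

theorem sum_sum_lintegral_stageLaw_le (hP : P.Bounded γ R b G M) (hγ0 : 0 ≤ γ) (hγ1 : γ < 1)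
    (hQ : ProperClosedConvex Q) (hS : P.SmoothnessConstants W L σ C) {c : Config}
    (hc : c.Admissible L C) (hF : (⨆ θ, P.F Q θ) < ⊤) (hθ₀ : Q θ₀ ≠ ⊤)
    (hD : (⨆ θ, P.F Q θ) ≤ P.F Q θ₀ + (D : EReal))
    (hW : ∀ s < K, P.WeightsBounded Q c (P.stageStart Q c θ₀ s) W) :
    ENNReal.ofReal (c.α / (4 + L) ^ 2) * ∑ s ∈ Finset.range K, ∑ t ∈ Finset.range (c.m + 1),
        ∫⁻ x, ENNReal.ofReal (‖P.gradMap c.η Q x.1.1‖ ^ 2) ∂(P.stageLaw Q c θ₀ s t)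
      ≤ ENNReal.ofReal (|D| + K * stageNoise c σ) := by
  obtain ⟨Fs, hFs, hgap⟩ := exists_optimal_value hQ hF hθ₀ hD
  have h := hP.sum_sum_lintegral_stageLaw_gradMap_le hγ0 hγ1 hQ hS hc hFs
    (ne_top_of_le_ne_top ENNReal.ofReal_ne_top hgap) K hW
  refine (le_self_add.trans h).trans ((add_le_add_left hgap _).trans (le_of_eq ?_))
  have hα := hc.α_pos
  have hβ : 0 < 1 - c.β := by linarith [hc.β_lt]
  have hnoise : 0 ≤ stageNoise c σ := by unfold stageNoise; positivity
  rw [ENNReal.ofReal_add (abs_nonneg D) (by positivity), ENNReal.ofReal_mul (by positivity),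
    ENNReal.ofReal_natCast]

theorem isProbabilityMeasure_stageLaw (hP : P.Bounded γ R b G M) {c : Config}
    (hprox : Measurable (proxStep c.η Q)) (θ₀ : Param q) (s t : ℕ) :
    IsProbabilityMeasure (P.stageLaw Q c θ₀ s t) := by
  have := hP.isProbabilityMeasure_stageStart hprox θ₀ s
  exact hP.isProbabilityMeasure_law hprox _ t

theorem accurate_restartOutput (hP : P.Bounded γ R b G M) (hγ0 : 0 ≤ γ) (hγ1 : γ < 1)
    (hQ : ProperClosedConvex Q) (hS : P.SmoothnessConstants W L σ C) {c : Config}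
    (hc : c.Admissible L C) (hF : (⨆ θ, P.F Q θ) < ⊤) (hθ₀ : Q θ₀ ≠ ⊤)
    (hD : (⨆ θ, P.F Q θ) ≤ P.F Q θ₀ + (D : EReal)) (hK : 1 ≤ K)
    (hW : ∀ s < K, P.WeightsBounded Q c (P.stageStart Q c θ₀ s) W)
    (hε : |D| + K * stageNoise c σ
      ≤ c.α / (4 + L) ^ 2 * (K * ((c.m : ℝ) + 1)) * (ε ^ 2 / 2)) :
    P.Accurate Q c ε (P.restartOutput Q c θ₀ K) := by
  have hprox := (hQ.continuous_proxStep hc.η_pos).measurable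
  have hα := hc.α_pos
  have hL := hc.L_nonneg
  have hsum := hP.sum_sum_lintegral_stageLaw_le hγ0 hγ1 hQ hS hc hF hθ₀ hD hW
  have hacc := accurate_mixture (P := P) (Q := Q) (c := c) (ε := ε)
    (measurable_gradMap hQ hc.η_pos hS) (I := Finset.range K ×ˢ Finset.range (c.m + 1))
    ⟨(0, 0), by simp; omega⟩ (μ := fun i => P.stageLaw Q c θ₀ i.1 i.2)
    (fun i _ => hP.isProbabilityMeasure_stageLaw hprox θ₀ i.1 i.2)
  rw [Finset.sum_product, Finset.sum_product, Finset.card_product, Finset.card_range,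
    Finset.card_range] at hacc
  refine hacc (inv_mul_le_of_mul_le (by positivity) (by positivity) hsum (hε.trans ?_))
  push_cast
  refine mul_le_mul_of_nonneg_left ?_ (by positivity)
  linarith [sq_nonneg ε]

/-- Restricting a sum of nonnegative terms to at least half of its indices at most doubles the
average; the spare factor in `ε² / 2` pays for that. -/
theorem accurate_output (hP : P.Bounded γ R b G M) (hγ0 : 0 ≤ γ) (hγ1 : γ < 1)
    (hQ : ProperClosedConvex Q) (hS : P.SmoothnessConstants W L σ C) {c : Config}
    (hc : c.Admissible L C) (hF : (⨆ θ, P.F Q θ) < ⊤) (hθ₀ : Q θ₀ ≠ ⊤)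
    (hD : (⨆ θ, P.F Q θ) ≤ P.F Q θ₀ + (D : EReal))
    (hW : P.WeightsBounded Q c (Measure.dirac (θ₀, 0, 0)) W)
    (hε : |D| + stageNoise c σ ≤ c.α / (4 + L) ^ 2 * ((c.m : ℝ) + 1) * (ε ^ 2 / 2))
    {I : Finset ℕ} (hI : I ⊆ Finset.range (c.m + 1)) (hcard : c.m + 1 ≤ 2 * I.card) :
    P.Accurate Q c ε (P.output Q c θ₀ I) := by
  have hprox := (hQ.continuous_proxStep hc.η_pos).measurable
  have hα := hc.α_pos
  have hL := hc.L_nonneg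
  have hsum := hP.sum_sum_lintegral_stageLaw_le (K := 1) hγ0 hγ1 hQ hS hc hF hθ₀ hD
    (fun s hs => by
      obtain rfl : s = 0 := by omega
      exact hW)
  rw [Finset.sum_range_one, Nat.cast_one, one_mul] at hsum
  refine accurate_mixture (measurable_gradMap hQ hc.η_pos hS) (Finset.card_pos.1 (by omega))
    (fun i _ => hP.isProbabilityMeasure_stageLaw hprox θ₀ 0 i)
    (inv_mul_le_of_mul_le (a := c.α / (4 + L) ^ 2) (by positivity) (by omega)
      ((mul_le_mul_right (Finset.sum_le_sum_of_subset hI) _).trans hsum) (hε.trans ?_))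
  have h : (c.m : ℝ) + 1 ≤ 2 * I.card := by exact_mod_cast hcard
  have := mul_le_mul_of_nonneg_left h (show 0 ≤ c.α / (4 + L) ^ 2 * (ε ^ 2 / 2) by positivity)
  linarith

end Bounded

end Model

end HSPG

end

/-! ### The two complexity bounds -/

theorem corollary1
    (H : ℕ) (γ R b G M W : ℝ) (hγ0 : 0 ≤ γ) (hγ1 : γ < 1) (hR : 0 < R) (hb : 0 ≤ b) (hG : 0 < G)
    (hM : 0 < M) (hW : 0 < W) :
    ∃ L₀ σ₀ C₀ : ℝ, 0 < L₀ ∧ 0 < σ₀ ∧ 0 < C₀ ∧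
      -- `L₀`, `σ₀`, `C₀` are constants of smoothness and variance for all problems of the class
      (∀ (S : Type u) (A : Type v) [MeasurableSpace S] [MeasurableSpace A] (q : ℕ)
        (P : HSPG.Model S A q H), P.Bounded γ R b G M → P.SmoothnessConstants W L₀ σ₀ C₀) ∧
      ∀ L σ C : ℝ, L₀ ≤ L → σ₀ ≤ σ → C₀ ≤ C →
      ∀ (B : ℕ) (c' ĉ D : ℝ), 0 < B → 0 < c' → 0 < ĉ → ĉ ≤ 1 → ĉ ≤ √(3 * C / (2 * B)) →
        -- ProxHSPGA
        (∃ Ψ' : ℝ, 0 < Ψ' ∧ ∀ Ψ : ℝ, Ψ' ≤ Ψ → ∃ ε₀ T : ℝ, 0 < ε₀ ∧ 0 < T ∧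
          ∀ (S : Type u) (A : Type v) [MeasurableSpace S] [MeasurableSpace A] (q : ℕ)
            (P : HSPG.Model S A q H) (Q : HSPG.Param q → EReal) (θ₀ : HSPG.Param q),
            P.Bounded γ R b G M → HSPG.ProperClosedConvex Q →
            (⨆ θ, P.F Q θ) < ⊤ → Q θ₀ ≠ ⊤ → (⨆ θ, P.F Q θ) ≤ P.F Q θ₀ + (D : EReal) →
          ∀ (ε : ℝ) (m : ℕ) (c : HSPG.Config), 0 < ε →
            m + 1 = ⌈Ψ ^ (3 / 2 : ℝ) * σ / (B * ε ^ 3)⌉₊ →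
            c = HSPG.config L σ C c' ĉ B m →
            (ε ≤ ε₀ ∨ B ≤ c.N * (m + 1)) →
            P.WeightsBounded Q c (MeasureTheory.Measure.dirac (θ₀, 0, 0)) W →
              P.Accurate Q c ε (P.output Q c θ₀ (Finset.range (m + 1))) ∧
              (1 ≤ m → P.Accurate Q c ε (P.output Q c θ₀ (Finset.Icc 1 m))) ∧
              (ε ≤ 1 → ∀ᵐ x ∂(P.law Q c (MeasureTheory.Measure.dirac (θ₀, 0, 0)) m),
                (x.2.1 : ℝ) ≤ T / ε ^ 3 ∧ (x.2.2 : ℝ) ≤ T / ε ^ 3)) ∧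
        -- restarting ProxHSPGA with `K` stages, `K` bounded
        (∀ K₀ : ℕ, ∃ Ψ' : ℝ, 0 < Ψ' ∧ ∀ Ψ : ℝ, Ψ' ≤ Ψ → ∃ ε₀ T : ℝ, 0 < ε₀ ∧ 0 < T ∧
          ∀ (S : Type u) (A : Type v) [MeasurableSpace S] [MeasurableSpace A] (q : ℕ)
            (P : HSPG.Model S A q H) (Q : HSPG.Param q → EReal) (θ₀ : HSPG.Param q),
            P.Bounded γ R b G M → HSPG.ProperClosedConvex Q →
            (⨆ θ, P.F Q θ) < ⊤ → Q θ₀ ≠ ⊤ → (⨆ θ, P.F Q θ) ≤ P.F Q θ₀ + (D : EReal) →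
          ∀ (ε : ℝ) (m K : ℕ) (c : HSPG.Config), 0 < ε → 1 ≤ K → K ≤ K₀ →
            m + 1 = ⌈Ψ ^ (3 / 2 : ℝ) * σ / (K * B * ε ^ 3)⌉₊ →
            c = HSPG.config L σ C c' ĉ B m →
            (ε ≤ ε₀ ∨ B ≤ c.N * (m + 1)) →
            (∀ s < K, P.WeightsBounded Q c (P.stageStart Q c θ₀ s) W) →
              P.Accurate Q c ε (P.restartOutput Q c θ₀ K) ∧
              (ε ≤ 1 → ∀ᵐ x ∂(P.stageStart Q c θ₀ K),
                (x.2.1 : ℝ) ≤ T / ε ^ 3 ∧ (x.2.2 : ℝ) ≤ T / ε ^ 3)) := by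
  obtain ⟨L₀, σ₀, C₀, hL₀, hσ₀, hC₀, hclass⟩ :=
    HSPG.Model.exists_smoothnessConstants.{u, v} H γ R b G M W hγ0 hγ1 hR hb hG hM hW
  refine ⟨L₀, σ₀, C₀, hL₀, hσ₀, hC₀, hclass, ?_⟩
  intro L σ C hL hσ hC B c' ĉ D hB hc' hĉ hĉ1 hĉ2
  have hL' : 0 < L := hL₀.trans_le hL
  have hσ' : 0 < σ := hσ₀.trans_le hσ
  have hC' : 0 < C := hC₀.trans_le hC
  have hB' : (0 : ℝ) < B := by exact_mod_cast hB
  have hrc := HSPG.rateConstant_pos hL' hσ' hC' hc' hĉ D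
  have hadm : ∀ {Ψ ε : ℝ} {m K K₀ : ℕ}, 0 < ε → 1 ≤ K → K ≤ K₀ →
      Ψ ^ (3 / 2 : ℝ) * σ / (K * B * ε ^ 3) ≤ (m : ℝ) + 1 →
      (ε ≤ min 1 (Ψ ^ (3 / 2 : ℝ) * σ / ((K₀ + 1) * B ^ 2)) ∨
        B ≤ (HSPG.config L σ C c' ĉ B m).N * (m + 1)) →
      (HSPG.config L σ C c' ĉ B m).Admissible L C := by
    intro Ψ ε m K K₀ hε hK hK₀ hm hor
    refine HSPG.config_admissible hL' hσ' hC' hc' hĉ hĉ1 hĉ2 hB ?_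
    rcases hor with h | h
    · exact HSPG.batch_le_of_small hσ' hc' hB hε hK hK₀ h hm
    · exact_mod_cast h
  have hceil : ∀ {x : ℝ} {m : ℕ}, m + 1 = ⌈x⌉₊ → x ≤ (m : ℝ) + 1 := by
    intro x m h
    have := Nat.le_ceil x
    rw [← h] at this
    exact_mod_cast this
  constructor
  -- One run is one stage: the cast of `1` is left visible so that the estimates for `K = K₀ = 1`
  -- apply as they are.
  · refine ⟨2 * HSPG.rateConstant L σ C c' ĉ D * ((1 : ℕ) : ℝ) ^ 2 / (σ ^ (1 / 3 : ℝ)) ^ 2,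
      by positivity, fun Ψ hΨ => ?_⟩
    have hΨ0 : 0 < Ψ := lt_of_lt_of_le (by positivity) hΨ
    refine ⟨min 1 (Ψ ^ (3 / 2 : ℝ) * σ / (((1 : ℕ) + 1) * B ^ 2)),
      ((1 : ℕ) : ℝ) * (c' * σ ^ (8 / 3 : ℝ) + 3) * (Ψ ^ (3 / 2 : ℝ) * σ + B),
      lt_min one_pos (by positivity), by positivity, ?_⟩
    intro S A _ _ q P Q θ₀ hP hQ hF hθ₀ hD ε m c hε hm hcfg hor hW
    have hm' : m + 1 = ⌈Ψ ^ (3 / 2 : ℝ) * σ / ((1 : ℕ) * B * ε ^ 3)⌉₊ := by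
      rw [hm, Nat.cast_one, one_mul]
    subst hcfg
    have hc := hadm hε le_rfl le_rfl (hceil hm') hor
    have hS := (hclass S A q P hP).mono hL hσ₀.le hσ hC
    have hprox := (hQ.continuous_proxStep hc.η_pos).measurable
    have hbound := HSPG.add_mul_stageNoise_le_sq hL' hσ' hC' hc' hĉ hB D le_rfl le_rfl hΨ hε
      (hceil hm')
    rw [Nat.cast_one, one_mul, one_mul] at hbound
    refine ⟨hP.accurate_output hγ0 hγ1 hQ hS hc hF hθ₀ hD hW hbound subset_rfl ?_,
      fun hm1 => hP.accurate_output hγ0 hγ1 hQ hS hc hF hθ₀ hD hW hbound (fun t ht => ?_) ?_,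
      fun hε1 => ?_⟩
    · rw [Finset.card_range]
      change m + 1 ≤ 2 * (m + 1)
      omega
    · rw [Finset.mem_Icc] at ht
      rw [Finset.mem_range]
      change t < m + 1
      omega
    · rw [Nat.card_Icc]
      change m + 1 ≤ 2 * (m + 1 - 1)
      omega
    · obtain ⟨h1, h2⟩ := HSPG.stage_costs_le (L := L) (C := C) (ĉ := ĉ) hσ' hc' hB hΨ0 hε hε1
        le_rfl le_rfl hm'
      -- The start of a single run is `stageStart` at stage `0`, where both counters vanish.
      have hcount := hP.ae_law_counters hprox (hP.ae_stageStart_counters hprox θ₀ 0) m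
      refine hcount.mono fun x hx => ?_
      rw [hx]
      constructor
      · refine le_trans (le_of_eq ?_) h1
        simp [HSPG.config]
      · refine le_trans (le_of_eq ?_) h2
        push_cast
        ring
  · intro K₀
    -- The summand `1`, here and in `T`, keeps both constants positive when `K₀ = 0`, a case with no
    -- admissible `K`.
    refine ⟨2 * HSPG.rateConstant L σ C c' ĉ D * (K₀ : ℝ) ^ 2 / (σ ^ (1 / 3 : ℝ)) ^ 2 + 1,
      by positivity, fun Ψ hΨ => ?_⟩
    have hΨ0 : 0 < Ψ := lt_of_lt_of_le (by positivity) hΨ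
    refine ⟨min 1 (Ψ ^ (3 / 2 : ℝ) * σ / ((K₀ + 1) * B ^ 2)),
      ((K₀ : ℝ) * (c' * σ ^ (8 / 3 : ℝ) + 3) * (Ψ ^ (3 / 2 : ℝ) * σ + B)) + 1,
      lt_min one_pos (by positivity), by positivity, ?_⟩
    intro S A _ _ q P Q θ₀ hP hQ hF hθ₀ hD ε m K c hε hK hK₀ hm hcfg hor hW
    subst hcfg
    have hc := hadm hε hK hK₀ (hceil hm) hor
    have hS := (hclass S A q P hP).mono hL hσ₀.le hσ hC
    have hprox := (hQ.continuous_proxStep hc.η_pos).measurable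
    have hbound := HSPG.add_mul_stageNoise_le_sq hL' hσ' hC' hc' hĉ hB D hK hK₀
      ((le_add_of_nonneg_right zero_le_one).trans hΨ) hε (hceil hm)
    refine ⟨hP.accurate_restartOutput hγ0 hγ1 hQ hS hc hF hθ₀ hD hK hW hbound, fun hε1 => ?_⟩
    obtain ⟨h1, h2⟩ := HSPG.stage_costs_le (L := L) (C := C) (ĉ := ĉ) hσ' hc' hB hΨ0 hε hε1
      hK hK₀ hm
    have hT : ∀ y : ℝ, y / ε ^ 3 ≤ (y + 1) / ε ^ 3 := fun y =>
      div_le_div_of_nonneg_right (by linarith) (by positivity)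
    refine (hP.ae_stageStart_counters hprox θ₀ K).mono fun x hx => ?_
    rw [hx]
    exact ⟨h1.trans (hT _), h2.trans (hT _)⟩
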